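/- **Setting.** Consider $N$ qubits ($N$ odd) at sites $1,\dots,N$. A *resource state of range $\xi$* is a state $|\Phi\rangle=U|+\rangle^{\otimes N}$ such that (i) $U$ is a unitary for which, for all $k$, conjugation $A\mapsto U^\dagger AU$ maps operators supported on $\{i\le k\}$ to operators supported on $\{i\le k+\xi\}$, and operators supported on $\{i>k\}$ to operators supported on $\{i>k-\xi\}$; and (ii) $|\Phi\rangle$ is invariant under $Z_1X_2X_4\cdots X_{N-1}Z_N$ and $X_1X_3\cdots X_N$. String order operators are $\mathcal K_{\ge k}=Z_kX_{k+1}X_{k+3}\cdots X_{N-1}Z_N$ for $k$ odd, $\mathcal K_{\ge k}=Z_kX_{k+1}X_{k+3}\cdots X_N$ for $k$ even, and $\mathcal K_{k,l}=Z_kX_{k+1}X_{k+3}\cdots X_{l-1}Z_l$ for $l-k>0$ even. *Measurement-based computation.* Site $i<N$ is measured in the eigenbasis of $\cos\gamma_i X_i-(-1)^{q_i}\sin\gamma_i Y_i$, with outcome $s_i\in\{0,1\}$ and $q_i=s_{i-1}+s_{i-3}+\cdots$. With $\tilde O_i=\sum_{\mathbf s}(-1)^{s_i}|\mathbf s\rangle\langle\mathbf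 s|$, where $|\mathbf s\rangle$ are the states of the adaptive measurement basis, the logical observables are $\overline{\mathcal X}=X_N\prod_{i<N\text{ odd}}\tilde O_i$, $\overline{\mathcal Y}=Y_N\prod_{i<N}\tilde O_i$, $\overline{\mathcal Z}=Z_N\prod_{i<N\text{ even}}\tilde O_i$, and the logical state is $\frac12(I+\langle\overline{\mathcal X}\rangle X+\langle\overline{\mathcal Y}\rangle Y+\langle\overline{\mathcal Z}\rangle Z)$, expectation values being taken in $|\Phi\rangle$. Sites $1,\dots,P$ ($P\ge1$) are measured at arbitrary angles (preparation of the input). The $m\ge1$ sites $a,a+\Delta,\dots,a+(m-1)\Delta<N$, where $\Delta>0$ is even, $a>P+2\xi$, and $a$ is odd for a $z$-rotation and even for an $x$-rotation, are measured at the angle $\gamma=\beta_{\log}/(m\langle\mathcal K_\ge\rangle)$. All other sites are measured at angle $0$. Along the rotation sites the string order is translation invariant: $\langle\mathcal K_{\ge k}\rangle=\langle\mathcal K_\ge\rangle\neq0$ for all rotation sites $k$, and $\langle\mathcal K_{k,l}\rangle=\langle\mathcal K(l-k)\rangle$ depends only on $l-k$ for rotation sites $k<l$. *Logical operation and error.*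 Let $\mathcal M$ be the linear map on $2\times2$ matrices that fixes $I$ and acts on the Bloch vector $(x,y,z)$ by the matrix $\langle\prod_{k=0}^{m-1}M_k\rangle$ (entrywise expectation value in $|\Phi\rangle$), where for a $z$-rotation $$M_k=\begin{pmatrix}\cos\gamma&-\sin\gamma\,\mathcal K_{\ge a+k\Delta}&0\\ \sin\gamma\,\mathcal K_{\ge a+k\Delta}&\cos\gamma&0\\0&0&1\end{pmatrix},$$ and for an $x$-rotation $M_k$ is the matrix with the same $2\times2$ rotation block in the $(y,z)$ coordinates and $1$ in the $x$ coordinate. Let $\mathcal R$ be the exact rotation by $\beta_{\log}$ about the axis. The logical error is $\mathcal D_m=\sqrt{2\,\mathrm{Tr}[(M-R)^\dagger(M-R)]}$, where $M,R$ are the $4\times4$ matrices of $\mathcal M,\mathcal R$ in the basis $I,X,Y,Z$. **Theorem.** Fix the axis ($x$ or $z$), the range $\xi$, an even spacing $\Delta>0$, the angle $\beta_{\log}\in\mathbb R$ and a value $\langle\mathcal K_\ge\rangle\ne0$. There is a constant $C$ such that for all $N,m,P,a$ and all resource states $|\Phi\rangle$ of range $\xi$ as above: 1. $\mathcal M$ is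 the logical operation implemented by the computation: for every choice of the preparation angles, $\mathcal M$ maps the logical state obtained with angle $0$ on the rotation sites to the logical state obtained with angle $\gamma$ on them; 2. $\displaystyle\Big|\mathcal D_m-\beta_{\log}^2\,\frac{\kappa}{m}\Big|\le\frac{C}{m^2}$ with $$\kappa=\Big(1+2\sum_{j=1}^{m-1}f(j\Delta)\Big)\Big(\frac1{\langle\mathcal K_\ge\rangle^2}-1\Big),\qquad f(d)=\frac{\langle\mathcal K(d)\rangle-\langle\mathcal K_\ge\rangle^2}{1-\langle\mathcal K_\ge\rangle^2}$$ (with $\kappa=0$ if $\langle\mathcal K_\ge\rangle^2=1$). Moreover the error can be made arbitrarily small by splitting: for every $\varepsilon>0$ there is $m_0$, depending only on $\varepsilon$ and the fixed data, such that $\mathcal D_m<\varepsilon$ for all $m\ge m_0$ and all such computations. -/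

import Mathlib

open scoped Matrix

noncomputable section

namespace ClusterMBQC

/-! ### Qubit chains.  The `N` sites of a chain are numbered `1, …, N`; the site with number `k`
is the element `k - 1` of `Fin N`. -/

/-- Labels of the computational basis of `N` qubits. -/
abbrev Config (N : ℕ) := Fin N → Fin 2

/-- State vectors of `N` qubits, in the computational basis. -/
abbrev Vec (N : ℕ) := Config N → ℂ

/-- Linear operators on `N` qubits, in the computational basis. -/
abbrev Op (N : ℕ) := Matrix (Config N) (Config N) ℂ

/-- Linear operators on one qubit. -/
abbrev Qubit := Matrix (Fin 2) (Fin 2) ℂ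

def pauliX : Qubit := !![0, 1; 1, 0]
def pauliY : Qubit := !![0, -Complex.I; Complex.I, 0]
def pauliZ : Qubit := !![1, 0; 0, -1]

/-- The operator `A 1 ⊗ A 2 ⊗ ⋯ ⊗ A N`. -/
def tensorOp (N : ℕ) (A : ℕ → Qubit) : Op N :=
  Matrix.of fun c c' => ∏ i : Fin N, A ((i : ℕ) + 1) (c i) (c' i)

/-- The one-qubit operator `A` acting on site `k`. -/
def siteOp (N k : ℕ) (A : Qubit) : Op N :=
  tensorOp N fun i => if i = k then A else 1

/-- The expectation value `⟨Φ|A|Φ⟩`. -/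
def expval {N : ℕ} (Φ : Vec N) (A : Op N) : ℂ := star Φ ⬝ᵥ (A *ᵥ Φ)

/-! ### Symmetry and string order -/

/-- `Z₁ X₂ X₄ ⋯ X_{N-1} Z_N` -/
def symm0 (N : ℕ) : Op N :=
  tensorOp N fun i => if i = 1 ∨ i = N then pauliZ else if Even i then pauliX else 1

/-- `X₁ X₃ ⋯ X_N` -/
def symm1 (N : ℕ) : Op N :=
  tensorOp N fun i => if Odd i then pauliX else 1

/-- The string order operator `𝒦_{≥ k}` for `k < N`, `N` odd: it is
`Z_k X_{k+1} X_{k+3} ⋯ X_{N-1} Z_N` for odd `k` and `Z_k X_{k+1} X_{k+3} ⋯ X_N` for even `k`. -/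
def stringGe (N k : ℕ) : Op N :=
  tensorOp N fun i =>
    if i = k then pauliZ
    else if k < i ∧ Odd (i - k) then pauliX
    else if i = N ∧ Odd k then pauliZ
    else 1

/-- The string order operator `𝒦_{k,l} = Z_k X_{k+1} X_{k+3} ⋯ X_{l-1} Z_l` for `k < l` of the
same parity. -/
def stringBetween (N k l : ℕ) : Op N :=
  tensorOp N fun i =>
    if i = k ∨ i = l then pauliZ
    else if k < i ∧ i < l ∧ Odd (i - k) then pauliX
    else 1

/-! ### Short-range entangled resource states -/

open Classical in
/-- The support of `A` is contained in the set `S` of sites: `A = B ⊗ 1` with `B` an operator on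
the qubits in `S`. -/
def SupportedOn {N : ℕ} (A : Op N) (S : Set ℕ) : Prop :=
  ∃ B : Matrix ({i : Fin N // (i : ℕ) + 1 ∈ S} → Fin 2) ({i : Fin N // (i : ℕ) + 1 ∈ S} → Fin 2) ℂ,
    ∀ c c' : Config N,
      A c c' = if ∀ i : Fin N, (i : ℕ) + 1 ∉ S → c i = c' i
        then B (fun i => c i.1) (fun i => c' i.1) else 0

/-- `U` is a short-range entangled circuit with entanglement range `ξ`. -/
structure IsShortRangeCircuit {N : ℕ} (ξ : ℕ) (U : Op N) : Prop where
  unitary : U ∈ Matrix.unitaryGroup (Config N) ℂ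
  left : ∀ (k : ℕ) (A : Op N), SupportedOn A {i | i ≤ k} →
    SupportedOn (Uᴴ * A * U) {i | i ≤ k + ξ}
  right : ∀ (k : ℕ) (A : Op N), SupportedOn A {i | k < i} →
    SupportedOn (Uᴴ * A * U) {i | k < i + ξ}

/-- The product state `|+⟩|+⟩⋯|+⟩`. -/
def plusState (N : ℕ) : Vec N := fun _ => ((1 / Real.sqrt 2 : ℝ) : ℂ) ^ N

/-- `Φ` is a short-range entangled state of range `ξ` on an odd chain, invariant under the
`ℤ₂ × ℤ₂` symmetry. -/
structure IsResourceState {N : ℕ} (ξ : ℕ) (Φ : Vec N) : Prop where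
  odd : Odd N
  short_range : ∃ U : Op N, IsShortRangeCircuit ξ U ∧ Φ = U *ᵥ plusState N
  invariant0 : symm0 N *ᵥ Φ = Φ
  invariant1 : symm1 N *ᵥ Φ = Φ

/-! ### Measurement-based computation on the chain -/

/-- The number (mod 2: the bit `q_i`) of outcomes `1` at the sites `i - 1, i - 3, …`, which decides
the measurement basis at site `i`. -/
def signFlip {N : ℕ} (s : Config N) (i : Fin N) : ℕ :=
  ∑ j : Fin N, if j < i ∧ Odd ((i : ℕ) - (j : ℕ)) then (s j : ℕ) else 0

/-- The one-qubit observable `cos γ X - (-1)^q sin γ Y`. -/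
def localObservable (γ : ℝ) (q : ℕ) : Qubit :=
  (Real.cos γ : ℂ) • pauliX - ((-1 : ℂ) ^ q * (Real.sin γ : ℂ)) • pauliY

/-- The normalized eigenvector of `cos γ X - (-1)^q sin γ Y` with eigenvalue `(-1)^s`. -/
def localVec (γ : ℝ) (q s : ℕ) : Fin 2 → ℂ :=
  ((1 / Real.sqrt 2 : ℝ) : ℂ) •
    ![1, (-1 : ℂ) ^ s * Complex.exp (-(Complex.I * (-1 : ℂ) ^ q * (γ : ℂ)))]

theorem localObservable_mulVec_localVec (γ : ℝ) (q s : ℕ) :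
    localObservable γ q *ᵥ localVec γ q s = (-1 : ℂ) ^ s • localVec γ q s := by
  have hs : ((-1 : ℂ) ^ s) * (-1) ^ s = 1 := by rw [← mul_pow]; simp
  have e1 : Complex.exp (-(Complex.I * (-1 : ℂ) ^ q * (γ : ℂ)))
      = Complex.cos γ - (-1) ^ q * Complex.sin γ * Complex.I := by
    rcases Nat.even_or_odd q with h | h
    · rw [h.neg_one_pow, show -(Complex.I * 1 * (γ : ℂ)) = (-γ : ℂ) * Complex.I by ring,
        Complex.exp_mul_I, Complex.cos_neg, Complex.sin_neg]; ring
    · rw [h.neg_one_pow, show -(Complex.I * -1 * (γ : ℂ)) = (γ : ℂ) * Complex.I by ring,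
        Complex.exp_mul_I]; ring
  have hq : ((-1 : ℂ) ^ q) ^ 2 = 1 := by rw [← pow_mul, mul_comm, pow_mul]; simp
  have hcs := Complex.sin_sq_add_cos_sq (γ : ℂ)
  have hI := Complex.I_sq
  funext i
  fin_cases i
  · simp [localObservable, localVec, pauliX, pauliY, e1, Matrix.mulVec, dotProduct]
    grind
  · simp [localObservable, localVec, pauliX, pauliY, e1, Matrix.mulVec, dotProduct]
    grind

/-- The measurement basis state `|𝐬⟩ = ⨂ᵢ |γᵢ, qᵢ(𝐬), sᵢ⟩` belonging to the measurement angles `γ`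
and the measurement record `𝐬`. -/
def recordVec {N : ℕ} (γ : ℕ → ℝ) (s : Config N) : Vec N :=
  fun c => ∏ i : Fin N, localVec (γ ((i : ℕ) + 1)) (signFlip s i) (s i : ℕ) (c i)

/-- The observable `∑_𝐬 (-1)^{sᵢ} |𝐬⟩⟨𝐬|` measured at a site, with the adaptation of the
measurement bases taken into account. -/
def decorated (N : ℕ) (γ : ℕ → ℝ) (i : Fin N) : Op N :=
  ∑ s : Config N, ((-1 : ℂ) ^ (s i : ℕ)) • Matrix.vecMulVec (recordVec γ s) (star (recordVec γ s))

/-- The product of the decorated observables over all sites `k < N` with property `p`. -/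
def decoratedProd (N : ℕ) (γ : ℕ → ℝ) (p : ℕ → Prop) [DecidablePred p] : Op N :=
  (((List.finRange N).filter fun i : Fin N => (i : ℕ) + 1 < N ∧ p ((i : ℕ) + 1)).map (decorated N γ)).prod

def logicalX (N : ℕ) (γ : ℕ → ℝ) : Op N :=
  siteOp N N pauliX * decoratedProd N γ fun k => Odd k

def logicalY (N : ℕ) (γ : ℕ → ℝ) : Op N :=
  siteOp N N pauliY * decoratedProd N γ fun _ => True

def logicalZ (N : ℕ) (γ : ℕ → ℝ) : Op N :=
  siteOp N N pauliZ * decoratedProd N γ fun k => Even k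

/-- The state of the logical qubit at readout, reconstructed from the three logical Pauli
expectation values, when the resource state `Φ` is measured at the angles `γ`. -/
def logicalState {N : ℕ} (Φ : Vec N) (γ : ℕ → ℝ) : Qubit :=
  (1 / 2 : ℂ) • (1 + expval Φ (logicalX N γ) • pauliX + expval Φ (logicalY N γ) • pauliY
    + expval Φ (logicalZ N γ) • pauliZ)

/-- The sites `a, a + Δ, …, a + (m - 1) Δ` of the symmetry-breaking measurements. -/
def rotationSites (a Δ m : ℕ) : Finset ℕ := (Finset.range m).image fun k => a + k * Δ

/-- Measurement angles of the computation without a rotation: arbitrary angles `θ` on the sites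
`1, …, P` (preparation of the logical input), angle `0` (the `X`-basis) on all others. -/
def inputAngles (θ : ℕ → ℝ) (P : ℕ) : ℕ → ℝ :=
  fun i => if i ≤ P then θ i else 0

/-- The same computation with the angle `γ` on the rotation sites. -/
def rotationAngles (θ : ℕ → ℝ) (P a Δ m : ℕ) (γ : ℝ) : ℕ → ℝ :=
  fun i => if i ≤ P then θ i else if i ∈ rotationSites a Δ m then γ else 0

/-! ### Logical operations and their distance -/

/-- The axis of a logical rotation. -/
inductive Axis
  | x
  | z

/-- `z`-rotations use the odd sites, `x`-rotations the even sites. -/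
def Axis.parity : Axis → ℕ → Prop
  | .x, a => Even a
  | .z, a => Odd a

def Axis.pauli : Axis → Qubit
  | .x => pauliX
  | .z => pauliZ

/-- The rotation `ρ ↦ V ρ V†` with `V = exp(-i β P / 2)`, where `P` is the Pauli matrix of the
axis. -/
def logicalRotation (axis : Axis) (β : ℝ) : Qubit →ₗ[ℂ] Qubit :=
  let V : Qubit := (Real.cos (β / 2) : ℂ) • 1 - (Complex.I * (Real.sin (β / 2) : ℂ)) • axis.pauli
  (LinearMap.mulLeft ℂ V).comp (LinearMap.mulRight ℂ Vᴴ)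

/-- The operator-valued matrix by which one symmetry-breaking measurement at angle `γ`, with string
order operator `K`, transforms the logical Pauli observables. -/
def stepMatrix {N : ℕ} (axis : Axis) (γ : ℝ) (K : Op N) : Matrix (Fin 3) (Fin 3) (Op N) :=
  match axis with
  | .z => !![(Real.cos γ : ℂ) • 1, -((Real.sin γ : ℂ) • K), 0;
             (Real.sin γ : ℂ) • K, (Real.cos γ : ℂ) • 1, 0;
             0, 0, 1]
  | .x => !![1, 0, 0;
             0, (Real.cos γ : ℂ) • 1, -((Real.sin γ : ℂ) • K);
             0, (Real.sin γ : ℂ) • K, (Real.cos γ : ℂ) • 1]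

/-- The matrix `⟨∏ₖ Mₖ(γ)⟩` (entrywise expectation value). -/
def blochMatrix {N : ℕ} (Φ : Vec N) (axis : Axis) (a Δ m : ℕ) (γ : ℝ) : Matrix (Fin 3) (Fin 3) ℂ :=
  (((List.range m).map fun k => stepMatrix axis γ (stringGe N (a + k * Δ))).prod).map (expval Φ)

def paulis : Fin 3 → Qubit := ![pauliX, pauliY, pauliZ]

/-- The linear map with `1 ↦ 1` that acts on the Bloch vector by the matrix `B`, i.e.
`σ_j ↦ ∑ i, B i j σ_i`. -/
def blochMap (B : Matrix (Fin 3) (Fin 3) ℂ) : Qubit →ₗ[ℂ] Qubit where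
  toFun A := (1 / 2 : ℂ) • (A.trace • (1 : Qubit)
    + ∑ i, ∑ j, (B i j * (paulis j * A).trace) • paulis i)
  map_add' A A' := by
    simp only [Matrix.trace_add, mul_add, add_smul, Finset.sum_add_distrib, smul_add]
    abel
  map_smul' c A := by
    simp only [Matrix.trace_smul, Matrix.mul_smul, smul_eq_mul, RingHom.id_apply, Finset.smul_sum,
      smul_add, smul_smul]
    congr 1
    · congr 1; ring
    · refine Finset.sum_congr rfl fun i _ => Finset.sum_congr rfl fun j _ => ?_
      congr 1; ring

/-- The logical operation implemented by `m` symmetry-breaking measurements at angle `γ`. -/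
def logicalOp {N : ℕ} (Φ : Vec N) (axis : Axis) (a Δ m : ℕ) (γ : ℝ) : Qubit →ₗ[ℂ] Qubit :=
  blochMap (blochMatrix Φ axis a Δ m γ)

def pauliBasis : Fin 4 → Qubit := ![1, pauliX, pauliY, pauliZ]

/-- The `4 × 4` matrix `M` of `T` in the basis `1, X, Y, Z`:  `T (σ_j) = ∑ i, M i j σ_i`. -/
def pauliMatrix (T : Qubit →ₗ[ℂ] Qubit) : Matrix (Fin 4) (Fin 4) ℂ :=
  Matrix.of fun i j => (1 / 2 : ℂ) * (pauliBasis i * T (pauliBasis j)).trace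

/-- The distance `√(2 Tr[(M - R)†(M - R)])` of two one-qubit operations. -/
def opDist (T T' : Qubit →ₗ[ℂ] Qubit) : ℝ :=
  Real.sqrt (2 * (((pauliMatrix T' - pauliMatrix T)ᴴ * (pauliMatrix T' - pauliMatrix T)).trace).re)

/-- The measurement angle `β / (m ⟨𝒦_≥⟩)` at each of the `m` rotation sites, with `σ = ⟨𝒦_≥⟩`. -/
def splitAngle (β σ : ℝ) (m : ℕ) : ℝ := β / (m * σ)

/-- The logical error `𝒟_m` of the rotation by `β`, split into `m` measurements. -/
def logicalError {N : ℕ} (Φ : Vec N) (axis : Axis) (a Δ m : ℕ) (β σ : ℝ) : ℝ :=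
  opDist (logicalRotation axis β) (logicalOp Φ axis a Δ m (splitAngle β σ m))

/-! ### The setting and the constant -/

/-- The layout of the computation: preparation on the sites `1, …, P`, then a buffer that exceeds
twice the entanglement range, then `m ≥ 1` rotation sites at spacing `Δ` beginning with site `a`, of
the parity that belongs to the axis, and the readout at site `N`. -/
structure IsLayout (axis : Axis) (ξ Δ N m P a : ℕ) : Prop where
  steps_pos : 0 < m
  prep_pos : 0 < P
  parity : axis.parity a
  buffer : P + 2 * ξ < a
  readout : a + (m - 1) * Δ < N

/-- Translation invariance of the string order parameters along the set `S` of sites: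
`⟨𝒦_{≥ k}⟩ = σ`, and `⟨𝒦_{k,l}⟩ = K (l - k)` depends on the distance only. -/
def IsHomogeneous {N : ℕ} (Φ : Vec N) (S : Finset ℕ) (σ : ℝ) (K : ℕ → ℝ) : Prop :=
  (∀ k ∈ S, expval Φ (stringGe N k) = (σ : ℂ)) ∧
  ∀ k ∈ S, ∀ l ∈ S, k < l → expval Φ (stringBetween N k l) = (K (l - k) : ℂ)

/-- The normalized connected string-order correlation
`f(d) = (⟨𝒦(d)⟩ - ⟨𝒦_≥⟩²) / (1 - ⟨𝒦_≥⟩²)`. -/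
def corr (σ : ℝ) (K : ℕ → ℝ) (d : ℕ) : ℝ := (K d - σ ^ 2) / (1 - σ ^ 2)

/-- `κ = (1 + 2 ∑_{j=1}^{m-1} f(jΔ)) (1/⟨𝒦_≥⟩² - 1)` -/
def kappa (σ : ℝ) (K : ℕ → ℝ) (Δ m : ℕ) : ℝ :=
  (1 + 2 * ∑ j ∈ Finset.Ico 1 m, corr σ K (j * Δ)) * (1 / σ ^ 2 - 1)

end ClusterMBQC

end

/-!
The proof works in the Heisenberg picture. On a measurement basis state, the product of the
decorated observables at the sites `n - 1, n - 3, …` is the sign of the outcomes there; this gives a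
recursion which expresses these products (`chain`) by Pauli operators. If the later sites of the
other sublattice are measured in the `X` basis, then switching on an angle at a site `b` multiplies
the later products on the sublattice of `b` by a rotation generated by `Z_b` times the adaptation
sign `(-1)^{q_b}` (`chain_update_of_odd`). This generator is the string order operator `𝒦_{≥ b}`
times the logical observable along the axis, so that the vector of the three logical observables is
multiplied by the operator-valued step matrix (`logicalVec_update`), and by the product of these
matrices for all rotation sites.

With angle `0` on the rotation sites, the symmetry of the resource state turns the logical
observables into operators on the sites `1, …, P` (`exists_logicalVec_mulVec`). These are far from
the string order operators, which live to the right of `a > P + 2ξ`, and in a state of range `ξ` the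
expectation value of a product of distant operators factorizes (`expval_mul_of_distant`): pulled back
to the product state, the two factors have disjoint supports. This is the first claim
(`logicalState_rotationAngles`).

For the error, the string order operators that begin at sites of one parity are diagonalized
simultaneously by Hadamard gates on the other sublattice. In a given state they become random
variables with the values `±1`, the matrix of the logical operation is an average of rotations, and
`𝒟_m = 2 |E e^{iγS} - e^{iβ}|` with the sum `S` of the `m` variables and `γ = β / (m ⟨𝒦_≥⟩)`
(`logicalError_eq`). Since `γ E S = β`, only the deviations from the mean contribute.

By the symmetry, a string order operator can act from the site `k` to the left as well as to the
right, hence the deviations at sites more than `2ξ` apart are independent in the sense of moments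
(`sum_spectralWeight_mul_of_distant`). Consequently the variance of `S` is `m` times a sum of
covariances up to a bounded term, its third central moment is `O(m)`, and its fourth is `O(m²)`. A
Taylor expansion of the characteristic function, with `γ = O(1/m)`, gives
`𝒟_m = γ² Var S + O(1/m²)` (`abs_logicalError_sub_le`), and `γ² Var S` is `β² κ / m` up to
`O(1/m²)`. The convergence `𝒟_m → 0` follows, as `κ` is bounded in terms of `ξ` and `⟨𝒦_≥⟩`.
-/

open scoped Matrix

namespace ClusterMBQC

/-! ### Tensor products of one-qubit operators -/

theorem tensorOp_mul (N : ℕ) (A B : ℕ → Qubit) :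
    tensorOp N A * tensorOp N B = tensorOp N fun i => A i * B i := by
  ext c c'
  simp only [tensorOp, Matrix.mul_apply, Matrix.of_apply, ← Finset.prod_mul_distrib]
  rw [Finset.prod_univ_sum, Fintype.piFinset_univ]

theorem tensorOp_congr {N : ℕ} {A B : ℕ → Qubit} (h : ∀ i, 1 ≤ i → i ≤ N → A i = B i) :
    tensorOp N A = tensorOp N B := by
  ext c c'
  simp only [tensorOp, Matrix.of_apply]
  exact Finset.prod_congr rfl fun i _ => by rw [h _ (by omega) (by omega)]

theorem tensorOp_diagonal (N : ℕ) (d : ℕ → Fin 2 → ℂ) :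
    tensorOp N (fun i => Matrix.diagonal (d i)) =
      Matrix.diagonal fun c => ∏ i : Fin N, d ((i : ℕ) + 1) (c i) := by
  ext c c'
  simp only [tensorOp, Matrix.of_apply, Matrix.diagonal_apply]
  split_ifs with h
  · subst h; simp
  · obtain ⟨i, hi⟩ := Function.ne_iff.mp h
    exact Finset.prod_eq_zero (Finset.mem_univ i) (if_neg hi)

theorem tensorOp_one (N : ℕ) : tensorOp N (fun _ => 1) = 1 := by
  simpa using tensorOp_diagonal N fun _ _ => 1

theorem tensorOp_conjTranspose (N : ℕ) (A : ℕ → Qubit) :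
    (tensorOp N A)ᴴ = tensorOp N fun i => (A i)ᴴ := by
  ext c c'
  simp [tensorOp, Matrix.conjTranspose_apply]

theorem tensorOp_mulVec {N : ℕ} (A : ℕ → Qubit) (v : Fin N → Fin 2 → ℂ) :
    tensorOp N A *ᵥ (fun c => ∏ i, v i (c i)) =
      fun c => ∏ i : Fin N, (A ((i : ℕ) + 1) *ᵥ v i) (c i) := by
  funext c
  simp only [tensorOp, Matrix.mulVec, dotProduct, Matrix.of_apply, ← Finset.prod_mul_distrib]
  rw [Finset.prod_univ_sum, Fintype.piFinset_univ]

theorem tensorOp_mul_self {N : ℕ} {A : ℕ → Qubit} (h : ∀ i, A i * A i = 1) :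
    tensorOp N A * tensorOp N A = 1 := by
  rw [tensorOp_mul, ← tensorOp_one]
  exact tensorOp_congr fun i _ _ => h i

/-! ### Pauli matrices and operators on one site -/

theorem pauliX_mul_self : pauliX * pauliX = 1 := by
  ext i j; fin_cases i <;> fin_cases j <;> simp [pauliX]

theorem pauliZ_mul_self : pauliZ * pauliZ = 1 := by
  ext i j; fin_cases i <;> fin_cases j <;> simp [pauliZ]

theorem pauliZ_mul_pauliX : pauliZ * pauliX = -(pauliX * pauliZ) := by
  ext i j; fin_cases i <;> fin_cases j <;> simp [pauliX, pauliZ]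

theorem pauliY_eq : pauliY = Complex.I • (pauliX * pauliZ) := by
  ext i j; fin_cases i <;> fin_cases j <;> simp [pauliX, pauliY, pauliZ]

theorem siteOp_apply {N : ℕ} (i : Fin N) (A : Qubit) (c c' : Config N) :
    siteOp N ((i : ℕ) + 1) A c c' =
      A (c i) (c' i) * ∏ j ∈ Finset.univ.erase i, (1 : Qubit) (c j) (c' j) := by
  rw [siteOp, tensorOp, Matrix.of_apply, ← Finset.mul_prod_erase _ _ (Finset.mem_univ i), if_pos rfl]
  congr 1
  refine Finset.prod_congr rfl fun j hj => ?_
  rw [if_neg]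
  intro h
  exact (Finset.mem_erase.mp hj).1 (Fin.ext (by omega))

theorem siteOp_mul (N k : ℕ) (A B : Qubit) : siteOp N k A * siteOp N k B = siteOp N k (A * B) := by
  rw [siteOp, siteOp, siteOp, tensorOp_mul]
  exact tensorOp_congr fun i _ _ => by split_ifs <;> simp

theorem siteOp_one (N k : ℕ) : siteOp N k 1 = 1 := by
  rw [siteOp, ← tensorOp_one]
  exact tensorOp_congr fun i _ _ => by split_ifs <;> rfl

theorem siteOp_mul_self {N k : ℕ} {A : Qubit} (h : A * A = 1) :
    siteOp N k A * siteOp N k A = 1 := by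
  rw [siteOp_mul, h, siteOp_one]

theorem exists_fin_of_site {N k : ℕ} (h1 : 1 ≤ k) (h2 : k ≤ N) : ∃ i : Fin N, (i : ℕ) + 1 = k :=
  ⟨⟨k - 1, by omega⟩, by simp; omega⟩

theorem siteOp_smul {N k : ℕ} (h1 : 1 ≤ k) (h2 : k ≤ N) (z : ℂ) (A : Qubit) :
    siteOp N k (z • A) = z • siteOp N k A := by
  obtain ⟨i, rfl⟩ := exists_fin_of_site h1 h2
  ext c c'
  rw [Matrix.smul_apply, siteOp_apply, siteOp_apply, Matrix.smul_apply, smul_eq_mul, smul_eq_mul,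
    mul_assoc]

theorem siteOp_sub {N k : ℕ} (h1 : 1 ≤ k) (h2 : k ≤ N) (A B : Qubit) :
    siteOp N k (A - B) = siteOp N k A - siteOp N k B := by
  obtain ⟨i, rfl⟩ := exists_fin_of_site h1 h2
  ext c c'
  rw [Matrix.sub_apply, siteOp_apply, siteOp_apply, siteOp_apply, Matrix.sub_apply, sub_mul]

theorem siteOp_pauliY {N k : ℕ} (h1 : 1 ≤ k) (h2 : k ≤ N) :
    siteOp N k pauliY = Complex.I • (siteOp N k pauliX * siteOp N k pauliZ) := by
  rw [pauliY_eq, siteOp_smul h1 h2, siteOp_mul]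

theorem siteOp_pauliZ_mul_pauliX {N k : ℕ} (h1 : 1 ≤ k) (h2 : k ≤ N) :
    siteOp N k pauliZ * siteOp N k pauliX = -(siteOp N k pauliX * siteOp N k pauliZ) := by
  rw [siteOp_mul, siteOp_mul, pauliZ_mul_pauliX, ← neg_one_smul ℂ (pauliX * pauliZ),
    siteOp_smul h1 h2, neg_one_smul]

/-! ### The algebra of operators supported on a set of sites -/

/-- The operators supported on the set `S` of sites. In the computational basis, the kernel of such
an operator does not change the spins outside of `S`, and is invariant under flipping a spin outside
of `S` in both arguments. Here `Config N` is seen as the group `(ℤ/2)^N`, so that adding `u` flips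
the spins where `u` is `1`. -/
def localAlg (N : ℕ) (S : Set ℕ) : Subalgebra ℂ (Op N) where
  carrier := {A | (∀ u c c' : Config N, (∀ i : Fin N, (i : ℕ) + 1 ∈ S → u i = 0) →
      A (c + u) (c' + u) = A c c') ∧
    ∀ c c' : Config N, A c c' ≠ 0 → ∀ i : Fin N, (i : ℕ) + 1 ∉ S → c i = c' i}
  mul_mem' := by
    rintro A B ⟨hA, hA'⟩ ⟨hB, hB'⟩
    refine ⟨fun u c c' hu => ?_, fun c c' h i hi => ?_⟩
    · rw [Matrix.mul_apply, Matrix.mul_apply, ← Equiv.sum_comp (Equiv.addRight u)]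
      exact Finset.sum_congr rfl fun d _ => by
        rw [Equiv.coe_addRight, hA u _ _ hu, hB u _ _ hu]
    · rw [Matrix.mul_apply] at h
      obtain ⟨d, -, hd⟩ := Finset.exists_ne_zero_of_sum_ne_zero h
      rw [hA' c d (left_ne_zero_of_mul hd) i hi, hB' d c' (right_ne_zero_of_mul hd) i hi]
  add_mem' := by
    rintro A B ⟨hA, hA'⟩ ⟨hB, hB'⟩
    refine ⟨fun u c c' hu => ?_, fun c c' h i hi => ?_⟩
    · rw [Matrix.add_apply, Matrix.add_apply, hA u _ _ hu, hB u _ _ hu]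
    · by_cases hz : A c c' = 0
      · exact hB' c c' (fun hz' => h (by rw [Matrix.add_apply, hz, hz', add_zero])) i hi
      · exact hA' c c' hz i hi
  algebraMap_mem' := by
    intro r
    refine ⟨fun u c c' _ => ?_, fun c c' h i _ => ?_⟩
    · simp [Matrix.algebraMap_matrix_apply]
    · rw [Matrix.algebraMap_matrix_apply] at h
      have : c = c' := by
        by_contra hc
        exact h (if_neg hc)
      rw [this]

theorem supportedOn_iff {N : ℕ} (A : Op N) (S : Set ℕ) : SupportedOn A S ↔ A ∈ localAlg N S := by
  classical
  constructor
  · rintro ⟨B, hB⟩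
    refine ⟨fun u c c' hu => ?_, fun c c' h i hi => ?_⟩
    · rw [hB, hB]
      have hr : ∀ d : Config N, (fun i : {i : Fin N // (i : ℕ) + 1 ∈ S} => (d + u) i.1) =
          fun i => d i.1 := fun d => funext fun i => by rw [Pi.add_apply, hu i.1 i.2, add_zero]
      rw [hr, hr]
      simp only [Pi.add_apply, add_left_inj]
    · rw [hB] at h
      by_contra hne
      exact h (if_neg fun hh => hne (hh i hi))
  · rintro ⟨hA, hA'⟩
    let ext : ({i : Fin N // (i : ℕ) + 1 ∈ S} → Fin 2) → Config N :=
      fun x i => if h : (i : ℕ) + 1 ∈ S then x ⟨i, h⟩ else 0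
    refine ⟨fun x y => A (ext x) (ext y), fun c c' => ?_⟩
    split_ifs with h
    · let u : Config N := fun i => if (i : ℕ) + 1 ∈ S then 0 else c i
      have key : ∀ d : Config N, (∀ i : Fin N, (i : ℕ) + 1 ∉ S → c i = d i) →
          ext (fun i => d i.1) + u = d := by
        intro d hd
        funext i
        by_cases hi : (i : ℕ) + 1 ∈ S
        · simp [ext, u, hi]
        · simp [ext, u, hi, hd i hi]
      have := hA u (ext fun i => c i.1) (ext fun i => c' i.1) fun i hi => by simp [u, hi]
      rwa [key c fun _ _ => rfl, key c' h] at this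
    · by_contra hne
      exact h (hA' c c' hne)

theorem localAlg_mono {N : ℕ} {S T : Set ℕ} (h : S ⊆ T) : localAlg N S ≤ localAlg N T :=
  fun _ hA => ⟨fun u c c' hu => hA.1 u c c' fun i hi => hu i (h hi),
    fun c c' hne i hi => hA.2 c c' hne i fun hS => hi (h hS)⟩

theorem tensorOp_mem_localAlg {N : ℕ} {A : ℕ → Qubit} {S : Set ℕ}
    (h : ∀ i, 1 ≤ i → i ≤ N → i ∉ S → A i = 1) : tensorOp N A ∈ localAlg N S := by
  refine ⟨fun u c c' hu => ?_, fun c c' hne i hi => ?_⟩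
  · simp only [tensorOp, Matrix.of_apply]
    refine Finset.prod_congr rfl fun i _ => ?_
    by_cases hi : (i : ℕ) + 1 ∈ S
    · rw [Pi.add_apply, Pi.add_apply, hu i hi, add_zero, add_zero]
    · rw [h _ (by omega) (by omega) hi]
      simp [Matrix.one_apply]
  · by_contra hcc
    refine hne ?_
    simp only [tensorOp, Matrix.of_apply]
    refine Finset.prod_eq_zero (Finset.mem_univ i) ?_
    rw [h _ (by omega) (by omega) hi, Matrix.one_apply_ne hcc]

theorem siteOp_mem_localAlg {N k : ℕ} {S : Set ℕ} (A : Qubit) (h : k ∈ S) :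
    siteOp N k A ∈ localAlg N S :=
  tensorOp_mem_localAlg fun i _ _ hi => if_neg (by rintro rfl; exact hi h)

/-- The reason why operators with disjoint supports commute: the reflection `d ↦ c + c' - d`
matches the intermediate states in `A * B` with those in `B * A`. -/
theorem localAlg_mul_apply_eq {N : ℕ} {S T : Set ℕ} (hST : Disjoint S T) {A B : Op N}
    (hA : A ∈ localAlg N S) (hB : B ∈ localAlg N T) (c c' d : Config N)
    (h : A c d * B d c' ≠ 0) : A c d * B d c' = B c (c + c' - d) * A (c + c' - d) c' := by
  have h1 : A (c + c' - d) c' = A c d := by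
    have := hA.1 (c' - d) c d fun i hi => by
      have := hB.2 d c' (right_ne_zero_of_mul h) i fun hT => Set.disjoint_left.mp hST hi hT
      rw [Pi.sub_apply, this, sub_self]
    rwa [add_sub_cancel, ← add_sub_assoc] at this
  have h2 : B c (c + c' - d) = B d c' := by
    have := hB.1 (c - d) d c' fun i hi => by
      have := hA.2 c d (left_ne_zero_of_mul h) i fun hS => Set.disjoint_left.mp hST hS hi
      rw [Pi.sub_apply, this, sub_self]
    rwa [add_sub_cancel, ← add_sub_assoc, add_comm c' c] at this
  rw [h1, h2, mul_comm]

theorem commute_of_disjoint {N : ℕ} {S T : Set ℕ} (hST : Disjoint S T) {A B : Op N}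
    (hA : A ∈ localAlg N S) (hB : B ∈ localAlg N T) : Commute A B := by
  ext c c'
  rw [Matrix.mul_apply, Matrix.mul_apply, ← Equiv.sum_comp (Equiv.subLeft (c + c'))]
  refine Finset.sum_congr rfl fun d _ => ?_
  simp only [Equiv.subLeft_apply]
  by_cases h : B c d * A d c' = 0
  · rw [h]
    by_contra hne
    apply hne
    rw [localAlg_mul_apply_eq hST hA hB _ _ _ hne, sub_sub_cancel, h]
  · exact (localAlg_mul_apply_eq hST.symm hB hA _ _ _ h).symm

/-- Conjugation by a product of one-qubit involutions keeps the support. -/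
theorem tensorOp_conj_mem_localAlg {N : ℕ} {S : Set ℕ} {A : ℕ → Qubit} (hA : ∀ i, A i * A i = 1)
    {B : Op N} (hB : B ∈ localAlg N S) : tensorOp N A * B * tensorOp N A ∈ localAlg N S := by
  classical
  have hsplit : tensorOp N A = tensorOp N (fun i => if i ∈ S then A i else 1) *
      tensorOp N (fun i => if i ∈ S then 1 else A i) := by
    rw [tensorOp_mul]
    exact tensorOp_congr fun i _ _ => by split_ifs <;> simp
  have hsplit' : tensorOp N A = tensorOp N (fun i => if i ∈ S then 1 else A i) *
      tensorOp N (fun i => if i ∈ S then A i else 1) := by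
    rw [tensorOp_mul]
    exact tensorOp_congr fun i _ _ => by split_ifs <;> simp
  have hin : tensorOp N (fun i => if i ∈ S then A i else 1) ∈ localAlg N S :=
    tensorOp_mem_localAlg fun i _ _ hi => if_neg hi
  have hout : tensorOp N (fun i => if i ∈ S then 1 else A i) ∈ localAlg N Sᶜ :=
    tensorOp_mem_localAlg fun i _ _ hi => if_pos (not_not.mp hi)
  have hsq : tensorOp N (fun i => if i ∈ S then 1 else A i) *
      tensorOp N (fun i => if i ∈ S then 1 else A i) = 1 :=
    tensorOp_mul_self fun i => by split_ifs <;> simp [hA]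
  have hcomm := (commute_of_disjoint disjoint_compl_right hB hout).eq
  have : tensorOp N A * B * tensorOp N A = tensorOp N (fun i => if i ∈ S then A i else 1) * B *
      tensorOp N (fun i => if i ∈ S then A i else 1) := by
    nth_rewrite 1 [hsplit]
    rw [hsplit', mul_assoc _ _ B, ← hcomm]
    simp only [mul_assoc]
    rw [← mul_assoc (tensorOp N fun i => if i ∈ S then 1 else A i), hsq, one_mul]
  rw [this]
  exact mul_mem (mul_mem hin hB) hin

/-! ### Expectation values factorize over distant regions -/

/-- Functions of disjoint sets of spins are independent under the uniform distribution. -/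
theorem card_mul_sum_mul {N : ℕ} {S T : Set ℕ} (hST : Disjoint S T) {f g : Config N → ℂ}
    (hf : ∀ u c : Config N, (∀ i : Fin N, (i : ℕ) + 1 ∈ S → u i = 0) → f (c + u) = f c)
    (hg : ∀ u c : Config N, (∀ i : Fin N, (i : ℕ) + 1 ∈ T → u i = 0) → g (c + u) = g c) :
    (2 : ℂ) ^ N * ∑ c, f c * g c = (∑ c, f c) * ∑ c, g c := by
  classical
  have hsplit : ∀ c w : Config N, f c * g (c + w) =
      f (c + fun i : Fin N => if (i : ℕ) + 1 ∈ S then 0 else w i) *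
        g (c + fun i : Fin N => if (i : ℕ) + 1 ∈ S then 0 else w i) := by
    intro c w
    rw [hf _ c fun i hi => if_pos hi]
    congr 1
    have := hg (fun i : Fin N => if (i : ℕ) + 1 ∈ S then w i else 0)
      (c + fun i : Fin N => if (i : ℕ) + 1 ∈ S then 0 else w i)
      fun i hi => if_neg fun hS => Set.disjoint_left.mp hST hS hi
    rw [← this]
    congr 1
    funext i
    by_cases hi : (i : ℕ) + 1 ∈ S <;> simp [hi]
  calc (2 : ℂ) ^ N * ∑ c, f c * g c
      = ∑ w : Config N, ∑ c, f c * g c := by simp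
    _ = ∑ w : Config N, ∑ c, f c * g (c + w) := by
        refine Finset.sum_congr rfl fun w _ => ?_
        simp only [hsplit]
        exact (Equiv.sum_comp (Equiv.addRight _) fun c => f c * g c).symm
    _ = ∑ c, f c * ∑ w, g w := by
        rw [Finset.sum_comm]
        refine Finset.sum_congr rfl fun c _ => ?_
        rw [← Finset.mul_sum]
        congr 1
        exact Equiv.sum_comp (Equiv.addLeft c) g
    _ = (∑ c, f c) * ∑ c, g c := by rw [Finset.sum_mul]

theorem expval_plusState {N : ℕ} (A : Op N) :
    expval (plusState N) A = ((2 : ℂ) ^ N)⁻¹ * ∑ c, ∑ c', A c c' := by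
  have h : (((1 / Real.sqrt 2 : ℝ) : ℂ) ^ N) * (((1 / Real.sqrt 2 : ℝ) : ℂ) ^ N) =
      ((2 : ℂ) ^ N)⁻¹ := by
    rw [← mul_pow, ← Complex.ofReal_mul, ← inv_pow]
    congr 1
    rw [div_mul_div_comm, Real.mul_self_sqrt (by norm_num)]
    norm_num
  simp only [expval, dotProduct, Matrix.mulVec, plusState, Pi.star_apply, star_pow,
    Complex.star_def, Complex.conj_ofReal, ← Finset.sum_mul, ← Finset.mul_sum]
  rw [← h]
  ring

theorem expval_plusState_mul {N : ℕ} {S T : Set ℕ} (hST : Disjoint S T) {A B : Op N}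
    (hA : A ∈ localAlg N S) (hB : B ∈ localAlg N T) :
    expval (plusState N) (A * B) = expval (plusState N) A * expval (plusState N) B := by
  have h := card_mul_sum_mul hST (f := fun d => ∑ c, A c d) (g := fun d => ∑ c', B d c')
    (fun u d hu => by
      rw [← Equiv.sum_comp (Equiv.addRight u)]
      exact Finset.sum_congr rfl fun c _ => hA.1 u c d hu)
    (fun u d hu => by
      rw [← Equiv.sum_comp (Equiv.addRight u)]
      exact Finset.sum_congr rfl fun c _ => hB.1 u d c hu)
  have h2 : ∑ c, ∑ c', (A * B) c c' = ∑ d, (∑ c, A c d) * ∑ c', B d c' := by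
    simp only [Matrix.mul_apply]
    calc ∑ c, ∑ c', ∑ d, A c d * B d c' = ∑ c, ∑ d, ∑ c', A c d * B d c' :=
          Finset.sum_congr rfl fun c _ => Finset.sum_comm
      _ = ∑ d, ∑ c, ∑ c', A c d * B d c' := Finset.sum_comm
      _ = _ := by simp only [Finset.sum_mul_sum]
  have h3 : ∑ c, ∑ c', A c c' = ∑ d, ∑ c, A c d := Finset.sum_comm
  rw [expval_plusState, expval_plusState, expval_plusState, h2, h3]
  have h0 : (2 : ℂ) ^ N ≠ 0 := pow_ne_zero _ two_ne_zero
  field_simp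
  rw [h]

theorem expval_mulVec {N : ℕ} (U A : Op N) (ψ : Vec N) :
    expval (U *ᵥ ψ) A = expval ψ (Uᴴ * A * U) := by
  simp only [expval, Matrix.star_mulVec, ← Matrix.mulVec_mulVec, Matrix.dotProduct_mulVec]

theorem expval_one {N ξ : ℕ} {Φ : Vec N} (hΦ : IsResourceState ξ Φ) : expval Φ 1 = 1 := by
  obtain ⟨U, hU, rfl⟩ := hΦ.short_range
  rw [expval_mulVec, mul_one, ← Matrix.star_eq_conjTranspose,
    Matrix.mem_unitaryGroup_iff'.mp hU.unitary, expval_plusState]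
  simp [Matrix.one_apply]

/-- In a resource state, operators on the sites `≥ q` and on the sites `≤ p` are uncorrelated as
soon as `q - p` exceeds twice the entanglement range. -/
theorem expval_mul_of_distant {N ξ p q : ℕ} {Φ : Vec N} (hΦ : IsResourceState ξ Φ)
    (hpq : p + 2 * ξ < q) {A B : Op N} (hA : A ∈ localAlg N {i | q ≤ i})
    (hB : B ∈ localAlg N {i | i ≤ p}) : expval Φ (A * B) = expval Φ A * expval Φ B := by
  obtain ⟨U, hU, rfl⟩ := hΦ.short_range
  have hUU : U * Uᴴ = 1 := by
    rw [← Matrix.star_eq_conjTranspose]; exact Matrix.mem_unitaryGroup_iff.mp hU.unitary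
  have hset : {i | q ≤ i} = {i | q - 1 < i} := by ext i; simp only [Set.mem_ofPred_eq]; omega
  rw [hset] at hA
  have hA' := (supportedOn_iff _ _).mp (hU.right _ _ ((supportedOn_iff _ _).mpr hA))
  have hB' := (supportedOn_iff _ _).mp (hU.left _ _ ((supportedOn_iff _ _).mpr hB))
  have hd : Disjoint {i | q - 1 < i + ξ} {i | i ≤ p + ξ} :=
    Set.disjoint_left.mpr fun i hi hi' => by
      simp only [Set.mem_ofPred_eq] at hi hi'; omega
  rw [expval_mulVec, expval_mulVec, expval_mulVec, ← expval_plusState_mul hd hA' hB']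
  congr 1
  calc Uᴴ * (A * B) * U = Uᴴ * A * (U * Uᴴ) * B * U := by rw [hUU]; simp only [mul_assoc, one_mul]
    _ = _ := by simp only [mul_assoc]

/-! ### The adaptive measurement basis -/

theorem localVec_dotProduct (γ : ℝ) (q : ℕ) (s s' : Fin 2) :
    star (localVec γ q s) ⬝ᵥ localVec γ q s' = if s = s' then 1 else 0 := by
  have hr : (((1 / Real.sqrt 2 : ℝ) : ℂ)) * (((1 / Real.sqrt 2 : ℝ) : ℂ)) = 1 / 2 := by
    rw [← Complex.ofReal_mul, div_mul_div_comm, Real.mul_self_sqrt (by norm_num)]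
    norm_num
  have he : (starRingEnd ℂ) (Complex.exp (-(Complex.I * (-1 : ℂ) ^ q * (γ : ℂ)))) *
      Complex.exp (-(Complex.I * (-1 : ℂ) ^ q * (γ : ℂ))) = 1 := by
    rw [← Complex.exp_conj, ← Complex.exp_add]
    simp
  have key : star (localVec γ q s) ⬝ᵥ localVec γ q s' =
      ((1 / Real.sqrt 2 : ℝ) : ℂ) * ((1 / Real.sqrt 2 : ℝ) : ℂ) *
        (1 + (-1) ^ (s : ℕ) * (-1) ^ (s' : ℕ) *
          ((starRingEnd ℂ) (Complex.exp (-(Complex.I * (-1 : ℂ) ^ q * (γ : ℂ)))) *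
            Complex.exp (-(Complex.I * (-1 : ℂ) ^ q * (γ : ℂ))))) := by
    simp only [localVec, dotProduct, Fin.sum_univ_two, Pi.star_apply, Pi.smul_apply, smul_eq_mul,
      star_mul', Complex.star_def, Complex.conj_ofReal, Matrix.cons_val_zero, Matrix.cons_val_one,
      map_one, map_mul, map_pow, map_neg]
    ring
  rw [key, he, hr]
  fin_cases s <;> fin_cases s' <;> norm_num

/-- The measurement basis is orthonormal: two different records use the same local basis at the
first site where they differ. -/
theorem recordVec_dotProduct {N : ℕ} (γ : ℕ → ℝ) (s s' : Config N) :
    star (recordVec γ s) ⬝ᵥ recordVec γ s' = if s = s' then 1 else 0 := by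
  have hprod : star (recordVec γ s) ⬝ᵥ recordVec γ s' = ∏ i : Fin N,
      star (localVec (γ ((i : ℕ) + 1)) (signFlip s i) (s i : ℕ)) ⬝ᵥ
        localVec (γ ((i : ℕ) + 1)) (signFlip s' i) (s' i : ℕ) := by
    simp only [recordVec, dotProduct, Pi.star_apply, star_prod, ← Finset.prod_mul_distrib]
    rw [Finset.prod_univ_sum, Fintype.piFinset_univ]
  rw [hprod]
  split_ifs with h
  · subst h
    exact Finset.prod_eq_one fun i _ => by rw [localVec_dotProduct, if_pos rfl]
  · classical
    obtain ⟨i, hi, hmin⟩ := WellFounded.has_min (wellFounded_lt (α := Fin N)) {i | s i ≠ s' i}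
      (Function.ne_iff.mp h)
    refine Finset.prod_eq_zero (Finset.mem_univ i) ?_
    have hflip : signFlip s i = signFlip s' i := by
      refine Finset.sum_congr rfl fun j _ => ?_
      split_ifs with hj
      · have : s j = s' j := by
          by_contra hne
          exact hmin j hne hj.1
        rw [this]
      · rfl
    rw [hflip, localVec_dotProduct, if_neg hi]

/-- Since the `2 ^ N` measurement basis states are orthonormal, they form a basis, so that operator
identities can be checked on them. -/
theorem eq_of_mulVec_recordVec {N : ℕ} (γ : ℕ → ℝ) {A B : Op N}
    (h : ∀ s, A *ᵥ recordVec γ s = B *ᵥ recordVec γ s) : A = B := by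
  let W : Op N := Matrix.of fun c s => recordVec γ s c
  have hW : Wᴴ * W = 1 := by
    ext s s'
    rw [Matrix.one_apply]
    exact recordVec_dotProduct γ s s'
  have hAB : A * W = B * W := by
    ext c s
    exact congrFun (h s) c
  rw [← mul_one A, ← mul_one B, ← mul_eq_one_comm.mp hW, ← mul_assoc, hAB, mul_assoc]

theorem decorated_mulVec_recordVec {N : ℕ} (γ : ℕ → ℝ) (i : Fin N) (s : Config N) :
    decorated N γ i *ᵥ recordVec γ s = (-1 : ℂ) ^ (s i : ℕ) • recordVec γ s := by
  simp only [decorated, Matrix.sum_mulVec, Matrix.smul_mulVec, Matrix.vecMulVec_mulVec,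
    recordVec_dotProduct]
  rw [Finset.sum_eq_single s]
  · simp
  · intro t _ ht
    simp [ht]
  · simp

theorem decorated_list_prod_mulVec {N : ℕ} (γ : ℕ → ℝ) (s : Config N) (l : List (Fin N)) :
    (l.map (decorated N γ)).prod *ᵥ recordVec γ s =
      (l.map fun i => (-1 : ℂ) ^ (s i : ℕ)).prod • recordVec γ s := by
  induction l with
  | nil => simp
  | cons i l ih =>
    rw [List.map_cons, List.prod_cons, ← Matrix.mulVec_mulVec, ih, Matrix.mulVec_smul,
      decorated_mulVec_recordVec, smul_smul, List.map_cons, List.prod_cons, mul_comm]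

theorem list_prod_map_filter {α M : Type*} [CommMonoid M] (l : List α) (p : α → Prop)
    [DecidablePred p] (f : α → M) :
    ((l.filter fun i => p i).map f).prod = (l.map fun i => if p i then f i else 1).prod := by
  induction l with
  | nil => rfl
  | cons i l ih => by_cases h : p i <;> simp [h, ih]

theorem decoratedProd_mulVec_recordVec {N : ℕ} (γ : ℕ → ℝ) (p : ℕ → Prop) [DecidablePred p]
    (s : Config N) : decoratedProd N γ p *ᵥ recordVec γ s =
      (-1 : ℂ) ^ (∑ i : Fin N, if (i : ℕ) + 1 < N ∧ p ((i : ℕ) + 1) then (s i : ℕ) else 0) •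
        recordVec γ s := by
  rw [decoratedProd, decorated_list_prod_mulVec, list_prod_map_filter (List.finRange N)
    (fun i : Fin N => (i : ℕ) + 1 < N ∧ p ((i : ℕ) + 1)), ← Fin.prod_univ_def,
    ← Finset.prod_pow_eq_pow_sum]
  congr 1
  exact Finset.prod_congr rfl fun i _ => by split_ifs <;> simp

/-! ### Products of decorated observables along one sublattice -/

/-- The product of the decorated observables at the sites `n - 1, n - 3, …`, as a polynomial in the
Pauli operators. The index is shifted by one so that the recursion starts with two empty products,
and the adaptation of the basis at site `n + 1` is given by `chain N γ (n + 1)`. -/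
noncomputable def chain (N : ℕ) (γ : ℕ → ℝ) : ℕ → Op N
  | 0 => 1
  | 1 => 1
  | n + 2 => ((Real.cos (γ (n + 1)) : ℂ) • siteOp N (n + 1) pauliX -
      (Real.sin (γ (n + 1)) : ℂ) • (siteOp N (n + 1) pauliY * chain N γ (n + 1))) * chain N γ n

/-- The sum of the outcomes at the sites `n - 1, n - 3, …`. -/
def outcomeSum {N : ℕ} (s : Config N) (n : ℕ) : ℕ :=
  ∑ j : Fin N, if (j : ℕ) + 1 < n ∧ Even (n - j) then (s j : ℕ) else 0

theorem outcomeSum_succ {N : ℕ} (s : Config N) (i : Fin N) :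
    outcomeSum s ((i : ℕ) + 1) = signFlip s i := by
  refine Finset.sum_congr rfl fun j _ => if_congr ?_ rfl rfl
  rw [Nat.even_iff, Nat.odd_iff, Fin.lt_def]
  omega

theorem outcomeSum_add_two {N : ℕ} (s : Config N) (i : Fin N) :
    outcomeSum s ((i : ℕ) + 2) = (s i : ℕ) + outcomeSum s i := by
  have h : (s i : ℕ) = ∑ j : Fin N, if j = i then (s j : ℕ) else 0 := by simp
  rw [h, outcomeSum, outcomeSum, ← Finset.sum_add_distrib]
  refine Finset.sum_congr rfl fun j _ => ?_
  simp only [Nat.even_iff, Fin.ext_iff]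
  split_ifs <;> omega

theorem siteOp_mulVec_recordVec {N : ℕ} (γ : ℕ → ℝ) (s : Config N) (i : Fin N) (A : Qubit) (z : ℂ)
    (h : A *ᵥ localVec (γ ((i : ℕ) + 1)) (signFlip s i) (s i : ℕ) =
      z • localVec (γ ((i : ℕ) + 1)) (signFlip s i) (s i : ℕ)) :
    siteOp N ((i : ℕ) + 1) A *ᵥ recordVec γ s = z • recordVec γ s := by
  have := tensorOp_mulVec (fun k => if k = (i : ℕ) + 1 then A else 1)
    fun j : Fin N => localVec (γ ((j : ℕ) + 1)) (signFlip s j) (s j : ℕ)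
  refine this.trans ?_
  funext c
  rw [Pi.smul_apply, smul_eq_mul, recordVec, ← Finset.mul_prod_erase _ _ (Finset.mem_univ i),
    ← Finset.mul_prod_erase _ (fun j : Fin N => localVec _ _ _ _) (Finset.mem_univ i), if_pos rfl,
    h, Pi.smul_apply, smul_eq_mul, mul_assoc]
  congr 2
  refine Finset.prod_congr rfl fun j hj => ?_
  rw [if_neg, Matrix.one_mulVec]
  intro hij
  exact (Finset.mem_erase.mp hj).1 (Fin.ext (by omega))

/-- On a measurement basis state, `chain N γ n` has the sign of the outcomes at `n - 1, n - 3, …`. In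
particular these products commute with each other and are involutions. -/
theorem chain_mulVec_recordVec {N : ℕ} (γ : ℕ → ℝ) (s : Config N) (n : ℕ) (hn : n ≤ N + 1) :
    chain N γ n *ᵥ recordVec γ s = (-1 : ℂ) ^ outcomeSum s n • recordVec γ s := by
  induction n using Nat.twoStepInduction with
  | zero => simp [chain, outcomeSum]
  | one => simp [chain, outcomeSum]
  | more n ih ih' =>
    let i : Fin N := ⟨n, by omega⟩
    have hobs := siteOp_mulVec_recordVec γ s i _ _
      (localObservable_mulVec_localVec (γ ((i : ℕ) + 1)) (signFlip s i) (s i : ℕ))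
    rw [localObservable, siteOp_sub (by omega) (by omega), siteOp_smul (by omega) (by omega),
      siteOp_smul (by omega) (by omega), Matrix.sub_mulVec, Matrix.smul_mulVec,
      Matrix.smul_mulVec] at hobs
    rw [chain, ← Matrix.mulVec_mulVec, ih (by omega), Matrix.mulVec_smul, Matrix.sub_mulVec,
      Matrix.smul_mulVec, Matrix.smul_mulVec, ← Matrix.mulVec_mulVec, ih' (by omega),
      Matrix.mulVec_smul, outcomeSum_succ s i, outcomeSum_add_two s i, pow_add, mul_smul,
      smul_comm ((-1 : ℂ) ^ (s i : ℕ)), ← hobs, smul_smul,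
      mul_comm ((-1 : ℂ) ^ signFlip s i)]

theorem chain_commute {N : ℕ} (γ : ℕ → ℝ) {n m : ℕ} (hn : n ≤ N + 1) (hm : m ≤ N + 1) :
    Commute (chain N γ n) (chain N γ m) :=
  eq_of_mulVec_recordVec γ fun s => by
    rw [← Matrix.mulVec_mulVec, ← Matrix.mulVec_mulVec, chain_mulVec_recordVec γ s n hn,
      chain_mulVec_recordVec γ s m hm, Matrix.mulVec_smul, Matrix.mulVec_smul,
      chain_mulVec_recordVec γ s n hn, chain_mulVec_recordVec γ s m hm, smul_comm]

theorem chain_mul_self {N : ℕ} (γ : ℕ → ℝ) {n : ℕ} (hn : n ≤ N + 1) :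
    chain N γ n * chain N γ n = 1 :=
  eq_of_mulVec_recordVec γ fun s => by
    rw [← Matrix.mulVec_mulVec, chain_mulVec_recordVec γ s n hn, Matrix.mulVec_smul,
      chain_mulVec_recordVec γ s n hn, smul_smul, ← mul_pow]
    simp

theorem chain_mem_localAlg (N : ℕ) (γ : ℕ → ℝ) (n : ℕ) : chain N γ n ∈ localAlg N {i | i < n} := by
  induction n using Nat.twoStepInduction with
  | zero => exact one_mem _
  | one => exact one_mem _
  | more n ih ih' =>
    have hsite : ∀ A, siteOp N (n + 1) A ∈ localAlg N {i | i < n + 2} := fun A =>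
      siteOp_mem_localAlg A (by simp)
    have h1 := localAlg_mono (T := {i | i < n + 2})
      (fun i (hi : i < n) => by rw [Set.mem_ofPred_eq]; omega) ih
    have h2 := localAlg_mono (T := {i | i < n + 2})
      (fun i (hi : i < n + 1) => by rw [Set.mem_ofPred_eq]; omega) ih'
    exact mul_mem (sub_mem (Subalgebra.smul_mem _ (hsite _) _)
      (Subalgebra.smul_mem _ (mul_mem (hsite _) h2) _)) h1

theorem siteOp_commute_chain {N : ℕ} (γ : ℕ → ℝ) {n k : ℕ} (h : n ≤ k) (A : Qubit) :
    Commute (siteOp N k A) (chain N γ n) :=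
  commute_of_disjoint (S := {k}) (Set.disjoint_left.mpr fun i hi hi' => by
      simp only [Set.mem_singleton_iff, Set.mem_ofPred_eq] at hi hi'; omega)
    (siteOp_mem_localAlg A rfl) (chain_mem_localAlg N γ n)

theorem siteOp_commute {N k l : ℕ} (h : k ≠ l) (A B : Qubit) :
    Commute (siteOp N k A) (siteOp N l B) :=
  commute_of_disjoint (Set.disjoint_singleton.mpr h) (siteOp_mem_localAlg A rfl)
    (siteOp_mem_localAlg B rfl)

theorem chain_add_two_of_zero {N : ℕ} {γ : ℕ → ℝ} {n : ℕ} (h : γ (n + 1) = 0) :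
    chain N γ (n + 2) = siteOp N (n + 1) pauliX * chain N γ n := by
  rw [chain, h]
  simp

theorem logicalX_eq {N : ℕ} (γ : ℕ → ℝ) (hN : Odd N) :
    logicalX N γ = siteOp N N pauliX * chain N γ (N - 1) := by
  rw [logicalX]
  congr 1
  refine eq_of_mulVec_recordVec γ fun s => ?_
  rw [decoratedProd_mulVec_recordVec, chain_mulVec_recordVec γ s _ (by omega)]
  congr 2
  refine Finset.sum_congr rfl fun j _ => if_congr ?_ rfl rfl
  rw [Nat.odd_iff] at hN
  rw [Nat.even_iff, Nat.odd_iff]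
  omega

theorem logicalZ_eq {N : ℕ} (γ : ℕ → ℝ) (hN : Odd N) :
    logicalZ N γ = siteOp N N pauliZ * chain N γ N := by
  rw [logicalZ]
  congr 1
  refine eq_of_mulVec_recordVec γ fun s => ?_
  rw [decoratedProd_mulVec_recordVec, chain_mulVec_recordVec γ s _ (by omega)]
  congr 2
  refine Finset.sum_congr rfl fun j _ => if_congr ?_ rfl rfl
  rw [Nat.odd_iff] at hN
  rw [Nat.even_iff, Nat.even_iff]
  omega

theorem logicalY_eq {N : ℕ} (γ : ℕ → ℝ) (hN : Odd N) :
    logicalY N γ = Complex.I • (logicalX N γ * logicalZ N γ) := by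
  have hN1 : 1 ≤ N := hN.pos
  have hprod : (decoratedProd N γ fun _ => True) = chain N γ (N - 1) * chain N γ N := by
    refine eq_of_mulVec_recordVec γ fun s => ?_
    rw [decoratedProd_mulVec_recordVec, ← Matrix.mulVec_mulVec,
      chain_mulVec_recordVec γ s N (by omega), Matrix.mulVec_smul,
      chain_mulVec_recordVec γ s _ (by omega), smul_smul, ← pow_add, outcomeSum, outcomeSum,
      ← Finset.sum_add_distrib]
    congr 2
    refine Finset.sum_congr rfl fun j _ => ?_
    rw [Nat.odd_iff] at hN
    simp only [Nat.even_iff, and_true]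
    split_ifs <;> omega
  rw [logicalY, hprod, logicalX_eq γ hN, logicalZ_eq γ hN, siteOp_pauliY hN1 le_rfl, smul_mul_assoc]
  congr 1
  rw [mul_assoc, mul_assoc, ← mul_assoc (siteOp N N pauliZ),
    (siteOp_commute_chain γ (by omega) pauliZ).eq, mul_assoc]

/-! ### Switching on one rotation angle -/

/-- Changing the angle at the site `b` does not affect the products of decorated observables on the
other sublattice, provided the later sites of that sublattice are measured at angle `0`. -/
theorem chain_update_of_even {N b : ℕ} {γ : ℕ → ℝ} (t : ℝ)
    (hγ : ∀ k, b < k → k % 2 ≠ b % 2 → γ k = 0) (n : ℕ) (hn : n ≤ b ∨ n % 2 = b % 2) :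
    chain N (Function.update γ b t) n = chain N γ n := by
  induction n using Nat.twoStepInduction with
  | zero => rfl
  | one => rfl
  | more n ih ih' =>
    by_cases h : n + 2 ≤ b
    · rw [chain, chain, ih (by omega), ih' (by omega), Function.update_of_ne (by omega)]
    · have hb : n + 1 ≠ b := by omega
      by_cases hb' : n + 1 < b
      · omega
      · have h0 := hγ (n + 1) (by omega) (by omega)
        rw [chain_add_two_of_zero h0, chain_add_two_of_zero (by rwa [Function.update_of_ne hb]),
          ih (by omega)]

/-- Changing the angle at the site `b` from `0` to `t` multiplies the later products of decorated
observables on the same sublattice by a rotation generated by `Z_b` times the sign `(-1)^{q_b}`. -/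
theorem chain_update_of_odd {N b : ℕ} {γ : ℕ → ℝ} (t : ℝ) (hb : 1 ≤ b) (hbN : b ≤ N) (h0 : γ b = 0)
    (hγ : ∀ k, b < k → k % 2 ≠ b % 2 → γ k = 0) (n : ℕ) (hn : b < n) (hnb : n % 2 ≠ b % 2) :
    chain N (Function.update γ b t) n = chain N γ n * ((Real.cos t : ℂ) • 1 -
      (Complex.I * (Real.sin t : ℂ)) • (siteOp N b pauliZ * chain N γ b)) := by
  induction n using Nat.twoStepInduction with
  | zero => omega
  | one => omega
  | more n ih ih' =>
    by_cases h : n + 1 = b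
    · subst h
      have hF := chain_update_of_even (N := N) t hγ
      have hc : Commute (chain N γ n) (siteOp N (n + 1) pauliZ * chain N γ (n + 1)) :=
        ((siteOp_commute_chain γ (by omega) _).symm).mul_right
          (chain_commute γ (by omega) (by omega))
      rw [chain_add_two_of_zero h0, chain, hF _ (by omega), hF _ (by omega), Function.update_self,
        siteOp_pauliY hb hbN, mul_assoc, mul_sub, mul_smul_comm, mul_smul_comm, hc.eq, sub_mul,
        mul_sub, mul_one, smul_mul_assoc, mul_smul_comm, mul_smul_comm, smul_mul_assoc,
        smul_mul_assoc, smul_mul_assoc, smul_smul, mul_comm Complex.I]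
      simp only [mul_assoc]
    · rw [chain, chain, Function.update_of_ne h, chain_update_of_even t hγ _ (by omega),
        ih (by omega) (by omega), mul_assoc]

/-- `Z_k X_{k+1} X_{k+3} ⋯` up to the site `n - 1`. -/
noncomputable def stringUpTo (N k n : ℕ) : Op N :=
  tensorOp N fun i => if i = k then pauliZ else if k < i ∧ i < n ∧ Odd (i - k) then pauliX else 1

theorem stringUpTo_add_two {N k n : ℕ} (hk : k ≤ n) (hn : n % 2 = k % 2) :
    stringUpTo N k (n + 2) = stringUpTo N k n * siteOp N (n + 1) pauliX := by
  rw [stringUpTo, stringUpTo, siteOp, tensorOp_mul]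
  refine tensorOp_congr fun i _ _ => ?_
  simp only [Nat.odd_iff]
  split_ifs <;> first | omega | simp

/-- Where the sites after `b` on the other sublattice are measured in the `X` basis, the string cancels
the corresponding decorated observables, which are products of the same `X`s. -/
theorem stringUpTo_mul_chain {N b : ℕ} {γ : ℕ → ℝ} (hγ : ∀ k, b < k → k % 2 ≠ b % 2 → γ k = 0)
    (n : ℕ) (hn : b ≤ n) (hnb : n % 2 = b % 2) :
    stringUpTo N b n * chain N γ n = siteOp N b pauliZ * chain N γ b := by
  obtain ⟨j, rfl⟩ : ∃ j, n = b + 2 * j := ⟨(n - b) / 2, by omega⟩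
  clear hn hnb
  induction j with
  | zero =>
    congr 1
    exact tensorOp_congr fun i _ _ => by split_ifs <;> first | omega | rfl
  | succ j ih =>
    rw [show b + 2 * (j + 1) = b + 2 * j + 2 by ring, stringUpTo_add_two (by omega) (by omega),
      chain_add_two_of_zero (hγ _ (by omega) (by omega)), mul_assoc,
      ← mul_assoc (siteOp N _ pauliX), siteOp_mul_self pauliX_mul_self, one_mul, ih]

theorem chain_commute_pauliZ {N b : ℕ} {γ : ℕ → ℝ} (hγ : ∀ k, b < k → k % 2 ≠ b % 2 → γ k = 0)
    (n : ℕ) (hn : b ≤ n) (hnb : n % 2 = b % 2) :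
    Commute (chain N γ n) (siteOp N b pauliZ) := by
  obtain ⟨j, rfl⟩ : ∃ j, n = b + 2 * j := ⟨(n - b) / 2, by omega⟩
  clear hn hnb
  induction j with
  | zero => exact (siteOp_commute_chain γ le_rfl _).symm
  | succ j ih =>
    rw [show b + 2 * (j + 1) = b + 2 * j + 2 by ring,
      chain_add_two_of_zero (hγ _ (by omega) (by omega))]
    exact (siteOp_commute (by omega) _ _).mul_left ih

/-- The generator `Z_b * chain N γ b` of the rotation at `b` anticommutes with the later products
of decorated observables on the sublattice of `b`, since these contain exactly one `X_b`. -/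
theorem pauliZ_chain_anticomm {N b : ℕ} {γ : ℕ → ℝ} (hb : 1 ≤ b) (h0 : γ b = 0)
    (hγ : ∀ k, b < k → k % 2 ≠ b % 2 → γ k = 0) (n : ℕ) (hn : b < n) (hnb : n % 2 ≠ b % 2)
    (hnN : n ≤ N + 1) :
    siteOp N b pauliZ * chain N γ b * chain N γ n =
      -(chain N γ n * (siteOp N b pauliZ * chain N γ b)) := by
  induction n using Nat.twoStepInduction with
  | zero => omega
  | one => omega
  | more n ih ih' =>
    by_cases h : n + 1 = b
    · subst h
      rw [chain_add_two_of_zero h0, mul_assoc, ← mul_assoc (chain N γ (n + 1)),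
        ← (siteOp_commute_chain γ le_rfl pauliX).eq, mul_assoc, ← mul_assoc (siteOp N _ pauliZ),
        siteOp_pauliZ_mul_pauliX hb (by omega),
        (chain_commute γ (by omega) (by omega) : Commute (chain N γ (n + 1)) (chain N γ n)).eq,
        neg_mul, mul_assoc, mul_assoc, ← mul_assoc (siteOp N _ pauliZ),
        (siteOp_commute_chain γ (by omega) pauliZ).eq, mul_assoc]
    · have hsite : ∀ A, Commute (siteOp N b pauliZ * chain N γ b) (siteOp N (n + 1) A) := fun A =>
        (siteOp_commute (by omega) _ _).mul_left (siteOp_commute_chain γ (by omega) _).symm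
      have hch : Commute (siteOp N b pauliZ * chain N γ b) (chain N γ (n + 1)) :=
        ((chain_commute_pauliZ hγ (n + 1) (by omega) (by omega)).symm).mul_left
          (chain_commute γ (by omega) (by omega))
      have hbr : Commute (siteOp N b pauliZ * chain N γ b)
          ((Real.cos (γ (n + 1)) : ℂ) • siteOp N (n + 1) pauliX -
            (Real.sin (γ (n + 1)) : ℂ) • (siteOp N (n + 1) pauliY * chain N γ (n + 1))) :=
        ((hsite _).smul_right _).sub_right (((hsite _).mul_right hch).smul_right _)
      rw [chain, ← mul_assoc, hbr.eq, mul_assoc, ih (by omega) (by omega) (by omega), mul_neg,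
        mul_assoc]

/-- The effect of one rotation angle in an abstract algebra: `L` and `R` are the logical observables
along and transverse to the axis, `K` is the string order operator and `K L = W`. -/
theorem rotation_identities {A : Type*} [Ring A] {K L R W : A} (hKL : K * L = W)
    (hL : L * L = 1) (hRL : R * L = -(L * R)) (hWR : W * R = -(R * W))
    (hLW : Commute L W) : R * W = K * (R * L) ∧ L * W = K := by
  have hK : K = W * L := by rw [← hKL, mul_assoc, hL, mul_one]
  have h1 : K * R = R * K := by
    have : L * R = -(R * L) := by rw [hRL, neg_neg]
    rw [hK, mul_assoc, this, mul_neg, ← mul_assoc, hWR, neg_mul, neg_neg, mul_assoc]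
  exact ⟨by rw [← mul_assoc, h1, mul_assoc, hKL], by rw [hK, hLW.eq]⟩

/-- The hypotheses of `rotation_identities` hold for the logical observables `L` along and `R`
transverse to the axis, which are read out at the site `N` as `Q` and `Q'`: the generator
`W = Z_b * chain N γ b` of the rotation at `b` is the string order operator times `L`. -/
theorem readout_identities {N b n n' : ℕ} {γ : ℕ → ℝ} {Q Q' : Qubit} (hb : 1 ≤ b) (hbN : b < N)
    (h0 : γ b = 0) (hγ : ∀ k, b < k → k % 2 ≠ b % 2 → γ k = 0) (hQ : Q * Q = 1)
    (hQQ : siteOp N N Q' * siteOp N N Q = -(siteOp N N Q * siteOp N N Q')) (hn : b ≤ n)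
    (hnN : n ≤ N) (hnb : n % 2 = b % 2) (hn' : b < n') (hnN' : n' ≤ N) (hnb' : n' % 2 ≠ b % 2)
    (hK : stringGe N b = stringUpTo N b n * siteOp N N Q) :
    let K := stringGe N b
    let L := siteOp N N Q * chain N γ n
    let R := siteOp N N Q' * chain N γ n'
    let W := siteOp N b pauliZ * chain N γ b
    K * L = W ∧ L * L = 1 ∧ R * L = -(L * R) ∧ R * W = K * (R * L) ∧ L * W = K := by
  intro K L R W
  have hQn : ∀ A, Commute (siteOp N N A) (chain N γ n) := fun A => siteOp_commute_chain γ hnN A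
  have hQn' : ∀ A, Commute (siteOp N N A) (chain N γ n') := fun A => siteOp_commute_chain γ hnN' A
  have hKL : K * L = W := by
    simp only [K, L, W]
    rw [hK, mul_assoc, ← mul_assoc (siteOp N N Q), siteOp_mul_self hQ, one_mul,
      stringUpTo_mul_chain hγ n hn hnb]
  have hL : L * L = 1 := by
    simp only [L]
    rw [mul_assoc, ← mul_assoc (chain N γ n), ← (hQn Q).eq, mul_assoc, chain_mul_self γ (by omega),
      mul_one, siteOp_mul_self hQ]
  have hRL : R * L = -(L * R) := by
    simp only [L, R]
    rw [mul_assoc, ← mul_assoc (chain N γ n'), ← (hQn' Q).eq, mul_assoc, ← mul_assoc, hQQ,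
      (chain_commute γ (by omega) (by omega) : Commute (chain N γ n') (chain N γ n)).eq, neg_mul,
      mul_assoc, ← mul_assoc _ _ (chain N γ n'), (hQn Q').eq]
    simp only [mul_assoc]
  have hWR : W * R = -(R * W) := by
    have hc : Commute W (siteOp N N Q') :=
      (siteOp_commute (by omega) _ _).mul_left (siteOp_commute_chain γ (by omega) _).symm
    simp only [R]
    rw [← mul_assoc, hc.eq, mul_assoc, pauliZ_chain_anticomm hb h0 hγ n' hn' hnb' (by omega),
      mul_neg, mul_assoc]
  have hLW : Commute L W :=
    Commute.mul_left
      ((siteOp_commute (by omega) _ _).mul_right (siteOp_commute_chain γ (by omega) _))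
      ((chain_commute_pauliZ hγ n hn hnb).mul_right (chain_commute γ (by omega) (by omega)))
  exact ⟨hKL, hL, hRL, rotation_identities hKL hL hRL hWR hLW⟩

/-- The vector of the logical Pauli observables. -/
noncomputable def logicalVec (N : ℕ) (γ : ℕ → ℝ) : Fin 3 → Op N :=
  ![logicalX N γ, logicalY N γ, logicalZ N γ]

theorem stringGe_of_odd {N k : ℕ} (hN : Odd N) (hk : Odd k) (hkN : k < N) :
    stringGe N k = stringUpTo N k N * siteOp N N pauliZ := by
  rw [stringGe, stringUpTo, siteOp, tensorOp_mul]
  refine tensorOp_congr fun i _ hi => ?_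
  rw [Nat.odd_iff] at hN hk
  simp only [Nat.odd_iff]
  split_ifs <;> first | omega | simp

theorem stringGe_of_even {N k : ℕ} (hN : Odd N) (hk : Even k) (hkN : k < N) :
    stringGe N k = stringUpTo N k (N - 1) * siteOp N N pauliX := by
  rw [stringGe, stringUpTo, siteOp, tensorOp_mul]
  refine tensorOp_congr fun i _ hi => ?_
  rw [Nat.odd_iff] at hN
  rw [Nat.even_iff] at hk
  simp only [Nat.odd_iff]
  split_ifs <;> first | omega | simp

/-- One additional rotation angle transforms the logical Pauli observables by the step matrix. -/
theorem logicalVec_update {N b : ℕ} {γ : ℕ → ℝ} {axis : Axis} (t : ℝ) (hN : Odd N)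
    (hpar : axis.parity b) (hb : 1 ≤ b) (hbN : b < N) (h0 : γ b = 0)
    (hγ : ∀ k, b < k → k % 2 ≠ b % 2 → γ k = 0) :
    logicalVec N (Function.update γ b t) = stepMatrix axis t (stringGe N b) *ᵥ logicalVec N γ := by
  have hN' := Nat.odd_iff.mp hN
  have hII : ∀ z : ℂ, Complex.I * (Complex.I * z) = -z := fun z => by
    rw [← mul_assoc, Complex.I_mul_I, neg_one_mul]
  cases axis with
  | z =>
    have hb' : Odd b := hpar
    have hb2 := Nat.odd_iff.mp hb'
    obtain ⟨hKL, hL, hRL, hRW, hLW⟩ := readout_identities (N := N) (b := b) (n := N) (n' := N - 1)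
      (γ := γ) (Q := pauliZ) (Q' := pauliX) hb hbN h0 hγ pauliZ_mul_self
      (by rw [siteOp_pauliZ_mul_pauliX (by omega) le_rfl, neg_neg]) (by omega) (by omega) (by omega)
      (by omega) (by omega) (by omega) (stringGe_of_odd hN hb' hbN)
    rw [← logicalX_eq γ hN, ← logicalZ_eq γ hN] at *
    have hZ : logicalZ N (Function.update γ b t) = logicalZ N γ := by
      rw [logicalZ_eq _ hN, logicalZ_eq _ hN, chain_update_of_even t hγ _ (by omega)]
    have hX : logicalX N (Function.update γ b t) = (Real.cos t : ℂ) • logicalX N γ -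
        (Complex.I * (Real.sin t : ℂ)) • (stringGe N b * (logicalX N γ * logicalZ N γ)) := by
      rw [logicalX_eq (Function.update γ b t) hN,
        chain_update_of_odd t hb hbN.le h0 hγ _ (by omega) (by omega), ← mul_assoc,
        ← logicalX_eq γ hN, mul_sub, mul_smul_comm, mul_smul_comm, mul_one, hRW]
    funext i
    fin_cases i
    · simp [logicalVec, stepMatrix, Matrix.mulVec, dotProduct, Fin.sum_univ_succ, hX,
        logicalY_eq _ hN, sub_eq_add_neg, smul_smul]
    · simp [logicalVec, stepMatrix, Matrix.mulVec, dotProduct, Fin.sum_univ_succ, hX, hZ,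
        logicalY_eq _ hN, sub_mul, mul_assoc, hL, smul_sub, smul_smul, hII]
      abel
    · simp [logicalVec, stepMatrix, Matrix.mulVec, dotProduct, Fin.sum_univ_succ, hZ]
  | x =>
    have hb' : Even b := hpar
    have hb2 := Nat.even_iff.mp hb'
    obtain ⟨hKL, hL, hRL, hRW, hLW⟩ := readout_identities (N := N) (b := b) (n := N - 1) (n' := N)
      (γ := γ) (Q := pauliX) (Q' := pauliZ) hb hbN h0 hγ pauliX_mul_self
      (siteOp_pauliZ_mul_pauliX (by omega) le_rfl) (by omega) (by omega) (by omega)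
      (by omega) (by omega) (by omega) (stringGe_of_even hN hb' hbN)
    rw [← logicalX_eq γ hN, ← logicalZ_eq γ hN] at *
    have hX : logicalX N (Function.update γ b t) = logicalX N γ := by
      rw [logicalX_eq _ hN, logicalX_eq _ hN, chain_update_of_even t hγ _ (by omega)]
    have hZ : logicalZ N (Function.update γ b t) = (Real.cos t : ℂ) • logicalZ N γ +
        (Complex.I * (Real.sin t : ℂ)) • (stringGe N b * (logicalX N γ * logicalZ N γ)) := by
      rw [logicalZ_eq (Function.update γ b t) hN,
        chain_update_of_odd t hb hbN.le h0 hγ _ (by omega) (by omega), ← mul_assoc,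
        ← logicalZ_eq γ hN, mul_sub, mul_smul_comm, mul_smul_comm, mul_one, hRW, hRL, mul_neg,
        smul_neg, sub_neg_eq_add]
    have hXK : ∀ A, logicalX N γ * (stringGe N b * (logicalX N γ * A)) = stringGe N b * A :=
      fun A => by rw [← mul_assoc (stringGe N b), hKL, ← mul_assoc, hLW]
    funext i
    fin_cases i
    · simp [logicalVec, stepMatrix, Matrix.mulVec, dotProduct, Fin.sum_univ_succ, hX]
    · simp [logicalVec, stepMatrix, Matrix.mulVec, dotProduct, Fin.sum_univ_succ, hX, hZ,
        logicalY_eq _ hN, mul_add, hXK, smul_smul, hII]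
    · simp [logicalVec, stepMatrix, Matrix.mulVec, dotProduct, Fin.sum_univ_succ, hZ,
        logicalY_eq _ hN, smul_smul]
      abel

theorem rotationAngles_zero (θ : ℕ → ℝ) (P a Δ : ℕ) (t : ℝ) :
    rotationAngles θ P a Δ 0 t = inputAngles θ P := by
  funext i
  simp [rotationAngles, inputAngles, rotationSites]

theorem mem_rotationSites {a Δ m k : ℕ} : k ∈ rotationSites a Δ m ↔ ∃ j < m, a + j * Δ = k := by
  simp [rotationSites]

theorem rotationAngles_succ (θ : ℕ → ℝ) {P a Δ : ℕ} (hP : P < a) (m : ℕ) (t : ℝ) :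
    rotationAngles θ P a Δ (m + 1) t =
      Function.update (rotationAngles θ P (a + Δ) Δ m t) a t := by
  funext i
  have hmem : i ∈ rotationSites a Δ (m + 1) ↔ i = a ∨ i ∈ rotationSites (a + Δ) Δ m := by
    rw [mem_rotationSites, mem_rotationSites]
    constructor
    · rintro ⟨_ | j, hj, rfl⟩
      · left; simp
      · exact Or.inr ⟨j, by omega, by ring⟩
    · rintro (rfl | ⟨j, hj, rfl⟩)
      · exact ⟨0, by omega, by simp⟩
      · exact ⟨j + 1, by omega, by ring⟩
  by_cases hi : i = a
  · subst hi
    rw [Function.update_self, rotationAngles, if_neg (by omega), if_pos (hmem.mpr (Or.inl rfl))]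
  · rw [Function.update_of_ne hi, rotationAngles, rotationAngles]
    simp [hmem, hi]

/-- In the Heisenberg picture, the rotation angles act on the logical Pauli observables by the
product of the step matrices. -/
theorem logicalVec_rotationAngles {N P a Δ m : ℕ} {axis : Axis} (θ : ℕ → ℝ) (t : ℝ) (hN : Odd N)
    (hΔ : 0 < Δ) (hΔ2 : Even Δ) (hpar : axis.parity a) (hP : P < a)
    (haN : ∀ j < m, a + j * Δ < N) :
    logicalVec N (rotationAngles θ P a Δ m t) =
      ((List.range m).map fun k => stepMatrix axis t (stringGe N (a + k * Δ))).prod *ᵥ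
        logicalVec N (inputAngles θ P) := by
  have hΔ2' := Nat.even_iff.mp hΔ2
  induction m generalizing a with
  | zero => rw [rotationAngles_zero]; simp
  | succ m ih =>
    have hpar' : axis.parity (a + Δ) := by
      cases axis with
      | x => exact Even.add hpar hΔ2
      | z => exact Odd.add_even hpar hΔ2
    have hstep : ∀ k, a + Δ + k * Δ = a + (k + 1) * Δ := fun k => by ring
    have hlater : ∀ j, a < a + Δ + j * Δ ∧ (a + Δ + j * Δ) % 2 = a % 2 := fun j => by
      have : (j * Δ) % 2 = 0 := by rw [Nat.mul_mod, hΔ2', mul_zero, Nat.zero_mod]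
      exact ⟨by omega, by omega⟩
    rw [rotationAngles_succ θ hP, logicalVec_update t hN hpar (by omega)
      (by simpa using haN 0 (by omega)), ih hpar' (by omega)
      (fun j hj => by rw [hstep]; exact haN _ (by omega)), List.range_succ_eq_map, List.map_cons,
      List.prod_cons, ← Matrix.mulVec_mulVec, List.map_map]
    · simp only [Function.comp_def, hstep, Nat.succ_eq_add_one, zero_mul, add_zero]
    · rw [rotationAngles, if_neg (by omega), if_neg]
      rw [mem_rotationSites]
      rintro ⟨j, -, hj⟩
      have := hlater j
      omega
    · intro k hk hk2
      rw [rotationAngles, if_neg (by omega), if_neg]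
      rw [mem_rotationSites]
      rintro ⟨j, -, hj⟩
      have := hlater j
      omega

/-! ### The symmetry localizes the logical observables -/

theorem expval_congr {N : ℕ} {Φ : Vec N} {A B : Op N} (h : A *ᵥ Φ = B *ᵥ Φ) :
    expval Φ A = expval Φ B := by
  rw [expval, expval, h]

theorem expval_add {N : ℕ} (Φ : Vec N) (A B : Op N) :
    expval Φ (A + B) = expval Φ A + expval Φ B := by
  simp [expval, Matrix.add_mulVec]

theorem mulVec_congr_left {N : ℕ} {Φ : Vec N} (C : Op N) {A B : Op N} (h : A *ᵥ Φ = B *ᵥ Φ) :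
    (C * A) *ᵥ Φ = (C * B) *ᵥ Φ := by
  rw [← Matrix.mulVec_mulVec, h, Matrix.mulVec_mulVec]

/-- If all angles after the site `P` vanish, the product of decorated observables on a sublattice
differs from a product of `X`s only on the sites `1, …, P`. -/
theorem chain_mul_tensorOp_mem_localAlg {N P r : ℕ} {γ : ℕ → ℝ} {A : ℕ → Qubit}
    (hγ : ∀ k, P < k → γ k = 0) (hA : ∀ k, P < k → k % 2 = r → A k = pauliX)
    (hA' : ∀ k, P < k → k % 2 ≠ r → A k = 1) (n : ℕ) (hn : (n + 1) % 2 = r) :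
    chain N γ n * tensorOp N (fun i => if i < n ∨ i ≤ P then A i else 1) ∈
      localAlg N {i | i ≤ P} := by
  have hbase : ∀ n, n ≤ P + 1 →
      chain N γ n * tensorOp N (fun i => if i < n ∨ i ≤ P then A i else 1) ∈
        localAlg N {i | i ≤ P} := fun n hn =>
    mul_mem (localAlg_mono (fun i (hi : i < n) => by rw [Set.mem_ofPred_eq]; omega)
      (chain_mem_localAlg N γ n))
      (tensorOp_mem_localAlg fun i _ _ hi => if_neg (by rw [Set.mem_ofPred_eq] at hi; omega))
  induction n using Nat.twoStepInduction with
  | zero => exact hbase 0 (by omega)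
  | one => exact hbase 1 (by omega)
  | more n ih ih' =>
    by_cases h : n + 2 ≤ P + 1
    · exact hbase _ h
    · have hD : tensorOp N (fun i => if i < n + 2 ∨ i ≤ P then A i else 1) =
          tensorOp N (fun i => if i < n ∨ i ≤ P then A i else 1) * siteOp N (n + 1) pauliX := by
        rw [siteOp, tensorOp_mul]
        refine tensorOp_congr fun i _ _ => ?_
        by_cases h1 : i = n + 1
        · rw [if_pos (by omega), if_neg (by omega), if_pos h1, one_mul,
            hA i (by omega) (by omega)]
        · rw [if_neg h1, mul_one]
          by_cases h2 : i < n ∨ i ≤ P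
          · rw [if_pos h2, if_pos (by omega)]
          · rw [if_neg h2]
            split_ifs
            · exact hA' i (by omega) (by omega)
            · rfl
      have hM := ih (by omega)
      have hc : Commute (siteOp N (n + 1) pauliX)
          (chain N γ n * tensorOp N (fun i => if i < n ∨ i ≤ P then A i else 1)) :=
        commute_of_disjoint (S := {n + 1}) (Set.disjoint_left.mpr fun i hi hi' => by
          simp only [Set.mem_singleton_iff, Set.mem_ofPred_eq] at hi hi'; omega)
          (siteOp_mem_localAlg _ rfl) hM
      rw [hD, chain_add_two_of_zero (hγ _ (by omega)), mul_assoc, ← mul_assoc (chain N γ n),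
        ← mul_assoc, hc.eq, mul_assoc, siteOp_mul_self pauliX_mul_self, mul_one]
      exact hM

theorem symm0_mul_self (N : ℕ) : symm0 N * symm0 N = 1 :=
  tensorOp_mul_self fun i => by split_ifs <;> simp [pauliX_mul_self, pauliZ_mul_self]

theorem symm1_mul_self (N : ℕ) : symm1 N * symm1 N = 1 :=
  tensorOp_mul_self fun i => by split_ifs <;> simp [pauliX_mul_self]

theorem symm0_conj_mem {N : ℕ} {S : Set ℕ} {B : Op N} (hB : B ∈ localAlg N S) :
    symm0 N * B * symm0 N ∈ localAlg N S :=
  tensorOp_conj_mem_localAlg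
    (fun i => by split_ifs <;> simp [pauliX_mul_self, pauliZ_mul_self]) hB

theorem symm1_conj_mem {N : ℕ} {S : Set ℕ} {B : Op N} (hB : B ∈ localAlg N S) :
    symm1 N * B * symm1 N ∈ localAlg N S :=
  tensorOp_conj_mem_localAlg (fun i => by split_ifs <;> simp [pauliX_mul_self]) hB

theorem siteOp_conj_of_mem {N P : ℕ} {A : Qubit} {B : Op N} (hP : P < N) (hA : A * A = 1)
    (hB : B ∈ localAlg N {i | i ≤ P}) : siteOp N N A * B * siteOp N N A = B := by
  have hc : Commute (siteOp N N A) B :=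
    commute_of_disjoint (S := {N}) (Set.disjoint_left.mpr fun i hi hi' => by
      simp only [Set.mem_singleton_iff, Set.mem_ofPred_eq] at hi hi'; omega)
      (siteOp_mem_localAlg _ rfl) hB
  rw [hc.eq, mul_assoc, siteOp_mul_self hA, mul_one]

theorem logicalX_mul_symm1_mem {N P : ℕ} {γ : ℕ → ℝ} (hN : Odd N) (hPN : P < N)
    (hγ : ∀ k, P < k → γ k = 0) : logicalX N γ * symm1 N ∈ localAlg N {i | i ≤ P} := by
  have hN' := Nat.odd_iff.mp hN
  have hM := chain_mul_tensorOp_mem_localAlg (N := N) (r := 1) hγ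
    (A := fun i => if Odd i then pauliX else 1) (fun k _ hk => if_pos (Nat.odd_iff.mpr hk))
    (fun k _ hk => if_neg (by rwa [Nat.odd_iff])) (N - 1) (by omega)
  have hsymm : symm1 N = tensorOp N (fun i => if i < N - 1 ∨ i ≤ P then
      (if Odd i then pauliX else 1) else 1) * siteOp N N pauliX := by
    rw [symm1, siteOp, tensorOp_mul]
    refine tensorOp_congr fun i _ hi => ?_
    simp only [Nat.odd_iff]
    split_ifs <;> first | omega | simp
  rw [logicalX_eq γ hN, hsymm, mul_assoc, ← mul_assoc (chain N γ (N - 1)), ← mul_assoc,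
    siteOp_conj_of_mem hPN pauliX_mul_self hM]
  exact hM

theorem logicalZ_mul_symm0_mem {N P : ℕ} {γ : ℕ → ℝ} (hN : Odd N) (hP : 0 < P) (hPN : P < N)
    (hγ : ∀ k, P < k → γ k = 0) : logicalZ N γ * symm0 N ∈ localAlg N {i | i ≤ P} := by
  have hN' := Nat.odd_iff.mp hN
  have hM := chain_mul_tensorOp_mem_localAlg (N := N) (r := 0) hγ
    (A := fun i => if i = 1 then pauliZ else if Even i then pauliX else 1)
    (fun k hk hk2 => by rw [if_neg (by omega), if_pos (Nat.even_iff.mpr hk2)])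
    (fun k hk hk2 => by rw [if_neg (by omega), if_neg (by rwa [Nat.even_iff])]) N (by omega)
  have hsymm : symm0 N = tensorOp N (fun i => if i < N ∨ i ≤ P then
      (if i = 1 then pauliZ else if Even i then pauliX else 1) else 1) * siteOp N N pauliZ := by
    rw [symm0, siteOp, tensorOp_mul]
    refine tensorOp_congr fun i _ hi => ?_
    simp only [Nat.even_iff]
    split_ifs <;> first | omega | simp
  rw [logicalZ_eq γ hN, hsymm, mul_assoc, ← mul_assoc (chain N γ N), ← mul_assoc,
    siteOp_conj_of_mem hPN pauliZ_mul_self hM]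
  exact hM

/-- If all angles after the site `P` vanish, the logical Pauli observables act on a symmetric state
like operators on the sites `1, …, P`. -/
theorem exists_logicalVec_mulVec {N ξ P : ℕ} {Φ : Vec N} (hΦ : IsResourceState ξ Φ) {γ : ℕ → ℝ}
    (hP : 0 < P) (hPN : P < N) (hγ : ∀ k, P < k → γ k = 0) (i : Fin 3) :
    ∃ O ∈ localAlg N {i | i ≤ P}, logicalVec N γ i *ᵥ Φ = O *ᵥ Φ := by
  have hX := logicalX_mul_symm1_mem hΦ.odd hPN hγ
  have hZ := logicalZ_mul_symm0_mem hΦ.odd hP hPN hγ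
  have hZΦ : logicalZ N γ *ᵥ Φ = (logicalZ N γ * symm0 N) *ᵥ Φ := by
    rw [← Matrix.mulVec_mulVec, hΦ.invariant0]
  fin_cases i
  · exact ⟨_, hX, by rw [← Matrix.mulVec_mulVec, hΦ.invariant1]; rfl⟩
  · refine ⟨_, Subalgebra.smul_mem _ (mul_mem hX (symm1_conj_mem hZ)) Complex.I, ?_⟩
    have h : (logicalX N γ * logicalZ N γ) *ᵥ Φ = (logicalX N γ * symm1 N *
        (symm1 N * (logicalZ N γ * symm0 N) * symm1 N)) *ᵥ Φ := by
      have hcancel : logicalX N γ * symm1 N * (symm1 N * (logicalZ N γ * symm0 N) * symm1 N) =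
          logicalX N γ * (symm1 N * symm1 N) * (logicalZ N γ * symm0 N) * symm1 N := by
        simp only [mul_assoc]
      rw [mulVec_congr_left _ hZΦ, hcancel, symm1_mul_self, mul_one, ← Matrix.mulVec_mulVec Φ _
        (symm1 N), hΦ.invariant1]
    calc logicalY N γ *ᵥ Φ = Complex.I • ((logicalX N γ * logicalZ N γ) *ᵥ Φ) := by
          rw [logicalY_eq γ hΦ.odd, Matrix.smul_mulVec]
      _ = _ := by rw [h, Matrix.smul_mulVec]
  · exact ⟨_, hZ, hZΦ⟩

/-! ### The logical operation -/

theorem stringGe_mem_localAlg {N k : ℕ} (hk : k ≤ N) : stringGe N k ∈ localAlg N {i | k ≤ i} :=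
  tensorOp_mem_localAlg fun i _ hi hik => by
    rw [Set.mem_ofPred_eq] at hik
    rw [if_neg (by omega), if_neg (by omega), if_neg (by omega)]

theorem list_prod_apply_mem {N : ℕ} {S : Subalgebra ℂ (Op N)}
    (l : List (Matrix (Fin 3) (Fin 3) (Op N))) (h : ∀ M ∈ l, ∀ i j, M i j ∈ S) (i j : Fin 3) :
    l.prod i j ∈ S := by
  induction l generalizing i with
  | nil =>
    rw [List.prod_nil, Matrix.one_apply]
    split_ifs
    · exact one_mem _
    · exact zero_mem _
  | cons M l ih =>
    rw [List.prod_cons, Matrix.mul_apply]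
    exact sum_mem fun k _ => mul_mem (h M (by simp) i k)
      (ih (fun M' hM' => h M' (by simp [hM'])) k)

theorem stepMatrix_apply_mem {N : ℕ} {S : Subalgebra ℂ (Op N)} (axis : Axis) (t : ℝ) {K : Op N}
    (hK : K ∈ S) (i j : Fin 3) : stepMatrix axis t K i j ∈ S := by
  have h1 : (Real.cos t : ℂ) • (1 : Op N) ∈ S := Subalgebra.smul_mem _ (one_mem _) _
  have h2 : (Real.sin t : ℂ) • K ∈ S := Subalgebra.smul_mem _ hK _
  cases axis <;> fin_cases i <;> fin_cases j <;>
    first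
      | exact h1
      | exact h2
      | exact neg_mem h2
      | exact one_mem _
      | exact zero_mem _

theorem layout_site_lt {axis : Axis} {ξ Δ N m P a : ℕ} (h : IsLayout axis ξ Δ N m P a) {j : ℕ}
    (hj : j < m) : a + j * Δ < N :=
  lt_of_le_of_lt (Nat.add_le_add_left (Nat.mul_le_mul_right Δ (by omega)) a) h.readout

/-- The expectation values of the logical Pauli observables transform by the matrix of expectation
values, because the string order operators are far from the preparation region. -/
theorem expval_logicalVec {axis : Axis} {N ξ Δ m P a : ℕ} {Φ : Vec N} (hΔ : 0 < Δ)
    (hΔ2 : Even Δ) (hL : IsLayout axis ξ Δ N m P a) (hΦ : IsResourceState ξ Φ) (θ : ℕ → ℝ) (t : ℝ)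
    (i : Fin 3) : expval Φ (logicalVec N (rotationAngles θ P a Δ m t) i) =
      ∑ j, blochMatrix Φ axis a Δ m t i j * expval Φ (logicalVec N (inputAngles θ P) j) := by
  have hPa : P < a := by have := hL.buffer; omega
  have haN : a < N := by simpa using layout_site_lt hL hL.steps_pos
  rw [logicalVec_rotationAngles θ t hΦ.odd hΔ hΔ2 hL.parity hPa fun j hj => layout_site_lt hL hj]
  simp only [Matrix.mulVec, dotProduct, Fin.sum_univ_three, expval_add, blochMatrix,
    Matrix.map_apply]
  have key : ∀ j, expval Φ (((List.range m).map fun k =>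
      stepMatrix axis t (stringGe N (a + k * Δ))).prod i j * logicalVec N (inputAngles θ P) j) =
      expval Φ (((List.range m).map fun k =>
        stepMatrix axis t (stringGe N (a + k * Δ))).prod i j) *
          expval Φ (logicalVec N (inputAngles θ P) j) := by
    intro j
    obtain ⟨O, hO, hOΦ⟩ := exists_logicalVec_mulVec hΦ (γ := inputAngles θ P) hL.prep_pos
      (by omega) (fun k hk => if_neg (by omega)) j
    rw [expval_congr (mulVec_congr_left _ hOΦ), expval_congr hOΦ]
    refine expval_mul_of_distant hΦ hL.buffer (list_prod_apply_mem _ ?_ i j) hO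
    intro M hM
    obtain ⟨k, hk, rfl⟩ := List.mem_map.mp hM
    refine stepMatrix_apply_mem axis t ?_
    have hk' := layout_site_lt hL (List.mem_range.mp hk)
    refine localAlg_mono ?_ (stringGe_mem_localAlg hk'.le)
    intro x hx
    rw [Set.mem_ofPred_eq] at hx ⊢
    omega
  rw [key, key, key]

theorem blochMap_apply_bloch (B : Matrix (Fin 3) (Fin 3) ℂ) (x y z : ℂ) :
    blochMap B ((1 / 2 : ℂ) • (1 + x • pauliX + y • pauliY + z • pauliZ)) =
      (1 / 2 : ℂ) • (1 + (B 0 0 * x + B 0 1 * y + B 0 2 * z) • pauliX +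
        (B 1 0 * x + B 1 1 * y + B 1 2 * z) • pauliY +
        (B 2 0 * x + B 2 1 * y + B 2 2 * z) • pauliZ) := by
  set ρ : Qubit := (1 / 2 : ℂ) • (1 + x • pauliX + y • pauliY + z • pauliZ) with hρ
  have hρ' : ρ = !![(1 + z) / 2, (x - Complex.I * y) / 2;
      (x + Complex.I * y) / 2, (1 - z) / 2] := by
    ext i j
    fin_cases i <;> fin_cases j <;> simp [hρ, pauliX, pauliY, pauliZ] <;> ring
  have h0 : ρ.trace = 1 := by
    rw [hρ', Matrix.trace_fin_two_of]; ring
  have h1 : (pauliX * ρ).trace = x := by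
    rw [hρ', pauliX, Matrix.mul_fin_two, Matrix.trace_fin_two_of]; ring
  have h2 : (pauliY * ρ).trace = y := by
    rw [hρ', pauliY, Matrix.mul_fin_two, Matrix.trace_fin_two_of]
    linear_combination (-y) * Complex.I_sq
  have h3 : (pauliZ * ρ).trace = z := by
    rw [hρ', pauliZ, Matrix.mul_fin_two, Matrix.trace_fin_two_of]; ring
  change (1 / 2 : ℂ) • (ρ.trace • (1 : Qubit)
    + ∑ i, ∑ j, (B i j * (paulis j * ρ).trace) • paulis i) = _
  congr 1
  have hp0 : paulis 0 = pauliX := rfl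
  have hp1 : paulis 1 = pauliY := rfl
  have hp2 : paulis 2 = pauliZ := rfl
  simp only [Fin.sum_univ_three, hp0, hp1, hp2, h0, h1, h2, h3, one_smul, add_smul]
  abel

theorem logicalState_rotationAngles {axis : Axis} {N ξ Δ m P a : ℕ} {Φ : Vec N} (hΔ : 0 < Δ)
    (hΔ2 : Even Δ) (hL : IsLayout axis ξ Δ N m P a) (hΦ : IsResourceState ξ Φ) (θ : ℕ → ℝ)
    (t : ℝ) : logicalState Φ (rotationAngles θ P a Δ m t) =
      logicalOp Φ axis a Δ m t (logicalState Φ (inputAngles θ P)) := by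
  have h := expval_logicalVec hΔ hΔ2 hL hΦ θ t
  have h0 := h 0
  have h1 := h 1
  have h2 := h 2
  simp only [Fin.sum_univ_three, logicalVec, Matrix.cons_val] at h0 h1 h2
  rw [logicalState, logicalState, logicalOp, blochMap_apply_bloch, h0, h1, h2]

/-! ### Simultaneous diagonalization of the string order operators -/

/-- The Hadamard matrix, which exchanges `X` and `Z`. -/
noncomputable def hadamard : Qubit := ((1 / Real.sqrt 2 : ℝ) : ℂ) • !![1, 1; 1, -1]

theorem inv_sqrt_two_mul_self :
    ((1 / Real.sqrt 2 : ℝ) : ℂ) * ((1 / Real.sqrt 2 : ℝ) : ℂ) = 1 / 2 := by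
  rw [← Complex.ofReal_mul, div_mul_div_comm, Real.mul_self_sqrt (by norm_num)]
  norm_num

theorem hadamard_mul_self : hadamard * hadamard = 1 := by
  rw [hadamard, smul_mul_smul_comm, inv_sqrt_two_mul_self, Matrix.mul_fin_two]
  ext i j; fin_cases i <;> fin_cases j <;> norm_num

theorem hadamard_conjTranspose : hadamardᴴ = hadamard := by
  rw [hadamard, Matrix.conjTranspose_smul]
  congr 1
  · exact Complex.conj_ofReal _
  · ext i j; fin_cases i <;> fin_cases j <;> simp

theorem hadamard_mul_pauliX_mul : hadamard * pauliX * hadamard = pauliZ := by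
  rw [hadamard, smul_mul_assoc, smul_mul_smul_comm, inv_sqrt_two_mul_self, pauliX, pauliZ,
    Matrix.mul_fin_two, Matrix.mul_fin_two]
  ext i j; fin_cases i <;> fin_cases j <;> norm_num

theorem pauliZ_eq_diagonal : pauliZ = Matrix.diagonal fun b : Fin 2 => (-1 : ℂ) ^ (b : ℕ) := by
  ext i j; fin_cases i <;> fin_cases j <;> simp [pauliZ]

/-- Hadamard gates on the sites of parity different from `r`. They diagonalize all string order
operators that begin at sites of parity `r`. -/
noncomputable def hadamardOp (N r : ℕ) : Op N :=
  tensorOp N fun i => if i % 2 = r then 1 else hadamard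

theorem hadamardOp_mul_self (N r : ℕ) : hadamardOp N r * hadamardOp N r = 1 :=
  tensorOp_mul_self fun i => by split_ifs <;> simp [hadamard_mul_self]

theorem hadamardOp_conjTranspose (N r : ℕ) : (hadamardOp N r)ᴴ = hadamardOp N r := by
  rw [hadamardOp, tensorOp_conjTranspose]
  exact tensorOp_congr fun i _ _ => by split_ifs <;> simp [hadamard_conjTranspose]

/-- The value `±1` of the string order operator `𝒦_{≥ k}` in a joint eigenstate. -/
noncomputable def stringValue (N k : ℕ) (c : Config N) : ℝ :=
  ∏ i : Fin N, if (i : ℕ) + 1 = k ∨ (k < (i : ℕ) + 1 ∧ Odd ((i : ℕ) + 1 - k)) ∨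
    ((i : ℕ) + 1 = N ∧ Odd k) then (-1 : ℝ) ^ (c i : ℕ) else 1

theorem stringValue_eq (N k : ℕ) (c : Config N) :
    stringValue N k c = 1 ∨ stringValue N k c = -1 := by
  refine Finset.prod_induction _ (fun x : ℝ => x = 1 ∨ x = -1) ?_ (Or.inl rfl) fun i _ => ?_
  · rintro _ _ (rfl | rfl) (rfl | rfl) <;> norm_num
  · split_ifs
    · exact neg_one_pow_eq_or ℝ _
    · exact Or.inl rfl

/-- The functional calculus of the joint eigenbasis: `g` becomes the operator with eigenvalues
`g c`. -/
noncomputable def spectralHom (N r : ℕ) : (Config N → ℂ) →+* Op N where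
  toFun g := hadamardOp N r * Matrix.diagonal g * hadamardOp N r
  map_one' := by
    rw [show Matrix.diagonal (1 : Config N → ℂ) = 1 from Matrix.diagonal_one, mul_one,
      hadamardOp_mul_self]
  map_zero' := by
    rw [show Matrix.diagonal (0 : Config N → ℂ) = 0 from Matrix.diagonal_zero, mul_zero, zero_mul]
  map_add' g h := by
    rw [← add_mul, ← mul_add, Matrix.diagonal_add]; rfl
  map_mul' g h := by
    have : Matrix.diagonal (g * h) = Matrix.diagonal g * Matrix.diagonal h := by
      rw [Matrix.diagonal_mul_diagonal]; rfl
    rw [this]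
    calc _ = hadamardOp N r * Matrix.diagonal g * 1 * Matrix.diagonal h * hadamardOp N r := by
          simp only [mul_assoc, one_mul]
      _ = _ := by rw [← hadamardOp_mul_self N r]; simp only [mul_assoc]

theorem spectralHom_smul {N : ℕ} (r : ℕ) (z : ℂ) (g : Config N → ℂ) :
    spectralHom N r (fun c => z * g c) = z • spectralHom N r g := by
  have : Matrix.diagonal (fun c => z * g c) = z • Matrix.diagonal g := by
    rw [← Matrix.diagonal_smul]; rfl
  change hadamardOp N r * Matrix.diagonal (fun c => z * g c) * hadamardOp N r =
    z • (hadamardOp N r * Matrix.diagonal g * hadamardOp N r)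
  rw [this, mul_smul_comm, smul_mul_assoc]

theorem spectralHom_stringValue {N k r : ℕ} (hN : Odd N) (hk : k % 2 = r) :
    spectralHom N r (fun c => (stringValue N k c : ℂ)) = stringGe N k := by
  have hN' := Nat.odd_iff.mp hN
  have hdiag : hadamardOp N r * stringGe N k * hadamardOp N r =
      Matrix.diagonal fun c => (stringValue N k c : ℂ) := by
    rw [hadamardOp, stringGe, tensorOp_mul, tensorOp_mul]
    have : (fun c : Config N => (stringValue N k c : ℂ)) = fun c => ∏ i : Fin N,
        (if (i : ℕ) + 1 = k ∨ (k < (i : ℕ) + 1 ∧ Odd ((i : ℕ) + 1 - k)) ∨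
          ((i : ℕ) + 1 = N ∧ Odd k) then fun b : Fin 2 => (-1 : ℂ) ^ (b : ℕ) else fun _ => 1)
            (c i) := by
      funext c
      rw [stringValue, Complex.ofReal_prod]
      refine Finset.prod_congr rfl fun i _ => ?_
      split_ifs <;> simp
    rw [this, ← tensorOp_diagonal N fun i => if i = k ∨ (k < i ∧ Odd (i - k)) ∨
          (i = N ∧ Odd k) then fun b : Fin 2 => (-1 : ℂ) ^ (b : ℕ) else fun _ => 1]
    refine tensorOp_congr fun i _ hi => ?_
    simp only [Nat.odd_iff]
    split_ifs <;> first
      | omega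
      | simp only [one_mul, mul_one, pauliZ_eq_diagonal, hadamard_mul_pauliX_mul,
          hadamard_mul_self, Matrix.diagonal_one]
  change hadamardOp N r * Matrix.diagonal _ * hadamardOp N r = _
  rw [← hdiag]
  calc _ = (hadamardOp N r * hadamardOp N r) * stringGe N k *
        (hadamardOp N r * hadamardOp N r) := by simp only [mul_assoc]
    _ = _ := by rw [hadamardOp_mul_self, one_mul, mul_one]

/-- The joint probability distribution of the string order operators in the state `Φ`. -/
noncomputable def spectralWeight {N : ℕ} (Φ : Vec N) (r : ℕ) (c : Config N) : ℝ :=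
  Complex.normSq ((hadamardOp N r *ᵥ Φ) c)

theorem expval_spectralHom {N : ℕ} (Φ : Vec N) (r : ℕ) (g : Config N → ℂ) :
    expval Φ (spectralHom N r g) = ∑ c, (spectralWeight Φ r c : ℂ) * g c := by
  have h : expval Φ (spectralHom N r g) =
      expval (hadamardOp N r *ᵥ Φ) (Matrix.diagonal g) := by
    rw [expval_mulVec, hadamardOp_conjTranspose]; rfl
  rw [h, expval, dotProduct]
  refine Finset.sum_congr rfl fun c _ => ?_
  rw [Matrix.mulVec_diagonal, spectralWeight, Complex.normSq_eq_conj_mul_self, Pi.star_apply,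
    Complex.star_def]
  ring

theorem sum_spectralWeight {N ξ : ℕ} {Φ : Vec N} (hΦ : IsResourceState ξ Φ) (r : ℕ) :
    ∑ c, spectralWeight Φ r c = 1 := by
  have h := expval_spectralHom Φ r 1
  rw [map_one, expval_one hΦ] at h
  have h' : ((∑ c, spectralWeight Φ r c : ℝ) : ℂ) = 1 := by simpa using h.symm
  exact_mod_cast h'

theorem spectralWeight_nonneg {N : ℕ} (Φ : Vec N) (r : ℕ) (c : Config N) :
    0 ≤ spectralWeight Φ r c := Complex.normSq_nonneg _

/-! ### The Bloch matrix is an average of rotations -/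

/-- The matrix of a rotation about the axis, with entries `c` and `s` for cosine and sine. -/
def axisRotation {R : Type*} [CommRing R] (axis : Axis) (c s : R) : Matrix (Fin 3) (Fin 3) R :=
  match axis with
  | .z => !![c, -s, 0; s, c, 0; 0, 0, 1]
  | .x => !![1, 0, 0; 0, c, -s; 0, s, c]

theorem axisRotation_mul {R : Type*} [CommRing R] (axis : Axis) (c s c' s' : R) :
    axisRotation axis c s * axisRotation axis c' s' =
      axisRotation axis (c * c' - s * s') (s * c' + c * s') := by
  cases axis <;> ext i j <;> fin_cases i <;> fin_cases j <;>
    simp [axisRotation, Matrix.mul_apply, Fin.sum_univ_three] <;> ring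

theorem axisRotation_one {R : Type*} [CommRing R] (axis : Axis) :
    axisRotation axis (1 : R) 0 = 1 := by
  cases axis <;> ext i j <;> fin_cases i <;> fin_cases j <;> simp [axisRotation]

theorem axisRotation_map {R S : Type*} [CommRing R] [Ring S] (axis : Axis) (c s : R) (f : R →+ S)
    {t : Matrix (Fin 3) (Fin 3) S} (h : t = match axis with
      | .z => !![f c, -(f s), 0; f s, f c, 0; 0, 0, f 1]
      | .x => !![f 1, 0, 0; 0, f c, -(f s); 0, f s, f c]) :
    (axisRotation axis c s).map f = t := by
  subst h
  cases axis <;> ext i j <;> fin_cases i <;> fin_cases j <;> simp [axisRotation]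

/-- Since the string order operator has the values `±1`, the step matrix is the rotation by `±t`. -/
theorem stepMatrix_eq_map {N k r : ℕ} (hN : Odd N) (hk : k % 2 = r) (axis : Axis) (t : ℝ) :
    stepMatrix axis t (stringGe N k) =
      (spectralHom N r).mapMatrix (axisRotation axis
        (fun c => (Real.cos (t * stringValue N k c) : ℂ))
        (fun c => (Real.sin (t * stringValue N k c) : ℂ))) := by
  have hc : (fun c => (Real.cos (t * stringValue N k c) : ℂ)) =
      fun c : Config N => (Real.cos t : ℂ) * (1 : Config N → ℂ) c := by
    funext c
    rcases stringValue_eq N k c with h | h <;> simp [h]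
  have hs : (fun c => (Real.sin (t * stringValue N k c) : ℂ)) =
      fun c : Config N => (Real.sin t : ℂ) * (fun c => (stringValue N k c : ℂ)) c := by
    funext c
    rcases stringValue_eq N k c with h | h <;> simp [h]
  rw [RingHom.mapMatrix_apply]
  refine (axisRotation_map axis _ _ (spectralHom N r : (Config N → ℂ) →+ Op N) ?_).symm
  simp only [AddMonoidHom.coe_coe]
  rw [hc, hs, spectralHom_smul, spectralHom_smul, map_one, spectralHom_stringValue hN hk]
  cases axis <;> rfl

theorem prod_stepMatrix_eq_map {N r : ℕ} (hN : Odd N) (axis : Axis) (t : ℝ) (k : ℕ → ℕ) (m : ℕ)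
    (hk : ∀ j < m, k j % 2 = r) :
    ((List.range m).map fun j => stepMatrix axis t (stringGe N (k j))).prod =
      (spectralHom N r).mapMatrix (axisRotation axis
        (fun c => (Real.cos (t * ∑ j ∈ Finset.range m, stringValue N (k j) c) : ℂ))
        (fun c => (Real.sin (t * ∑ j ∈ Finset.range m, stringValue N (k j) c) : ℂ))) := by
  induction m with
  | zero =>
    have h1 : (fun _ => 1 : Config N → ℂ) = 1 := rfl
    have h0 : (fun _ => 0 : Config N → ℂ) = 0 := rfl
    simp only [List.range_zero, List.map_nil, List.prod_nil, Finset.range_zero, Finset.sum_empty,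
      mul_zero, Real.cos_zero, Real.sin_zero, Complex.ofReal_one, Complex.ofReal_zero, h1, h0,
      axisRotation_one, map_one]
  | succ m ih =>
    rw [List.range_succ, List.map_append, List.prod_append, List.map_singleton, List.prod_singleton,
      ih fun j hj => hk j (by omega), stepMatrix_eq_map hN (hk m (by omega)), ← map_mul,
      axisRotation_mul]
    congr 2
    · funext c
      simp only [Pi.sub_apply, Pi.mul_apply]
      rw [Finset.sum_range_succ, mul_add, Real.cos_add]
      push_cast; ring
    · funext c
      simp only [Pi.add_apply, Pi.mul_apply]
      rw [Finset.sum_range_succ, mul_add, Real.sin_add]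
      push_cast; ring

theorem blochMatrix_eq {axis : Axis} {N ξ a Δ m : ℕ} {Φ : Vec N} (hΦ : IsResourceState ξ Φ)
    (hΔ : Even Δ) (t : ℝ) :
    blochMatrix Φ axis a Δ m t = axisRotation axis
      ((∑ c, spectralWeight Φ (a % 2) c *
        Real.cos (t * ∑ j ∈ Finset.range m, stringValue N (a + j * Δ) c) : ℝ) : ℂ)
      ((∑ c, spectralWeight Φ (a % 2) c *
        Real.sin (t * ∑ j ∈ Finset.range m, stringValue N (a + j * Δ) c) : ℝ) : ℂ) := by
  have hk : ∀ j < m, (a + j * Δ) % 2 = a % 2 := fun j _ => by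
    rw [Nat.add_mod, Nat.mul_mod, Nat.even_iff.mp hΔ]; simp
  rw [blochMatrix, prod_stepMatrix_eq_map hΦ.odd axis t (fun j => a + j * Δ) m hk,
    RingHom.mapMatrix_apply, Matrix.map_map]
  let f : (Config N → ℂ) →+ ℂ :=
    { toFun := fun g => expval Φ (spectralHom N (a % 2) g)
      map_zero' := by simp [expval]
      map_add' := fun g h => by rw [map_add, expval_add] }
  refine axisRotation_map axis _ _ f ?_
  have h1 : f 1 = 1 := by
    change expval Φ (spectralHom N (a % 2) 1) = 1
    rw [map_one, expval_one hΦ]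
  have hg : ∀ g : Config N → ℝ, f (fun c => (g c : ℂ)) =
      ((∑ c, spectralWeight Φ (a % 2) c * g c : ℝ) : ℂ) := fun g => by
    change expval Φ (spectralHom N (a % 2) _) = _
    rw [expval_spectralHom]
    push_cast; rfl
  rw [h1, hg, hg]
  cases axis <;> rfl

/-! ### The logical error -/

theorem blochMap_apply_fin_two (B : Matrix (Fin 3) (Fin 3) ℂ) (p q r u : ℂ) :
    blochMap B !![p, q; r, u] = (1 / 2 : ℂ) • ((p + u) • (1 : Qubit) +
      ((B 0 0 * (q + r) + B 0 1 * (Complex.I * (q - r)) + B 0 2 * (p - u)) • pauliX +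
        (B 1 0 * (q + r) + B 1 1 * (Complex.I * (q - r)) + B 1 2 * (p - u)) • pauliY +
        (B 2 0 * (q + r) + B 2 1 * (Complex.I * (q - r)) + B 2 2 * (p - u)) • pauliZ)) := by
  have h1 : (pauliX * !![p, q; r, u]).trace = q + r := by
    rw [pauliX, Matrix.mul_fin_two, Matrix.trace_fin_two_of]; ring
  have h2 : (pauliY * !![p, q; r, u]).trace = Complex.I * (q - r) := by
    rw [pauliY, Matrix.mul_fin_two, Matrix.trace_fin_two_of]; ring
  have h3 : (pauliZ * !![p, q; r, u]).trace = p - u := by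
    rw [pauliZ, Matrix.mul_fin_two, Matrix.trace_fin_two_of]; ring
  change (1 / 2 : ℂ) • (Matrix.trace !![p, q; r, u] • (1 : Qubit)
    + ∑ i, ∑ j, (B i j * (paulis j * !![p, q; r, u]).trace) • paulis i) = _
  have hp0 : paulis 0 = pauliX := rfl
  have hp1 : paulis 1 = pauliY := rfl
  have hp2 : paulis 2 = pauliZ := rfl
  simp only [Fin.sum_univ_three, hp0, hp1, hp2, h1, h2, h3, Matrix.trace_fin_two_of, add_smul]

theorem logicalRotation_eq_blochMap (axis : Axis) (β : ℝ) :
    logicalRotation axis β =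
      blochMap (axisRotation axis (Real.cos β : ℂ) (Real.sin β : ℂ)) := by
  have hcos : (Real.cos β : ℂ) = (Real.cos (β / 2) : ℂ) ^ 2 - (Real.sin (β / 2) : ℂ) ^ 2 := by
    rw [← Complex.ofReal_pow, ← Complex.ofReal_pow, ← Complex.ofReal_sub]
    congr 1
    rw [← Real.cos_two_mul']; congr 1; ring
  have hsin : (Real.sin β : ℂ) = 2 * (Real.sin (β / 2) : ℂ) * (Real.cos (β / 2) : ℂ) := by
    rw [show β = 2 * (β / 2) by ring, Real.sin_two_mul]
    push_cast; ring_nf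
  have hone : (Real.cos (β / 2) : ℂ) ^ 2 + (Real.sin (β / 2) : ℂ) ^ 2 = 1 := by
    rw [← Complex.ofReal_pow, ← Complex.ofReal_pow, ← Complex.ofReal_add, Real.cos_sq_add_sin_sq,
      Complex.ofReal_one]
  have hI := Complex.I_sq
  refine LinearMap.ext fun A => ?_
  have hA : A = !![A 0 0, A 0 1; A 1 0, A 1 1] := Matrix.eta_fin_two A
  generalize A 0 0 = p, A 0 1 = q, A 1 0 = r, A 1 1 = u at hA
  subst hA
  rw [hcos, hsin, blochMap_apply_fin_two]
  change ((Real.cos (β / 2) : ℂ) • (1 : Qubit) -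
      (Complex.I * (Real.sin (β / 2) : ℂ)) • axis.pauli) * (!![p, q; r, u] *
    ((Real.cos (β / 2) : ℂ) • (1 : Qubit) -
      (Complex.I * (Real.sin (β / 2) : ℂ)) • axis.pauli)ᴴ) = _
  have hcc : (starRingEnd ℂ) (Real.cos (β / 2) : ℂ) = Real.cos (β / 2) := Complex.conj_ofReal _
  have hss : (starRingEnd ℂ) (Real.sin (β / 2) : ℂ) = Real.sin (β / 2) := Complex.conj_ofReal _
  generalize (Real.cos (β / 2) : ℂ) = c at *
  generalize (Real.sin (β / 2) : ℂ) = s at *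
  cases axis with
  | x =>
    have hV : c • (1 : Qubit) - (Complex.I * s) • Axis.x.pauli =
        !![c, -(Complex.I * s); -(Complex.I * s), c] := by
      ext i j; fin_cases i <;> fin_cases j <;> simp [Axis.pauli, pauliX]
    have hV' : (!![c, -(Complex.I * s); -(Complex.I * s), c] : Qubit)ᴴ =
        !![c, Complex.I * s; Complex.I * s, c] := by
      ext i j; fin_cases i <;> fin_cases j <;> simp [hcc, hss]
    rw [hV, hV', Matrix.mul_fin_two, Matrix.mul_fin_two]
    ext i j
    fin_cases i <;> fin_cases j <;> simp [axisRotation, pauliX, pauliY, pauliZ] <;> grind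
  | z =>
    have hV : c • (1 : Qubit) - (Complex.I * s) • Axis.z.pauli =
        !![c - Complex.I * s, 0; 0, c + Complex.I * s] := by
      ext i j; fin_cases i <;> fin_cases j <;> simp [Axis.pauli, pauliZ]
    have hV' : (!![c - Complex.I * s, 0; 0, c + Complex.I * s] : Qubit)ᴴ =
        !![c + Complex.I * s, 0; 0, c - Complex.I * s] := by
      ext i j; fin_cases i <;> fin_cases j <;> simp [hcc, hss]
      ring
    rw [hV, hV', Matrix.mul_fin_two, Matrix.mul_fin_two]
    ext i j
    fin_cases i <;> fin_cases j <;> simp [axisRotation, pauliX, pauliY, pauliZ] <;> grind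

theorem pauliMatrix_blochMap (B : Matrix (Fin 3) (Fin 3) ℂ) :
    pauliMatrix (blochMap B) = !![1, 0, 0, 0; 0, B 0 0, B 0 1, B 0 2; 0, B 1 0, B 1 1, B 1 2;
      0, B 2 0, B 2 1, B 2 2] := by
  have hI := Complex.I_sq
  have h1 : blochMap B 1 = 1 := by
    rw [Matrix.one_fin_two, blochMap_apply_fin_two]
    ext i j; fin_cases i <;> fin_cases j <;> norm_num [pauliX, pauliY, pauliZ]
  have hX : blochMap B pauliX = !![B 2 0, B 0 0 - Complex.I * B 1 0;
      B 0 0 + Complex.I * B 1 0, -B 2 0] := by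
    rw [show pauliX = !![0, 1; 1, 0] from rfl, blochMap_apply_fin_two]
    ext i j; fin_cases i <;> fin_cases j <;> simp [pauliX, pauliY, pauliZ] <;> grind
  have hY : blochMap B pauliY = !![B 2 1, B 0 1 - Complex.I * B 1 1;
      B 0 1 + Complex.I * B 1 1, -B 2 1] := by
    rw [show pauliY = !![0, -Complex.I; Complex.I, 0] from rfl, blochMap_apply_fin_two]
    ext i j; fin_cases i <;> fin_cases j <;> simp [pauliX, pauliY, pauliZ] <;> grind
  have hZ : blochMap B pauliZ = !![B 2 2, B 0 2 - Complex.I * B 1 2;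
      B 0 2 + Complex.I * B 1 2, -B 2 2] := by
    rw [show pauliZ = !![1, 0; 0, -1] from rfl, blochMap_apply_fin_two]
    ext i j; fin_cases i <;> fin_cases j <;> simp [pauliX, pauliY, pauliZ] <;> grind
  have hcol : ∀ i, ∀ x y z : ℂ, (1 / 2 : ℂ) * (pauliBasis i * !![z, x - Complex.I * y;
      x + Complex.I * y, -z]).trace = ![0, x, y, z] i := by
    intro i x y z
    fin_cases i
    · change (1 / 2 : ℂ) * (1 * !![z, x - Complex.I * y; x + Complex.I * y, -z]).trace = 0
      rw [one_mul, Matrix.trace_fin_two_of]; ring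
    · change (1 / 2 : ℂ) * (pauliX * !![z, x - Complex.I * y; x + Complex.I * y, -z]).trace = x
      rw [pauliX, Matrix.mul_fin_two, Matrix.trace_fin_two_of]; ring
    · change (1 / 2 : ℂ) * (pauliY * !![z, x - Complex.I * y; x + Complex.I * y, -z]).trace = y
      rw [pauliY, Matrix.mul_fin_two, Matrix.trace_fin_two_of]
      linear_combination (-y) * hI
    · change (1 / 2 : ℂ) * (pauliZ * !![z, x - Complex.I * y; x + Complex.I * y, -z]).trace = z
      rw [pauliZ, Matrix.mul_fin_two, Matrix.trace_fin_two_of]; ring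
  have hcol1 : ∀ i, (1 / 2 : ℂ) * (pauliBasis i * 1).trace = ![1, 0, 0, 0] i := by
    intro i
    rw [mul_one]
    fin_cases i
    · change (1 / 2 : ℂ) * (1 : Qubit).trace = 1
      rw [Matrix.trace_one, Fintype.card_fin]; norm_num
    · change (1 / 2 : ℂ) * pauliX.trace = 0
      rw [pauliX, Matrix.trace_fin_two_of]; ring
    · change (1 / 2 : ℂ) * pauliY.trace = 0
      rw [pauliY, Matrix.trace_fin_two_of]; ring
    · change (1 / 2 : ℂ) * pauliZ.trace = 0
      rw [pauliZ, Matrix.trace_fin_two_of]; ring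
  ext i j
  rw [pauliMatrix, Matrix.of_apply]
  fin_cases j
  · rw [show pauliBasis ((fun i => i) ⟨0, by norm_num⟩) = 1 from rfl, h1, hcol1]
    fin_cases i <;> rfl
  · rw [show pauliBasis ((fun i => i) ⟨1, by norm_num⟩) = pauliX from rfl, hX, hcol]
    fin_cases i <;> rfl
  · rw [show pauliBasis ((fun i => i) ⟨2, by norm_num⟩) = pauliY from rfl, hY, hcol]
    fin_cases i <;> rfl
  · rw [show pauliBasis ((fun i => i) ⟨3, by norm_num⟩) = pauliZ from rfl, hZ, hcol]
    fin_cases i <;> rfl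

theorem opDist_axisRotation (axis : Axis) (c s c' s' : ℝ) :
    opDist (blochMap (axisRotation axis (c : ℂ) (s : ℂ)))
      (blochMap (axisRotation axis (c' : ℂ) (s' : ℂ))) =
        2 * ‖((c' : ℂ) + s' * Complex.I) - (c + s * Complex.I)‖ := by
  have hnorm : ‖((c' : ℂ) + s' * Complex.I) - (c + s * Complex.I)‖ =
      Real.sqrt ((c' - c) ^ 2 + (s' - s) ^ 2) := by
    rw [show ((c' : ℂ) + s' * Complex.I) - (c + s * Complex.I) =
      ((c' - c : ℝ) : ℂ) + ((s' - s : ℝ) : ℂ) * Complex.I by push_cast; ring,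
      Complex.norm_add_mul_I]
  have htr : (((pauliMatrix (blochMap (axisRotation axis (c' : ℂ) s')) -
      pauliMatrix (blochMap (axisRotation axis (c : ℂ) s)))ᴴ *
        (pauliMatrix (blochMap (axisRotation axis (c' : ℂ) s')) -
      pauliMatrix (blochMap (axisRotation axis (c : ℂ) s)))).trace).re =
        2 * ((c' - c) ^ 2 + (s' - s) ^ 2) := by
    rw [pauliMatrix_blochMap, pauliMatrix_blochMap]
    cases axis <;>
      simp [Matrix.trace, Matrix.mul_apply, Fin.sum_univ_succ, axisRotation] <;> ring
  rw [opDist, htr, hnorm,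
    show 2 * (2 * ((c' - c) ^ 2 + (s' - s) ^ 2)) = 2 ^ 2 * ((c' - c) ^ 2 + (s' - s) ^ 2) by ring,
    Real.sqrt_mul (by norm_num), Real.sqrt_sq (by norm_num)]

/-- The logical error is governed by the characteristic function of the sum of the string order
operators. -/
theorem logicalError_eq {axis : Axis} {N ξ a Δ m : ℕ} {Φ : Vec N} (hΦ : IsResourceState ξ Φ)
    (hΔ : Even Δ) (β σ : ℝ) : logicalError Φ axis a Δ m β σ =
      2 * ‖∑ c, (spectralWeight Φ (a % 2) c : ℂ) * Complex.exp (((splitAngle β σ m *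
        ∑ j ∈ Finset.range m, stringValue N (a + j * Δ) c : ℝ) : ℂ) * Complex.I) -
          Complex.exp (β * Complex.I)‖ := by
  have hexp : ∀ x : ℝ, Complex.exp ((x : ℂ) * Complex.I) =
      (Real.cos x : ℂ) + (Real.sin x : ℂ) * Complex.I := fun x => by
    rw [Complex.exp_mul_I, Complex.ofReal_cos, Complex.ofReal_sin]
  rw [logicalError, logicalOp, blochMatrix_eq hΦ hΔ, logicalRotation_eq_blochMap,
    opDist_axisRotation, hexp]
  simp only [hexp, mul_add, Finset.sum_add_distrib]
  congr 3
  push_cast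
  rw [Finset.sum_mul]
  simp only [mul_assoc]

/-! ### Distant string order operators are independent -/

theorem stringGe_mul_symm_mem_of_odd {N k : ℕ} (hN : Odd N) (hk : Odd k) :
    stringGe N k * symm0 N ∈ localAlg N {i | i ≤ k} := by
  rw [stringGe, symm0, tensorOp_mul]
  refine tensorOp_mem_localAlg fun i _ hi hik => ?_
  rw [Set.mem_ofPred_eq] at hik
  rw [Nat.odd_iff] at hN hk
  simp only [Nat.odd_iff, Nat.even_iff]
  split_ifs <;> first | omega | simp [pauliX_mul_self, pauliZ_mul_self]

theorem stringGe_mul_symm_mem_of_even {N k : ℕ} (hk : Even k) :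
    stringGe N k * symm1 N ∈ localAlg N {i | i ≤ k} := by
  rw [stringGe, symm1, tensorOp_mul]
  refine tensorOp_mem_localAlg fun i _ hi hik => ?_
  rw [Set.mem_ofPred_eq] at hik
  rw [Nat.even_iff] at hk
  simp only [Nat.odd_iff]
  split_ifs <;> first | omega | simp [pauliX_mul_self]

/-- Acting on a symmetric state, the string order operator `𝒦_{≥ k}`, which extends from `k` to the
right end of the chain, can be replaced by one that extends from the left end to `k`. -/
theorem exists_stringGe_mul_mulVec {N ξ k p : ℕ} {Φ : Vec N} (hΦ : IsResourceState ξ Φ)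
    (hkp : k ≤ p) {O : Op N} (hO : O ∈ localAlg N {i | i ≤ p}) :
    ∃ O' ∈ localAlg N {i | i ≤ p}, (stringGe N k * O) *ᵥ Φ = O' *ᵥ Φ := by
  have hmono : localAlg N {i | i ≤ k} ≤ localAlg N {i | i ≤ p} :=
    localAlg_mono fun i (hi : i ≤ k) => le_trans hi hkp
  have key : ∀ S : Op N, S * S = 1 → S *ᵥ Φ = Φ →
      (stringGe N k * O) *ᵥ Φ = (stringGe N k * S * (S * O * S)) *ᵥ Φ := by
    intro S hS hSΦ
    have : stringGe N k * S * (S * O * S) = stringGe N k * (S * S) * O * S := by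
      simp only [mul_assoc]
    rw [this, hS, mul_one, ← Matrix.mulVec_mulVec Φ _ S, hSΦ]
  rcases Nat.even_or_odd k with hk | hk
  · exact ⟨_, mul_mem (hmono (stringGe_mul_symm_mem_of_even hk)) (symm1_conj_mem hO),
      key _ (symm1_mul_self N) hΦ.invariant1⟩
  · exact ⟨_, mul_mem (hmono (stringGe_mul_symm_mem_of_odd hΦ.odd hk)) (symm0_conj_mem hO),
      key _ (symm0_mul_self N) hΦ.invariant0⟩

theorem exists_list_prod_mulVec {N ξ p : ℕ} {Φ : Vec N} (hΦ : IsResourceState ξ Φ) (z : ℂ)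
    (l : List ℕ) (hl : ∀ k ∈ l, k ≤ p) :
    ∃ O ∈ localAlg N {i | i ≤ p},
      (l.map fun k => stringGe N k - z • (1 : Op N)).prod *ᵥ Φ = O *ᵥ Φ := by
  induction l with
  | nil => exact ⟨1, one_mem _, rfl⟩
  | cons k l ih =>
    obtain ⟨O, hO, hOΦ⟩ := ih fun j hj => hl j (by simp [hj])
    obtain ⟨O', hO', hO'Φ⟩ :=
      exists_stringGe_mul_mulVec hΦ (hl k (by simp)) hO
    refine ⟨O' - z • O, sub_mem hO' (Subalgebra.smul_mem _ hO _), ?_⟩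
    rw [List.map_cons, List.prod_cons, mulVec_congr_left _ hOΦ, sub_mul, Matrix.sub_mulVec, hO'Φ,
      smul_mul_assoc, one_mul, Matrix.sub_mulVec]

theorem list_prod_mem_localAlg {N q : ℕ} (z : ℂ) (l : List ℕ) (hl : ∀ k ∈ l, k < N ∧ q ≤ k) :
    (l.map fun k => stringGe N k - z • (1 : Op N)).prod ∈ localAlg N {i | q ≤ i} := by
  refine list_prod_mem fun A hA => ?_
  obtain ⟨k, hk, rfl⟩ := List.mem_map.mp hA
  exact sub_mem (localAlg_mono (fun i (hi : k ≤ i) => le_trans (hl k hk).2 hi)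
    (stringGe_mem_localAlg (hl k hk).1.le)) (Subalgebra.smul_mem _ (one_mem _) _)

theorem spectralHom_list_prod {N r : ℕ} (hN : Odd N) (σ : ℝ) (l : List ℕ)
    (hl : ∀ k ∈ l, k % 2 = r) :
    spectralHom N r (fun c => ((l.map fun k => stringValue N k c - σ).prod : ℝ)) =
      (l.map fun k => stringGe N k - (σ : ℂ) • (1 : Op N)).prod := by
  induction l with
  | nil =>
    have : (fun _ => ((1 : ℝ) : ℂ) : Config N → ℂ) = 1 := funext fun _ => Complex.ofReal_one
    simp only [List.map_nil, List.prod_nil]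
    rw [this, map_one]
  | cons k l ih =>
    have h1 : (fun c : Config N =>
        ((((k :: l).map fun k => stringValue N k c - σ).prod : ℝ) : ℂ)) =
        ((fun c => (stringValue N k c : ℂ)) - fun c => (σ : ℂ) * (1 : Config N → ℂ) c) *
          fun c => (((l.map fun k => stringValue N k c - σ).prod : ℝ) : ℂ) := by
      funext c
      simp
    rw [h1, map_mul, map_sub, ih fun j hj => hl j (by simp [hj]),
      spectralHom_stringValue hN (hl k (by simp)), spectralHom_smul, map_one, List.map_cons,
      List.prod_cons]

/-- Joint moments of string order operators factorize over distant groups of sites. -/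
theorem sum_spectralWeight_mul_of_distant {N ξ r p q : ℕ} {Φ : Vec N} (hΦ : IsResourceState ξ Φ)
    (σ : ℝ) (hpq : p + 2 * ξ < q) (l l' : List ℕ) (hl : ∀ k ∈ l, k < N ∧ q ≤ k ∧ k % 2 = r)
    (hl' : ∀ k ∈ l', k ≤ p ∧ k % 2 = r) :
    ∑ c, spectralWeight Φ r c * ((l.map fun k => stringValue N k c - σ).prod *
        (l'.map fun k => stringValue N k c - σ).prod) =
      (∑ c, spectralWeight Φ r c * (l.map fun k => stringValue N k c - σ).prod) *
        ∑ c, spectralWeight Φ r c * (l'.map fun k => stringValue N k c - σ).prod := by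
  have hE : ∀ g : Config N → ℝ, ((∑ c, spectralWeight Φ r c * g c : ℝ) : ℂ) =
      expval Φ (spectralHom N r fun c => (g c : ℂ)) := fun g => by
    rw [expval_spectralHom]; push_cast; rfl
  have hmul : (fun c : Config N => (((l.map fun k => stringValue N k c - σ).prod *
      (l'.map fun k => stringValue N k c - σ).prod : ℝ) : ℂ)) =
      (fun c => (((l.map fun k => stringValue N k c - σ).prod : ℝ) : ℂ)) *
        fun c => (((l'.map fun k => stringValue N k c - σ).prod : ℝ) : ℂ) :=
    funext fun c => Complex.ofReal_mul _ _
  apply Complex.ofReal_injective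
  rw [Complex.ofReal_mul, hE, hE, hE, hmul, map_mul,
    spectralHom_list_prod hΦ.odd σ l fun k hk => (hl k hk).2.2,
    spectralHom_list_prod hΦ.odd σ l' fun k hk => (hl' k hk).2]
  obtain ⟨O, hO, hOΦ⟩ := exists_list_prod_mulVec hΦ (σ : ℂ) l'
    fun k hk => (hl' k hk).1
  rw [expval_congr (mulVec_congr_left _ hOΦ), expval_congr hOΦ]
  exact expval_mul_of_distant hΦ hpq
    (list_prod_mem_localAlg _ l fun k hk => ⟨(hl k hk).1, (hl k hk).2.1⟩) hO

theorem stringGe_mul_stringGe {N k l : ℕ} (hN : Odd N) (hkl : k < l) (hlN : l < N)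
    (hpar : k % 2 = l % 2) : stringGe N k * stringGe N l = stringBetween N k l := by
  rw [stringGe, stringGe, stringBetween, tensorOp_mul]
  refine tensorOp_congr fun i _ hi => ?_
  rw [Nat.odd_iff] at hN
  simp only [Nat.odd_iff]
  split_ifs <;> first | omega | simp [pauliX_mul_self, pauliZ_mul_self]

theorem sum_spectralWeight_stringValue {N ξ k : ℕ} {Φ : Vec N} (hΦ : IsResourceState ξ Φ) {r : ℕ}
    (hk : k % 2 = r) {σ : ℝ} (hσ : expval Φ (stringGe N k) = (σ : ℂ)) :
    ∑ c, spectralWeight Φ r c * stringValue N k c = σ := by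
  rw [← spectralHom_stringValue hΦ.odd hk, expval_spectralHom] at hσ
  exact_mod_cast hσ

theorem sum_spectralWeight_stringValue_mul {N ξ k l : ℕ} {Φ : Vec N} (hΦ : IsResourceState ξ Φ)
    {r : ℕ} (hkl : k < l) (hlN : l < N) (hk : k % 2 = r) (hl : l % 2 = r) {x : ℝ}
    (hx : expval Φ (stringBetween N k l) = (x : ℂ)) :
    ∑ c, spectralWeight Φ r c * (stringValue N k c * stringValue N l c) = x := by
  rw [← stringGe_mul_stringGe hΦ.odd hkl hlN (by omega), ← spectralHom_stringValue hΦ.odd hk,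
    ← spectralHom_stringValue hΦ.odd hl, ← map_mul, expval_spectralHom] at hx
  have hx' : ((∑ c, spectralWeight Φ r c * (stringValue N k c * stringValue N l c) : ℝ) : ℂ) =
      (x : ℂ) := by
    rw [← hx]; push_cast; rfl
  exact_mod_cast hx'

/-! ### Moments of a sum of finitely dependent random variables -/

/-- In the finite probability space with weights `w`, the moments of the variables `y 0, …, y (m-1)`
vanish as soon as one of the indices is smaller, or larger, than all others by more than `d`. -/
structure FinitelyDependent {Ω : Type*} [Fintype Ω] (w : Ω → ℝ) (y : ℕ → Ω → ℝ) (m d : ℕ) :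
    Prop where
  below : ∀ i < m, ∀ l : List ℕ, (∀ j ∈ l, j < m ∧ i + d < j) →
    ∑ c, w c * (y i c * (l.map fun j => y j c).prod) = 0
  above : ∀ i < m, ∀ l : List ℕ, (∀ j ∈ l, j < m ∧ j + d < i) →
    ∑ c, w c * (y i c * (l.map fun j => y j c).prod) = 0

section Moments

variable {Ω : Type*} [Fintype Ω] {w : Ω → ℝ} {y : ℕ → Ω → ℝ} {m d : ℕ}

theorem abs_sum_weight_le (hw : ∀ c, 0 ≤ w c) (hw1 : ∑ c, w c = 1) {g : Ω → ℝ} {B : ℝ}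
    (hg : ∀ c, |g c| ≤ B) : |∑ c, w c * g c| ≤ B := by
  calc |∑ c, w c * g c| ≤ ∑ c, |w c * g c| := Finset.abs_sum_le_sum_abs _ _
    _ ≤ ∑ c, w c * B := Finset.sum_le_sum fun c _ => by
        rw [abs_mul, abs_of_nonneg (hw c)]
        exact mul_le_mul_of_nonneg_left (hg c) (hw c)
    _ = B := by rw [← Finset.sum_mul, hw1, one_mul]

/-- The indicator of `|i - j| ≤ e`. -/
noncomputable def near (e i j : ℕ) : ℝ := if i ≤ j + e ∧ j ≤ i + e then 1 else 0

theorem near_nonneg (e i j : ℕ) : 0 ≤ near e i j := by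
  rw [near]; split_ifs <;> norm_num

theorem sum_near_le (e i m : ℕ) : ∑ j ∈ Finset.range m, near e i j ≤ 2 * e + 1 := by
  simp only [near]
  rw [Finset.sum_boole]
  have : (Finset.range m).filter (fun j => i ≤ j + e ∧ j ≤ i + e) ⊆ Finset.Icc (i - e) (i + e) := by
    intro j hj
    rw [Finset.mem_filter] at hj
    rw [Finset.mem_Icc]
    omega
  have hcard := Finset.card_le_card this
  rw [Nat.card_Icc] at hcard
  have : ((Finset.range m).filter (fun j => i ≤ j + e ∧ j ≤ i + e)).card ≤ 2 * e + 1 := by omega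
  exact_mod_cast this

/-- A third moment vanishes unless its indices are within `2 * d` of each other: otherwise the smallest
or the largest of them is isolated. -/
theorem abs_third_moment_le (hw : ∀ c, 0 ≤ w c) (hw1 : ∑ c, w c = 1)
    (hy : ∀ j < m, ∀ c, |y j c| ≤ 2) (hdep : FinitelyDependent w y m d) {i j k : ℕ} (hi : i < m)
    (hj : j < m) (hk : k < m) :
    |∑ c, w c * (y i c * (y j c * y k c))| ≤ 8 * (near (2 * d) i j * near (2 * d) i k) := by
  by_cases hnear : (i ≤ j + 2 * d ∧ j ≤ i + 2 * d) ∧ (i ≤ k + 2 * d ∧ k ≤ i + 2 * d)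
  · rw [near, near, if_pos hnear.1, if_pos hnear.2, mul_one, mul_one]
    refine abs_sum_weight_le hw hw1 fun c => ?_
    rw [abs_mul, abs_mul]
    calc |y i c| * (|y j c| * |y k c|) ≤ 2 * (2 * 2) := by
          gcongr
          · exact hy i hi c
          · exact hy j hj c
          · exact hy k hk c
      _ = 8 := by norm_num
  · have hzero : ∑ c, w c * (y i c * (y j c * y k c)) = 0 := by
      have hperm : ∀ a b e : ℕ, (∀ c, y i c * (y j c * y k c) = y a c * (y b c * y e c)) →
          a < m → b < m → e < m → (a + d < b ∧ a + d < e) ∨ (b + d < a ∧ e + d < a) →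
          ∑ c, w c * (y i c * (y j c * y k c)) = 0 := by
        intro a b e habe ha hb he h
        simp only [habe]
        rcases h with h | h
        · simpa using hdep.below a ha [b, e] (by simp; omega)
        · simpa using hdep.above a ha [b, e] (by simp; omega)
      have hcases : ((i + d < j ∧ i + d < k) ∨ (j + d < i ∧ k + d < i)) ∨
          ((j + d < i ∧ j + d < k) ∨ (i + d < j ∧ k + d < j)) ∨
          ((k + d < i ∧ k + d < j) ∨ (i + d < k ∧ j + d < k)) := by omega
      rcases hcases with h | h | h
      · exact hperm i j k (fun _ => rfl) hi hj hk h
      · exact hperm j i k (fun _ => by ring) hj hi hk h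
      · exact hperm k i j (fun _ => by ring) hk hi hj h
    rw [hzero, abs_zero]
    exact mul_nonneg (by norm_num) (mul_nonneg (near_nonneg _ _ _) (near_nonneg _ _ _))

/-- Unless four indices form two pairs of nearby indices, the smallest of them, here `i`, or the
largest of them is farther than `d` from all others. -/
theorem isolated_or_paired_of_min {i j k l d : ℕ} (hij : i ≤ j) (hik : i ≤ k) (hil : i ≤ l)
    (h1 : ¬((i ≤ j + d ∧ j ≤ i + d) ∧ (k ≤ l + d ∧ l ≤ k + d)))
    (h2 : ¬((i ≤ k + d ∧ k ≤ i + d) ∧ (j ≤ l + d ∧ l ≤ j + d)))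
    (h3 : ¬((i ≤ l + d ∧ l ≤ i + d) ∧ (j ≤ k + d ∧ k ≤ j + d))) :
    (i + d < j ∧ i + d < k ∧ i + d < l) ∨ (i + d < j ∧ k + d < j ∧ l + d < j) ∨
      (i + d < k ∧ j + d < k ∧ l + d < k) ∨ (i + d < l ∧ j + d < l ∧ k + d < l) := by
  omega

/-- The nonzero fourth moments have their indices in two pairs of nearby indices. -/
theorem fourth_moment_le (hw : ∀ c, 0 ≤ w c) (hw1 : ∑ c, w c = 1)
    (hy : ∀ j < m, ∀ c, |y j c| ≤ 2) (hdep : FinitelyDependent w y m d) {i j k l : ℕ} (hi : i < m)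
    (hj : j < m) (hk : k < m) (hl : l < m) :
    ∑ c, w c * (y i c * (y j c * (y k c * y l c))) ≤ 16 * (near d i j * near d k l +
      near d i k * near d j l + near d i l * near d j k) := by
  have hn := near_nonneg d
  have h1 := mul_nonneg (hn i j) (hn k l)
  have h2 := mul_nonneg (hn i k) (hn j l)
  have h3 := mul_nonneg (hn i l) (hn j k)
  by_cases hnear : ((i ≤ j + d ∧ j ≤ i + d) ∧ (k ≤ l + d ∧ l ≤ k + d)) ∨
      ((i ≤ k + d ∧ k ≤ i + d) ∧ (j ≤ l + d ∧ l ≤ j + d)) ∨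
      ((i ≤ l + d ∧ l ≤ i + d) ∧ (j ≤ k + d ∧ k ≤ j + d))
  · have hone : 1 ≤ near d i j * near d k l + near d i k * near d j l + near d i l * near d j k := by
      rcases hnear with h | h | h
      · have : near d i j * near d k l = 1 := by rw [near, near, if_pos h.1, if_pos h.2, mul_one]
        linarith
      · have : near d i k * near d j l = 1 := by rw [near, near, if_pos h.1, if_pos h.2, mul_one]
        linarith
      · have : near d i l * near d j k = 1 := by rw [near, near, if_pos h.1, if_pos h.2, mul_one]
        linarith
    have hle : |∑ c, w c * (y i c * (y j c * (y k c * y l c)))| ≤ 16 := by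
      refine abs_sum_weight_le hw hw1 fun c => ?_
      rw [abs_mul, abs_mul, abs_mul]
      calc |y i c| * (|y j c| * (|y k c| * |y l c|)) ≤ 2 * (2 * (2 * 2)) := by
            gcongr
            · exact hy i hi c
            · exact hy j hj c
            · exact hy k hk c
            · exact hy l hl c
        _ = 16 := by norm_num
    linarith [le_abs_self (∑ c, w c * (y i c * (y j c * (y k c * y l c))))]
  · have hzero : ∑ c, w c * (y i c * (y j c * (y k c * y l c))) = 0 := by
      have hperm : ∀ a b e f : ℕ,
          (∀ c, y i c * (y j c * (y k c * y l c)) = y a c * (y b c * (y e c * y f c))) →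
          a < m → b < m → e < m → f < m →
          (a + d < b ∧ a + d < e ∧ a + d < f) ∨ (b + d < a ∧ e + d < a ∧ f + d < a) →
          ∑ c, w c * (y i c * (y j c * (y k c * y l c))) = 0 := by
        intro a b e f habe ha hb he hf h
        simp only [habe]
        rcases h with h | h
        · simpa using hdep.below a ha [b, e, f] (by simp; omega)
        · simpa using hdep.above a ha [b, e, f] (by simp; omega)
      have hmin : ∀ a b e f : ℕ,
          (∀ c, y i c * (y j c * (y k c * y l c)) = y a c * (y b c * (y e c * y f c))) →
          a < m → b < m → e < m → f < m → a ≤ b → a ≤ e → a ≤ f →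
          ¬((a ≤ b + d ∧ b ≤ a + d) ∧ (e ≤ f + d ∧ f ≤ e + d)) →
          ¬((a ≤ e + d ∧ e ≤ a + d) ∧ (b ≤ f + d ∧ f ≤ b + d)) →
          ¬((a ≤ f + d ∧ f ≤ a + d) ∧ (b ≤ e + d ∧ e ≤ b + d)) →
          ∑ c, w c * (y i c * (y j c * (y k c * y l c))) = 0 := by
        intro a b e f habe ha hb he hf hab hae haf h1 h2 h3
        rcases isolated_or_paired_of_min hab hae haf h1 h2 h3 with h | h | h | h
        · exact hperm a b e f habe ha hb he hf (Or.inl h)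
        · exact hperm b a e f (fun c => by rw [habe]; ring) hb ha he hf (Or.inr h)
        · exact hperm e a b f (fun c => by rw [habe]; ring) he ha hb hf (Or.inr h)
        · exact hperm f a b e (fun c => by rw [habe]; ring) hf ha hb he (Or.inr h)
      have hn1 := fun h => hnear (Or.inl h)
      have hn2 := fun h => hnear (Or.inr (Or.inl h))
      have hn3 := fun h => hnear (Or.inr (Or.inr h))
      rcases le_total i j with hij | hij <;> rcases le_total k l with hkl | hkl
      · rcases le_total i k with hik | hik
        · exact hmin i j k l (fun _ => rfl) hi hj hk hl hij hik (hik.trans hkl)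
            hn1 hn2 hn3
        · exact hmin k i j l (fun _ => by ring) hk hi hj hl hik (hik.trans hij) hkl
            (fun h => hn2 ⟨h.1.symm, h.2⟩) (fun h => hn3 ⟨h.2, h.1.symm⟩)
            fun h => hn1 ⟨h.2, h.1⟩
      · rcases le_total i l with hil | hil
        · exact hmin i j k l (fun _ => rfl) hi hj hk hl hij (hil.trans hkl) hil
            hn1 hn2 hn3
        · exact hmin l i j k (fun _ => by ring) hl hi hj hk hil (hil.trans hij) hkl
            (fun h => hn3 ⟨h.1.symm, h.2⟩) (fun h => hn2 ⟨h.2, h.1.symm⟩)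
            fun h => hn1 ⟨h.2, h.1.symm⟩
      · rcases le_total j k with hjk | hjk
        · exact hmin j i k l (fun _ => by ring) hj hi hk hl hij hjk (hjk.trans hkl)
            (fun h => hn1 ⟨h.1.symm, h.2⟩) (fun h => hn3 ⟨h.2, h.1⟩)
            fun h => hn2 ⟨h.2, h.1⟩
        · exact hmin k i j l (fun _ => by ring) hk hi hj hl (hjk.trans hij) hjk hkl
            (fun h => hn2 ⟨h.1.symm, h.2⟩) (fun h => hn3 ⟨h.2, h.1.symm⟩)
            fun h => hn1 ⟨h.2, h.1⟩
      · rcases le_total j l with hjl | hjl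
        · exact hmin j i k l (fun _ => by ring) hj hi hk hl hij (hjl.trans hkl) hjl
            (fun h => hn1 ⟨h.1.symm, h.2⟩) (fun h => hn3 ⟨h.2, h.1⟩)
            fun h => hn2 ⟨h.2, h.1⟩
        · exact hmin l i j k (fun _ => by ring) hl hi hj hk (hjl.trans hij) hjl hkl
            (fun h => hn3 ⟨h.1.symm, h.2⟩) (fun h => hn2 ⟨h.2, h.1.symm⟩)
            fun h => hn1 ⟨h.2, h.1.symm⟩
    rw [hzero]
    linarith

theorem sum_weight_third_power (w : Ω → ℝ) (y : ℕ → Ω → ℝ) (m : ℕ) :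
    ∑ c, w c * (∑ j ∈ Finset.range m, y j c) ^ 3 = ∑ i ∈ Finset.range m, ∑ j ∈ Finset.range m,
      ∑ k ∈ Finset.range m, ∑ c, w c * (y i c * (y j c * y k c)) := by
  have h : ∀ c, w c * (∑ j ∈ Finset.range m, y j c) ^ 3 = ∑ i ∈ Finset.range m,
      ∑ j ∈ Finset.range m, ∑ k ∈ Finset.range m, w c * (y i c * (y j c * y k c)) := by
    intro c
    rw [show (∑ j ∈ Finset.range m, y j c) ^ 3 = (∑ j ∈ Finset.range m, y j c) *
      ((∑ j ∈ Finset.range m, y j c) * ∑ j ∈ Finset.range m, y j c) by ring]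
    simp only [Finset.sum_mul]
    simp only [Finset.mul_sum]
  simp only [h]
  rw [Finset.sum_comm]
  refine Finset.sum_congr rfl fun i _ => ?_
  rw [Finset.sum_comm]
  refine Finset.sum_congr rfl fun j _ => ?_
  rw [Finset.sum_comm]

theorem sum_weight_fourth_power (w : Ω → ℝ) (y : ℕ → Ω → ℝ) (m : ℕ) :
    ∑ c, w c * (∑ j ∈ Finset.range m, y j c) ^ 4 = ∑ i ∈ Finset.range m, ∑ j ∈ Finset.range m,
      ∑ k ∈ Finset.range m, ∑ l ∈ Finset.range m,
        ∑ c, w c * (y i c * (y j c * (y k c * y l c))) := by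
  have h : ∀ c, w c * (∑ j ∈ Finset.range m, y j c) ^ 4 = ∑ i ∈ Finset.range m,
      ∑ j ∈ Finset.range m, ∑ k ∈ Finset.range m, ∑ l ∈ Finset.range m,
        w c * (y i c * (y j c * (y k c * y l c))) := by
    intro c
    rw [show (∑ j ∈ Finset.range m, y j c) ^ 4 = (∑ j ∈ Finset.range m, y j c) *
      ((∑ j ∈ Finset.range m, y j c) * ((∑ j ∈ Finset.range m, y j c) *
        ∑ j ∈ Finset.range m, y j c)) by ring]
    simp only [Finset.sum_mul]
    simp only [Finset.mul_sum]
  simp only [h]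
  rw [Finset.sum_comm]
  refine Finset.sum_congr rfl fun i _ => ?_
  rw [Finset.sum_comm]
  refine Finset.sum_congr rfl fun j _ => ?_
  rw [Finset.sum_comm]
  refine Finset.sum_congr rfl fun k _ => ?_
  rw [Finset.sum_comm]

theorem abs_sum_weight_third_power_le (hw : ∀ c, 0 ≤ w c) (hw1 : ∑ c, w c = 1)
    (hy : ∀ j < m, ∀ c, |y j c| ≤ 2) (hdep : FinitelyDependent w y m d) :
    |∑ c, w c * (∑ j ∈ Finset.range m, y j c) ^ 3| ≤ 8 * (4 * d + 1) ^ 2 * m := by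
  rw [sum_weight_third_power]
  have hD : ∀ i, ∑ j ∈ Finset.range m, near (2 * d) i j ≤ 4 * d + 1 := fun i => by
    have := sum_near_le (2 * d) i m
    push_cast at this
    linarith
  have hD0 : ∀ i, 0 ≤ ∑ j ∈ Finset.range m, near (2 * d) i j := fun i =>
    Finset.sum_nonneg fun j _ => near_nonneg _ _ _
  calc _ ≤ ∑ i ∈ Finset.range m, ∑ j ∈ Finset.range m, ∑ k ∈ Finset.range m,
        8 * (near (2 * d) i j * near (2 * d) i k) := by
        refine (Finset.abs_sum_le_sum_abs _ _).trans (Finset.sum_le_sum fun i hi => ?_)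
        refine (Finset.abs_sum_le_sum_abs _ _).trans (Finset.sum_le_sum fun j hj => ?_)
        refine (Finset.abs_sum_le_sum_abs _ _).trans (Finset.sum_le_sum fun k hk => ?_)
        exact abs_third_moment_le hw hw1 hy hdep (Finset.mem_range.mp hi) (Finset.mem_range.mp hj)
          (Finset.mem_range.mp hk)
    _ = ∑ i ∈ Finset.range m, 8 * ((∑ j ∈ Finset.range m, near (2 * d) i j) *
          ∑ k ∈ Finset.range m, near (2 * d) i k) := by
        refine Finset.sum_congr rfl fun i _ => ?_
        rw [Finset.sum_mul_sum, Finset.mul_sum]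
        simp only [Finset.mul_sum]
    _ ≤ ∑ i ∈ Finset.range m, 8 * ((4 * d + 1) * (4 * d + 1) : ℝ) :=
        Finset.sum_le_sum fun i _ => by
          have := mul_le_mul (hD i) (hD i) (hD0 i) (by positivity)
          linarith
    _ = _ := by rw [Finset.sum_const, Finset.card_range, nsmul_eq_mul]; ring

theorem sum_weight_fourth_power_le (hw : ∀ c, 0 ≤ w c) (hw1 : ∑ c, w c = 1)
    (hy : ∀ j < m, ∀ c, |y j c| ≤ 2) (hdep : FinitelyDependent w y m d) :
    ∑ c, w c * (∑ j ∈ Finset.range m, y j c) ^ 4 ≤ 48 * (2 * d + 1) ^ 2 * m ^ 2 := by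
  rw [sum_weight_fourth_power]
  set s := Finset.range m with hs
  have hD : ∀ i, ∑ j ∈ s, near d i j ≤ 2 * d + 1 := fun i => sum_near_le d i m
  have hD0 : ∀ i, 0 ≤ ∑ j ∈ s, near d i j := fun i => Finset.sum_nonneg fun j _ => near_nonneg _ _ _
  have hDm : ∑ i ∈ s, ∑ j ∈ s, near d i j ≤ m * (2 * d + 1) := by
    calc _ ≤ ∑ i ∈ s, (2 * d + 1 : ℝ) := Finset.sum_le_sum fun i _ => hD i
      _ = _ := by rw [Finset.sum_const, hs, Finset.card_range, nsmul_eq_mul]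
  calc _ ≤ ∑ i ∈ s, ∑ j ∈ s, ∑ k ∈ s, ∑ l ∈ s, 16 * (near d i j * near d k l +
        near d i k * near d j l + near d i l * near d j k) := by
        refine Finset.sum_le_sum fun i hi => Finset.sum_le_sum fun j hj =>
          Finset.sum_le_sum fun k hk => Finset.sum_le_sum fun l hl => ?_
        exact fourth_moment_le hw hw1 hy hdep (Finset.mem_range.mp hi) (Finset.mem_range.mp hj)
          (Finset.mem_range.mp hk) (Finset.mem_range.mp hl)
    _ = ∑ i ∈ s, ∑ j ∈ s, (16 * (near d i j * ∑ k ∈ s, ∑ l ∈ s, near d k l) +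
          32 * ((∑ k ∈ s, near d i k) * ∑ l ∈ s, near d j l)) := by
        refine Finset.sum_congr rfl fun i _ => Finset.sum_congr rfl fun j _ => ?_
        simp only [mul_add, Finset.sum_add_distrib, ← Finset.mul_sum]
        have : ∑ k ∈ s, ∑ l ∈ s, near d i l * near d j k =
            (∑ k ∈ s, near d i k) * ∑ l ∈ s, near d j l := by
          rw [Finset.sum_comm, Finset.sum_mul_sum]
        rw [this, ← Finset.sum_mul]
        ring
    _ ≤ ∑ i ∈ s, ∑ j ∈ s, (16 * (near d i j * (m * (2 * d + 1))) +
          32 * ((2 * d + 1) * (2 * d + 1)) : ℝ) := by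
        refine Finset.sum_le_sum fun i _ => Finset.sum_le_sum fun j _ => ?_
        have h1 := mul_le_mul_of_nonneg_left hDm (near_nonneg d i j)
        have h2 := mul_le_mul (hD i) (hD j) (hD0 j) (by positivity)
        linarith
    _ = 16 * (m * (2 * d + 1)) * (∑ i ∈ s, ∑ j ∈ s, near d i j) +
          32 * ((2 * d + 1) * (2 * d + 1)) * m ^ 2 := by
        simp only [Finset.sum_add_distrib, ← Finset.mul_sum, ← Finset.sum_mul, Finset.sum_const, hs,
          Finset.card_range, nsmul_eq_mul]
        ring
    _ ≤ 16 * (m * (2 * d + 1)) * (m * (2 * d + 1)) +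
          32 * ((2 * d + 1) * (2 * d + 1)) * m ^ 2 := by
        gcongr
    _ = _ := by ring

/-! ### The characteristic function to second order -/

/-- The third-order term is kept, since the third moment of a sum of `m` finitely dependent variables is
`O(m)` while its absolute third moment is only `O(m ^ (3/2))`. -/
theorem norm_exp_mul_I_sub_taylor_le (x : ℝ) :
    ‖Complex.exp (x * Complex.I) - (1 + x * Complex.I - x ^ 2 / 2 - x ^ 3 / 6 * Complex.I)‖ ≤
      4 * x ^ 4 := by
  have hI2 : Complex.I ^ 2 = -1 := Complex.I_sq
  have hnorm : ‖(x : ℂ) * Complex.I‖ = |x| := by simp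
  have hx4 : |x| ^ 4 = x ^ 4 := by rw [← abs_pow, abs_of_nonneg (by positivity)]
  by_cases h : |x| ≤ 1
  · have := Complex.exp_bound (x := (x : ℂ) * Complex.I) (by rw [hnorm]; exact h) (n := 4)
      (by norm_num)
    rw [hnorm, hx4] at this
    have hsum : ∑ k ∈ Finset.range 4, ((x : ℂ) * Complex.I) ^ k / (k.factorial : ℂ) =
        1 + x * Complex.I - x ^ 2 / 2 - x ^ 3 / 6 * Complex.I := by
      simp only [Finset.sum_range_succ, Finset.sum_range_zero, Nat.factorial]
      push_cast
      linear_combination (x ^ 2 / 2 + x ^ 3 / 6 * Complex.I : ℂ) * hI2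
    rw [hsum] at this
    refine this.trans ?_
    have h4 : 0 ≤ x ^ 4 := by positivity
    norm_num [Nat.factorial]
    linarith
  · push Not at h
    have h2 : ‖(x : ℂ) ^ 2 / 2‖ = |x| ^ 2 / 2 := by simp
    have h3 : ‖(x : ℂ) ^ 3 / 6 * Complex.I‖ = |x| ^ 3 / 6 := by simp
    have hb : ‖Complex.exp (x * Complex.I) -
        (1 + x * Complex.I - x ^ 2 / 2 - x ^ 3 / 6 * Complex.I)‖ ≤
        1 + (1 + |x| + |x| ^ 2 / 2 + |x| ^ 3 / 6) := by
      refine (norm_sub_le _ _).trans (add_le_add (Complex.norm_exp_ofReal_mul_I x).le ?_)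
      refine (norm_sub_le _ _).trans (add_le_add ?_ h3.le)
      refine (norm_sub_le _ _).trans (add_le_add ?_ h2.le)
      exact (norm_add_le _ _).trans (by rw [norm_one, hnorm])
    refine hb.trans ?_
    rw [← hx4]
    have e1 : (1 : ℝ) ≤ |x| ^ 4 := one_le_pow₀ h.le
    have e2 : |x| ≤ |x| ^ 4 := le_self_pow₀ h.le (by norm_num)
    have e3 : |x| ^ 2 ≤ |x| ^ 4 := pow_le_pow_right₀ h.le (by norm_num)
    have e4 : |x| ^ 3 ≤ |x| ^ 4 := pow_le_pow_right₀ h.le (by norm_num)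
    linarith

/-- The characteristic function of a centered random variable `T`, with second-order term and with
an error controlled by the third and the fourth moment. -/
theorem norm_charFun_sub_le (hw : ∀ c, 0 ≤ w c) (hw1 : ∑ c, w c = 1) {T : Ω → ℝ}
    (hT : ∑ c, w c * T c = 0) (g : ℝ) :
    ‖∑ c, (w c : ℂ) * Complex.exp ((g * T c : ℝ) * Complex.I) - 1 +
        (g ^ 2 / 2 * ∑ c, w c * T c ^ 2 : ℝ)‖ ≤
      |g| ^ 3 / 6 * |∑ c, w c * T c ^ 3| + 4 * g ^ 4 * ∑ c, w c * T c ^ 4 := by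
  have hsplit : ∑ c, (w c : ℂ) * Complex.exp ((g * T c : ℝ) * Complex.I) - 1 +
      (g ^ 2 / 2 * ∑ c, w c * T c ^ 2 : ℝ) =
      ∑ c, (w c : ℂ) * (Complex.exp ((g * T c : ℝ) * Complex.I) -
        (1 + (g * T c : ℝ) * Complex.I - (g * T c : ℝ) ^ 2 / 2 -
          (g * T c : ℝ) ^ 3 / 6 * Complex.I)) -
      ((g ^ 3 / 6 * ∑ c, w c * T c ^ 3 : ℝ) : ℂ) * Complex.I := by
    have e1 : ∑ c, (w c : ℂ) = 1 := by exact_mod_cast hw1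
    have eT : ∑ c, (w c : ℂ) * (T c : ℂ) = 0 := by exact_mod_cast hT
    have expand : ∀ c, (w c : ℂ) * (Complex.exp ((g * T c : ℝ) * Complex.I) -
        (1 + (g * T c : ℝ) * Complex.I - (g * T c : ℝ) ^ 2 / 2 -
          (g * T c : ℝ) ^ 3 / 6 * Complex.I)) =
        (w c : ℂ) * Complex.exp ((g * T c : ℝ) * Complex.I) - (w c : ℂ) -
          (g * Complex.I) * ((w c : ℂ) * T c) + (g ^ 2 / 2 : ℂ) * ((w c : ℂ) * (T c : ℂ) ^ 2) +
          (g ^ 3 / 6 * Complex.I) * ((w c : ℂ) * (T c : ℂ) ^ 3) := by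
      intro c
      push_cast
      ring
    simp only [expand, Finset.sum_add_distrib, Finset.sum_sub_distrib, ← Finset.mul_sum, e1, eT]
    push_cast
    ring
  rw [hsplit]
  refine (norm_sub_le _ _).trans ?_
  rw [add_comm]
  refine add_le_add (le_of_eq ?_) ?_
  · rw [norm_mul, Complex.norm_I, mul_one, Complex.norm_real, Real.norm_eq_abs, abs_mul, abs_div,
      abs_pow]
    norm_num
  · refine (norm_sum_le _ _).trans ?_
    rw [Finset.mul_sum]
    refine Finset.sum_le_sum fun c _ => ?_
    rw [norm_mul, Complex.norm_real, Real.norm_eq_abs, abs_of_nonneg (hw c)]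
    have := mul_le_mul_of_nonneg_left (norm_exp_mul_I_sub_taylor_le (g * T c)) (hw c)
    refine this.trans (le_of_eq ?_)
    ring

/-! ### The variance of a stationary sequence -/

/-- A double sum over a Toeplitz matrix, grouped by lags. -/
theorem sum_sum_stationary (v : ℕ → ℕ → ℝ) (f : ℕ → ℝ) (m : ℕ) (hsymm : ∀ i j, v i j = v j i)
    (hdiag : ∀ i < m, v i i = f 0) (hoff : ∀ i j, i < j → j < m → v i j = f (j - i)) :
    ∑ i ∈ Finset.range m, ∑ j ∈ Finset.range m, v i j =
      m * f 0 + 2 * ∑ t ∈ Finset.Ico 1 m, ((m : ℝ) - t) * f t := by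
  induction m with
  | zero => simp
  | succ m ih =>
    have hrow : ∑ i ∈ Finset.range m, v i m = ∑ t ∈ Finset.Ico 1 (m + 1), f t := by
      rw [Finset.sum_Ico_eq_sum_range, Nat.add_sub_cancel, ← Finset.sum_range_reflect]
      refine Finset.sum_congr rfl fun i hi => ?_
      have := Finset.mem_range.mp hi
      rw [hoff _ _ (by omega) (by omega)]
      congr 1
      omega
    have hstep : ∑ t ∈ Finset.Ico 1 (m + 1), (((m + 1 : ℕ) : ℝ) - t) * f t =
        ∑ t ∈ Finset.Ico 1 m, ((m : ℝ) - t) * f t + ∑ t ∈ Finset.Ico 1 (m + 1), f t := by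
      have h1 : ∑ t ∈ Finset.Ico 1 m, ((m : ℝ) - t) * f t =
          ∑ t ∈ Finset.Ico 1 (m + 1), ((m : ℝ) - t) * f t := by
        rcases Nat.eq_zero_or_pos m with rfl | hm
        · simp
        · rw [Finset.sum_Ico_succ_top hm, sub_self, zero_mul, add_zero]
      rw [h1, ← Finset.sum_add_distrib]
      refine Finset.sum_congr rfl fun t _ => ?_
      push_cast
      ring
    rw [Finset.sum_range_succ]
    simp only [Finset.sum_range_succ, Finset.sum_add_distrib]
    rw [ih (fun i hi => hdiag i (by omega)) (fun i j hij hj => hoff i j hij (by omega)), hrow,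
      hstep, hdiag m (by omega)]
    simp only [hsymm m]
    rw [hrow]
    push_cast
    ring

theorem sum_weight_sq (w : Ω → ℝ) (y : ℕ → Ω → ℝ) (m : ℕ) :
    ∑ c, w c * (∑ j ∈ Finset.range m, y j c) ^ 2 = ∑ i ∈ Finset.range m, ∑ j ∈ Finset.range m,
      ∑ c, w c * (y i c * y j c) := by
  have h : ∀ c, w c * (∑ j ∈ Finset.range m, y j c) ^ 2 = ∑ i ∈ Finset.range m,
      ∑ j ∈ Finset.range m, w c * (y i c * y j c) := by
    intro c
    rw [sq, Finset.sum_mul_sum]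
    simp only [Finset.mul_sum]
  simp only [h]
  rw [Finset.sum_comm]
  refine Finset.sum_congr rfl fun i _ => ?_
  rw [Finset.sum_comm]

/-- A sum over lags that vanishes beyond the dependence range `d` is bounded independently of the
number of terms. -/
theorem abs_sum_Ico_le {f : ℕ → ℝ} {B : ℝ} (hB : 0 ≤ B) (hf : ∀ t ∈ Finset.Ico 1 m, |f t| ≤ B)
    (hzero : ∀ t ∈ Finset.Ico 1 m, d < t → f t = 0) :
    |∑ t ∈ Finset.Ico 1 m, f t| ≤ d * B := by
  calc |∑ t ∈ Finset.Ico 1 m, f t| ≤ ∑ t ∈ Finset.Ico 1 m, |f t| := Finset.abs_sum_le_sum_abs _ _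
    _ = ∑ t ∈ (Finset.Ico 1 m).filter (· ≤ d), |f t| := by
        rw [Finset.sum_filter]
        refine Finset.sum_congr rfl fun t ht => ?_
        split_ifs with h
        · rfl
        · rw [hzero t ht (by omega), abs_zero]
    _ ≤ ∑ t ∈ (Finset.Ico 1 m).filter (· ≤ d), B :=
        Finset.sum_le_sum fun t ht => hf t (Finset.mem_filter.mp ht).1
    _ = ((Finset.Ico 1 m).filter (· ≤ d)).card * B := by rw [Finset.sum_const, nsmul_eq_mul]
    _ ≤ d * B := by
        refine mul_le_mul_of_nonneg_right ?_ hB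
        have hsub : (Finset.Ico 1 m).filter (· ≤ d) ⊆ Finset.Icc 1 d := fun t ht => by
          rw [Finset.mem_filter, Finset.mem_Ico] at ht
          rw [Finset.mem_Icc]
          omega
        have := Finset.card_le_card hsub
        rw [Nat.card_Icc, Nat.add_sub_cancel] at this
        exact_mod_cast this

end Moments

/-! ### Expansion of the logical error -/

section Error

variable {axis : Axis} {N ξ Δ m P a : ℕ} {Φ : Vec N} {σ : ℝ} {K : ℕ → ℝ}

theorem site_add_lt (hΔ : 0 < Δ) {i j : ℕ} (h : i + 2 * ξ < j) :
    a + i * Δ + 2 * ξ < a + j * Δ := by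
  have h1 : (i + 2 * ξ + 1) * Δ ≤ j * Δ := Nat.mul_le_mul_right Δ h
  have h2 : 2 * ξ + 1 ≤ (2 * ξ + 1) * Δ := Nat.le_mul_of_pos_right _ hΔ
  have h3 : (i + 2 * ξ + 1) * Δ = i * Δ + (2 * ξ + 1) * Δ := by ring
  omega

theorem site_mod_two (hΔ : Even Δ) (j : ℕ) : (a + j * Δ) % 2 = a % 2 := by
  rw [Nat.add_mod, Nat.mul_mod, Nat.even_iff.mp hΔ]; simp

/-- The deviation of the string order operator at the `j`-th rotation site from its mean value, as
a random variable on the joint spectrum. -/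
noncomputable def deviation (N a Δ : ℕ) (σ : ℝ) (j : ℕ) (c : Config N) : ℝ :=
  stringValue N (a + j * Δ) c - σ

theorem sum_weight_value (hΔ : Even Δ) (hΦ : IsResourceState ξ Φ)
    (hK : IsHomogeneous Φ (rotationSites a Δ m) σ K) {j : ℕ} (hj : j < m) :
    ∑ c, spectralWeight Φ (a % 2) c * stringValue N (a + j * Δ) c = σ :=
  sum_spectralWeight_stringValue hΦ (site_mod_two hΔ j) (hK.1 _ (mem_rotationSites.mpr ⟨j, hj, rfl⟩))

theorem sum_weight_deviation (hΔ : Even Δ) (hΦ : IsResourceState ξ Φ)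
    (hK : IsHomogeneous Φ (rotationSites a Δ m) σ K) {j : ℕ} (hj : j < m) :
    ∑ c, spectralWeight Φ (a % 2) c * deviation N a Δ σ j c = 0 := by
  simp only [deviation, mul_sub, Finset.sum_sub_distrib, ← Finset.sum_mul]
  rw [sum_weight_value hΔ hΦ hK hj, sum_spectralWeight hΦ, one_mul, sub_self]

theorem abs_stringValue (N k : ℕ) (c : Config N) : |stringValue N k c| = 1 := by
  rcases stringValue_eq N k c with h | h <;> simp [h]

theorem abs_mean_le_one (hL : IsLayout axis ξ Δ N m P a) (hΔ : Even Δ) (hΦ : IsResourceState ξ Φ)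
    (hK : IsHomogeneous Φ (rotationSites a Δ m) σ K) : |σ| ≤ 1 := by
  rw [← sum_weight_value hΔ hΦ hK hL.steps_pos]
  exact abs_sum_weight_le (spectralWeight_nonneg Φ _) (sum_spectralWeight hΦ _)
    fun c => (abs_stringValue _ _ c).le

theorem abs_deviation_le (hL : IsLayout axis ξ Δ N m P a) (hΔ : Even Δ) (hΦ : IsResourceState ξ Φ)
    (hK : IsHomogeneous Φ (rotationSites a Δ m) σ K) (j : ℕ) (c : Config N) :
    |deviation N a Δ σ j c| ≤ 2 := by
  have h1 := abs_mean_le_one hL hΔ hΦ hK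
  have h2 := abs_stringValue N (a + j * Δ) c
  rw [deviation]
  linarith [abs_sub (stringValue N (a + j * Δ) c) σ]

theorem finitelyDependent_deviation (hΔ : 0 < Δ) (hΔ2 : Even Δ) (hL : IsLayout axis ξ Δ N m P a)
    (hΦ : IsResourceState ξ Φ) (hK : IsHomogeneous Φ (rotationSites a Δ m) σ K) :
    FinitelyDependent (spectralWeight Φ (a % 2)) (deviation N a Δ σ) m (2 * ξ) where
  below i hi l hl := by
    have hpq : a + i * Δ + 2 * ξ < a + (i + 2 * ξ + 1) * Δ := site_add_lt hΔ (by omega)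
    have h := sum_spectralWeight_mul_of_distant (r := a % 2) hΦ σ hpq
      (l.map fun j => a + j * Δ) [a + i * Δ]
      (by
        intro k hk
        obtain ⟨j, hj, rfl⟩ := List.mem_map.mp hk
        refine ⟨layout_site_lt hL (hl j hj).1, ?_, site_mod_two hΔ2 j⟩
        exact Nat.add_le_add_left (Nat.mul_le_mul_right Δ (hl j hj).2) a)
      (by
        intro k hk
        rw [List.mem_singleton] at hk
        subst hk
        exact ⟨le_rfl, site_mod_two hΔ2 i⟩)
    simp only [List.map_map, List.map_singleton, List.prod_singleton] at h
    have h0 := sum_weight_deviation hΔ2 hΦ hK hi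
    simp only [deviation] at h0
    rw [h0, mul_zero] at h
    rw [← h]
    exact Finset.sum_congr rfl fun c _ => by rw [mul_comm (deviation N a Δ σ i c)]; rfl
  above i hi l hl := by
    have hbuf := hL.buffer
    have hpq : a + i * Δ - (2 * ξ + 1) + 2 * ξ < a + i * Δ := by
      have : 2 * ξ + 1 ≤ a + i * Δ := by omega
      omega
    have h := sum_spectralWeight_mul_of_distant (r := a % 2) hΦ σ hpq
      [a + i * Δ] (l.map fun j => a + j * Δ)
      (by
        intro k hk
        rw [List.mem_singleton] at hk
        subst hk
        exact ⟨layout_site_lt hL hi, le_rfl, site_mod_two hΔ2 i⟩)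
      (by
        intro k hk
        obtain ⟨j, hj, rfl⟩ := List.mem_map.mp hk
        refine ⟨?_, site_mod_two hΔ2 j⟩
        have := site_add_lt (a := a) (ξ := ξ) hΔ (hl j hj).2
        omega)
    simp only [List.map_map, List.map_singleton, List.prod_singleton] at h
    have h0 := sum_weight_deviation hΔ2 hΦ hK hi
    simp only [deviation] at h0
    rw [h0, zero_mul] at h
    rw [← h]
    rfl

/-- The covariance of two string order operators at distance `t` (in units of the spacing). -/
def covariance (σ : ℝ) (K : ℕ → ℝ) (Δ t : ℕ) : ℝ :=
  if t = 0 then 1 - σ ^ 2 else K (t * Δ) - σ ^ 2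

theorem sum_weight_deviation_sq (hΔ : Even Δ) (hΦ : IsResourceState ξ Φ)
    (hK : IsHomogeneous Φ (rotationSites a Δ m) σ K) {j : ℕ} (hj : j < m) :
    ∑ c, spectralWeight Φ (a % 2) c * (deviation N a Δ σ j c * deviation N a Δ σ j c) =
      covariance σ K Δ 0 := by
  have h1 := sum_weight_value hΔ hΦ hK hj
  have h2 := sum_spectralWeight hΦ (a % 2)
  have h : ∀ c, spectralWeight Φ (a % 2) c *
      (deviation N a Δ σ j c * deviation N a Δ σ j c) = spectralWeight Φ (a % 2) c * (1 + σ ^ 2) -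
        2 * σ * (spectralWeight Φ (a % 2) c * stringValue N (a + j * Δ) c) := by
    intro c
    have : stringValue N (a + j * Δ) c ^ 2 = 1 := by
      rcases stringValue_eq N (a + j * Δ) c with h | h <;> simp [h]
    rw [deviation]
    linear_combination spectralWeight Φ (a % 2) c * this
  simp only [h, Finset.sum_sub_distrib, ← Finset.sum_mul, ← Finset.mul_sum, h1, h2]
  rw [covariance, if_pos rfl]
  ring

theorem sum_weight_deviation_mul (hΔ : 0 < Δ) (hΔ2 : Even Δ) (hL : IsLayout axis ξ Δ N m P a)
    (hΦ : IsResourceState ξ Φ) (hK : IsHomogeneous Φ (rotationSites a Δ m) σ K) {i j : ℕ}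
    (hij : i < j) (hj : j < m) :
    ∑ c, spectralWeight Φ (a % 2) c * (deviation N a Δ σ i c * deviation N a Δ σ j c) =
      covariance σ K Δ (j - i) := by
  have hi : i < m := hij.trans hj
  have hlt : a + i * Δ < a + j * Δ := site_add_lt (ξ := 0) hΔ (by omega)
  have hsub : a + j * Δ - (a + i * Δ) = (j - i) * Δ := by
    rw [Nat.add_sub_add_left, Nat.sub_mul]
  have h0 := sum_spectralWeight_stringValue_mul hΦ hlt (layout_site_lt hL hj) (site_mod_two hΔ2 i)
    (site_mod_two hΔ2 j) (hK.2 _ (mem_rotationSites.mpr ⟨i, hi, rfl⟩) _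
      (mem_rotationSites.mpr ⟨j, hj, rfl⟩) hlt)
  rw [hsub] at h0
  have h1 := sum_weight_value hΔ2 hΦ hK hi
  have h1' := sum_weight_value hΔ2 hΦ hK hj
  have h2 := sum_spectralWeight hΦ (a % 2)
  have h : ∀ c, spectralWeight Φ (a % 2) c *
      (deviation N a Δ σ i c * deviation N a Δ σ j c) =
        spectralWeight Φ (a % 2) c * (stringValue N (a + i * Δ) c * stringValue N (a + j * Δ) c) -
        σ * (spectralWeight Φ (a % 2) c * stringValue N (a + i * Δ) c) -
        σ * (spectralWeight Φ (a % 2) c * stringValue N (a + j * Δ) c) +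
        spectralWeight Φ (a % 2) c * σ ^ 2 := by
    intro c
    rw [deviation, deviation]
    ring
  simp only [h, Finset.sum_add_distrib, Finset.sum_sub_distrib, ← Finset.sum_mul, ← Finset.mul_sum,
    h0, h1, h1', h2]
  rw [covariance, if_neg (by omega)]
  ring

theorem sum_weight_deviation_zero_mul (hΔ : 0 < Δ) (hΔ2 : Even Δ) (hL : IsLayout axis ξ Δ N m P a)
    (hΦ : IsResourceState ξ Φ) (hK : IsHomogeneous Φ (rotationSites a Δ m) σ K) {t : ℕ}
    (ht : t ∈ Finset.Ico 1 m) :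
    ∑ c, spectralWeight Φ (a % 2) c * (deviation N a Δ σ 0 c * deviation N a Δ σ t c) =
      covariance σ K Δ t := by
  rw [Finset.mem_Ico] at ht
  have := sum_weight_deviation_mul hΔ hΔ2 hL hΦ hK (i := 0) (j := t) (by omega) ht.2
  rwa [Nat.sub_zero] at this

theorem abs_covariance_le (hΔ : 0 < Δ) (hΔ2 : Even Δ) (hL : IsLayout axis ξ Δ N m P a)
    (hΦ : IsResourceState ξ Φ) (hK : IsHomogeneous Φ (rotationSites a Δ m) σ K) {t : ℕ}
    (ht : t ∈ Finset.Ico 1 m) : |covariance σ K Δ t| ≤ 4 := by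
  rw [← sum_weight_deviation_zero_mul hΔ hΔ2 hL hΦ hK ht]
  refine abs_sum_weight_le (spectralWeight_nonneg Φ _) (sum_spectralWeight hΦ _) fun c => ?_
  rw [abs_mul]
  have h0 := abs_deviation_le hL hΔ2 hΦ hK 0 c
  have h1 := abs_deviation_le hL hΔ2 hΦ hK t c
  calc _ ≤ (2 : ℝ) * 2 := mul_le_mul h0 h1 (abs_nonneg _) (by norm_num)
    _ = 4 := by norm_num

theorem covariance_eq_zero (hΔ : 0 < Δ) (hΔ2 : Even Δ) (hL : IsLayout axis ξ Δ N m P a)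
    (hΦ : IsResourceState ξ Φ) (hK : IsHomogeneous Φ (rotationSites a Δ m) σ K) {t : ℕ}
    (ht : t ∈ Finset.Ico 1 m) (hξ : 2 * ξ < t) : covariance σ K Δ t = 0 := by
  rw [← sum_weight_deviation_zero_mul hΔ hΔ2 hL hΦ hK ht]
  rw [Finset.mem_Ico] at ht
  have := (finitelyDependent_deviation hΔ hΔ2 hL hΦ hK).below 0 hL.steps_pos [t]
    (by simp; omega)
  simpa using this

/-- In the degenerate case `⟨𝒦_≥⟩² = 1` the string order operators do not fluctuate. -/
theorem covariance_eq_zero_of_sq (hΔ : 0 < Δ) (hΔ2 : Even Δ) (hL : IsLayout axis ξ Δ N m P a)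
    (hΦ : IsResourceState ξ Φ) (hK : IsHomogeneous Φ (rotationSites a Δ m) σ K) {t : ℕ}
    (ht : t ∈ Finset.Ico 1 m) (hσ : σ ^ 2 = 1) : covariance σ K Δ t = 0 := by
  have h := sum_weight_deviation_sq hΔ2 hΦ hK hL.steps_pos
  rw [covariance, if_pos rfl, hσ, sub_self] at h
  rw [← sum_weight_deviation_zero_mul hΔ hΔ2 hL hΦ hK ht]
  refine Finset.sum_eq_zero fun c hc => ?_
  have hc0 := (Finset.sum_eq_zero_iff_of_nonneg fun c _ =>
    mul_nonneg (spectralWeight_nonneg Φ (a % 2) c) (mul_self_nonneg _)).mp h c hc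
  rcases mul_eq_zero.mp hc0 with h0 | h0
  · rw [h0, zero_mul]
  · rw [mul_self_eq_zero.mp h0, zero_mul, mul_zero]

/-- `κ` is the asymptotic variance per site divided by `⟨𝒦_≥⟩²`. -/
theorem kappa_eq (hΔ : 0 < Δ) (hΔ2 : Even Δ) (hL : IsLayout axis ξ Δ N m P a)
    (hΦ : IsResourceState ξ Φ) (hK : IsHomogeneous Φ (rotationSites a Δ m) σ K) (hσ : σ ≠ 0) :
    kappa σ K Δ m =
      (covariance σ K Δ 0 + 2 * ∑ t ∈ Finset.Ico 1 m, covariance σ K Δ t) / σ ^ 2 := by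
  by_cases h1 : σ ^ 2 = 1
  · rw [kappa, Finset.sum_eq_zero fun t ht =>
      covariance_eq_zero_of_sq hΔ hΔ2 hL hΦ hK ht h1, covariance, if_pos rfl, h1]
    norm_num
  · have h1' : 1 - σ ^ 2 ≠ 0 := fun h => h1 (by linarith)
    have hcorr : ∑ j ∈ Finset.Ico 1 m, corr σ K (j * Δ) =
        (∑ t ∈ Finset.Ico 1 m, covariance σ K Δ t) / (1 - σ ^ 2) := by
      rw [Finset.sum_div]
      refine Finset.sum_congr rfl fun t ht => ?_
      rw [Finset.mem_Ico] at ht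
      rw [corr, covariance, if_neg (by omega)]
    rw [kappa, hcorr, covariance, if_pos rfl]
    field_simp

/-- The variance of the sum of the deviations is `m` times the variance per site, up to a boundary term
that is bounded independently of `m`. -/
theorem abs_variance_sub_le (hΔ : 0 < Δ) (hΔ2 : Even Δ) (hL : IsLayout axis ξ Δ N m P a)
    (hΦ : IsResourceState ξ Φ) (hK : IsHomogeneous Φ (rotationSites a Δ m) σ K) :
    |∑ c, spectralWeight Φ (a % 2) c * (∑ j ∈ Finset.range m, deviation N a Δ σ j c) ^ 2 -
      m * (covariance σ K Δ 0 + 2 * ∑ t ∈ Finset.Ico 1 m, covariance σ K Δ t)| ≤ 32 * ξ ^ 2 := by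
  rw [sum_weight_sq, sum_sum_stationary
    (fun i j => ∑ c, spectralWeight Φ (a % 2) c * (deviation N a Δ σ i c * deviation N a Δ σ j c))
    (covariance σ K Δ) m
    (fun i j => Finset.sum_congr rfl fun c _ => by rw [mul_comm (deviation N a Δ σ i c)])
    (fun i hi => sum_weight_deviation_sq hΔ2 hΦ hK hi)
    (fun i j hij hj => sum_weight_deviation_mul hΔ hΔ2 hL hΦ hK hij hj)]
  have hsum : ∑ t ∈ Finset.Ico 1 m, ((m : ℝ) - t) * covariance σ K Δ t =
      m * ∑ t ∈ Finset.Ico 1 m, covariance σ K Δ t -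
        ∑ t ∈ Finset.Ico 1 m, (t : ℝ) * covariance σ K Δ t := by
    simp only [sub_mul, Finset.sum_sub_distrib, Finset.mul_sum]
  have hbound : |∑ t ∈ Finset.Ico 1 m, (t : ℝ) * covariance σ K Δ t| ≤
      (2 * ξ : ℕ) * (8 * ξ : ℝ) := by
    refine abs_sum_Ico_le (by positivity) (fun t ht => ?_) fun t ht hξ => by
      rw [covariance_eq_zero hΔ hΔ2 hL hΦ hK ht hξ, mul_zero]
    by_cases hξ : 2 * ξ < t
    · rw [covariance_eq_zero hΔ hΔ2 hL hΦ hK ht hξ, mul_zero, abs_zero]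
      positivity
    · have h4 := abs_covariance_le hΔ hΔ2 hL hΦ hK ht
      have ht2 : (t : ℝ) ≤ 2 * ξ := by exact_mod_cast not_lt.mp hξ
      rw [abs_mul, Nat.abs_cast]
      calc (t : ℝ) * |covariance σ K Δ t| ≤ (2 * ξ) * 4 :=
            mul_le_mul ht2 h4 (abs_nonneg _) (by positivity)
        _ = 8 * ξ := by ring
  rw [hsum]
  push_cast at hbound
  rw [show (m : ℝ) * covariance σ K Δ 0 + 2 * (m * ∑ t ∈ Finset.Ico 1 m, covariance σ K Δ t -
    ∑ t ∈ Finset.Ico 1 m, (t : ℝ) * covariance σ K Δ t) -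
      m * (covariance σ K Δ 0 + 2 * ∑ t ∈ Finset.Ico 1 m, covariance σ K Δ t) =
        -(2 * ∑ t ∈ Finset.Ico 1 m, (t : ℝ) * covariance σ K Δ t) by ring, abs_neg, abs_mul,
    abs_of_pos (by norm_num : (0 : ℝ) < 2)]
  linarith

theorem abs_kappa_mul_le (hΔ : 0 < Δ) (hΔ2 : Even Δ) (hL : IsLayout axis ξ Δ N m P a)
    (hΦ : IsResourceState ξ Φ) (hK : IsHomogeneous Φ (rotationSites a Δ m) σ K) (hσ : σ ≠ 0)
    (β : ℝ) : |β ^ 2 * kappa σ K Δ m / m| ≤ (β / σ) ^ 2 * (1 + 16 * ξ) / m := by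
  have hsum := abs_sum_Ico_le (d := 2 * ξ) (by norm_num : (0 : ℝ) ≤ 4)
    (fun t ht => abs_covariance_le hΔ hΔ2 hL hΦ hK ht)
    fun t ht h => covariance_eq_zero hΔ hΔ2 hL hΦ hK ht h
  push_cast at hsum
  have h0 : |covariance σ K Δ 0| ≤ 1 := by
    have h1 : σ ^ 2 ≤ 1 := (sq_le_one_iff_abs_le_one σ).mpr (abs_mean_le_one hL hΔ2 hΦ hK)
    rw [covariance, if_pos rfl, abs_le]
    constructor <;> nlinarith [sq_nonneg σ]
  have hV : |covariance σ K Δ 0 + 2 * ∑ t ∈ Finset.Ico 1 m, covariance σ K Δ t| ≤ 1 + 16 * ξ := by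
    refine (abs_add_le _ _).trans ?_
    rw [abs_mul, abs_of_pos (by norm_num : (0 : ℝ) < 2)]
    linarith
  have heq : β ^ 2 * kappa σ K Δ m / m = (β / σ) ^ 2 *
      (covariance σ K Δ 0 + 2 * ∑ t ∈ Finset.Ico 1 m, covariance σ K Δ t) / m := by
    rw [kappa_eq hΔ hΔ2 hL hΦ hK hσ]
    ring
  rw [heq, abs_div, abs_mul, Nat.abs_cast, abs_of_nonneg (sq_nonneg (β / σ))]
  gcongr

/-- The angle `β / (m ⟨𝒦_≥⟩)` is chosen such that the mean of the total rotation angle is `β`.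
Hence only the deviations contribute to the error. -/
theorem logicalError_eq_centered (hL : IsLayout axis ξ Δ N m P a) (hΔ : Even Δ)
    (hΦ : IsResourceState ξ Φ) (hσ : σ ≠ 0) (β : ℝ) :
    logicalError Φ axis a Δ m β σ = 2 * ‖∑ c, (spectralWeight Φ (a % 2) c : ℂ) *
      Complex.exp ((splitAngle β σ m * ∑ j ∈ Finset.range m, deviation N a Δ σ j c : ℝ) *
        Complex.I) - 1‖ := by
  have hm : (m : ℝ) ≠ 0 := Nat.cast_ne_zero.mpr hL.steps_pos.ne'
  have hphase : ∀ c, Complex.exp (((splitAngle β σ m *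
      ∑ j ∈ Finset.range m, stringValue N (a + j * Δ) c : ℝ) : ℂ) * Complex.I) =
      Complex.exp (β * Complex.I) * Complex.exp ((splitAngle β σ m *
        ∑ j ∈ Finset.range m, deviation N a Δ σ j c : ℝ) * Complex.I) := by
    intro c
    rw [← Complex.exp_add, ← add_mul, ← Complex.ofReal_add]
    congr 3
    simp only [deviation, Finset.sum_sub_distrib, Finset.sum_const, Finset.card_range,
      nsmul_eq_mul, splitAngle]
    field_simp
    ring
  rw [logicalError_eq hΦ hΔ]
  simp only [hphase]
  have hfac : ∑ c, (spectralWeight Φ (a % 2) c : ℂ) * (Complex.exp (β * Complex.I) *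
      Complex.exp ((splitAngle β σ m * ∑ j ∈ Finset.range m, deviation N a Δ σ j c : ℝ) *
        Complex.I)) - Complex.exp (β * Complex.I) =
      Complex.exp (β * Complex.I) * (∑ c, (spectralWeight Φ (a % 2) c : ℂ) *
        Complex.exp ((splitAngle β σ m * ∑ j ∈ Finset.range m, deviation N a Δ σ j c : ℝ) *
          Complex.I) - 1) := by
    rw [mul_sub, mul_one, Finset.mul_sum]
    congr 1
    exact Finset.sum_congr rfl fun c _ => by ring
  rw [hfac, norm_mul, Complex.norm_exp_ofReal_mul_I, one_mul]

/-- The constant in the error estimate. Its terms come from the third and the fourth moment of the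
sum of the deviations, and from the boundary terms in its variance. -/
noncomputable def errorConstant (ξ : ℕ) (b : ℝ) : ℝ :=
  |b| ^ 3 * (8 / 3 * (8 * ξ + 1) ^ 2) + b ^ 4 * (384 * (4 * ξ + 1) ^ 2) + b ^ 2 * (32 * ξ ^ 2)

theorem errorConstant_nonneg (ξ : ℕ) (b : ℝ) : 0 ≤ errorConstant ξ b := by
  have : 0 ≤ b ^ 4 := by positivity
  rw [errorConstant]
  positivity

theorem abs_logicalError_sub_le (hΔ : 0 < Δ) (hΔ2 : Even Δ) (hL : IsLayout axis ξ Δ N m P a)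
    (hΦ : IsResourceState ξ Φ) (hK : IsHomogeneous Φ (rotationSites a Δ m) σ K) (hσ : σ ≠ 0)
    (β : ℝ) : |logicalError Φ axis a Δ m β σ - β ^ 2 * kappa σ K Δ m / m| ≤
      errorConstant ξ (β / σ) / (m : ℝ) ^ 2 := by
  have hm : (0 : ℝ) < m := Nat.cast_pos.mpr hL.steps_pos
  have hw := spectralWeight_nonneg Φ (a % 2)
  have hw1 := sum_spectralWeight hΦ (a % 2)
  have hdep := finitelyDependent_deviation hΔ hΔ2 hL hΦ hK
  have hdev : ∀ j < m, ∀ c, |deviation N a Δ σ j c| ≤ 2 :=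
    fun j _ c => abs_deviation_le hL hΔ2 hΦ hK j c
  set w := spectralWeight Φ (a % 2) with hwdef
  set T : Config N → ℝ := fun c => ∑ j ∈ Finset.range m, deviation N a Δ σ j c with hT
  set V := covariance σ K Δ 0 + 2 * ∑ t ∈ Finset.Ico 1 m, covariance σ K Δ t with hVdef
  set g := splitAngle β σ m with hg
  set b := β / σ with hb
  have hgb : g = b / m := by
    rw [hg, hb, splitAngle, div_div, mul_comm]
  have hT1 : ∑ c, w c * T c = 0 := by
    simp only [hT, Finset.mul_sum]
    rw [Finset.sum_comm]
    exact Finset.sum_eq_zero fun j hj => sum_weight_deviation hΔ2 hΦ hK (Finset.mem_range.mp hj)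
  have h3 : |∑ c, w c * T c ^ 3| ≤ 8 * (4 * (2 * ξ : ℕ) + 1) ^ 2 * m :=
    abs_sum_weight_third_power_le hw hw1 hdev hdep
  have h4 : ∑ c, w c * T c ^ 4 ≤ 48 * (2 * (2 * ξ : ℕ) + 1) ^ 2 * m ^ 2 :=
    sum_weight_fourth_power_le hw hw1 hdev hdep
  have h2 : |∑ c, w c * T c ^ 2 - m * V| ≤ 32 * ξ ^ 2 := abs_variance_sub_le hΔ hΔ2 hL hΦ hK
  have h2nn : 0 ≤ ∑ c, w c * T c ^ 2 :=
    Finset.sum_nonneg fun c _ => mul_nonneg (hw c) (sq_nonneg _)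
  have hchar := norm_charFun_sub_le hw hw1 hT1 g
  set S := ∑ c, (w c : ℂ) * Complex.exp ((g * T c : ℝ) * Complex.I) with hS
  have hD : logicalError Φ axis a Δ m β σ = 2 * ‖S - 1‖ :=
    logicalError_eq_centered hL hΔ2 hΦ hσ β
  have hkap : β ^ 2 * kappa σ K Δ m / m = g ^ 2 * (m * V) := by
    rw [kappa_eq hΔ hΔ2 hL hΦ hK hσ, ← hVdef, hgb, hb]
    field_simp
  -- The leading term `-g² Var / 2` of `S - 1` is negative, so it determines the norm of `S - 1` up
  -- to the norm of the remainder.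
  have hlead : |2 * ‖S - 1‖ - g ^ 2 * ∑ c, w c * T c ^ 2| ≤
      2 * (|g| ^ 3 / 6 * |∑ c, w c * T c ^ 3| + 4 * g ^ 4 * ∑ c, w c * T c ^ 4) := by
    have hn : ‖((g ^ 2 / 2 * ∑ c, w c * T c ^ 2 : ℝ) : ℂ)‖ = g ^ 2 / 2 * ∑ c, w c * T c ^ 2 := by
      rw [Complex.norm_real, Real.norm_eq_abs, abs_of_nonneg (by positivity)]
    have htri := abs_norm_sub_norm_le (S - 1) (-((g ^ 2 / 2 * ∑ c, w c * T c ^ 2 : ℝ) : ℂ))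
    rw [norm_neg, hn, sub_neg_eq_add] at htri
    rw [show 2 * ‖S - 1‖ - g ^ 2 * ∑ c, w c * T c ^ 2 =
      2 * (‖S - 1‖ - g ^ 2 / 2 * ∑ c, w c * T c ^ 2) by ring, abs_mul,
      abs_of_pos (by norm_num : (0 : ℝ) < 2)]
    exact mul_le_mul_of_nonneg_left (htri.trans hchar) (by norm_num)
  have hvar : |g ^ 2 * ∑ c, w c * T c ^ 2 - g ^ 2 * (m * V)| ≤ g ^ 2 * (32 * ξ ^ 2) := by
    rw [← mul_sub, abs_mul, abs_of_nonneg (sq_nonneg g)]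
    exact mul_le_mul_of_nonneg_left h2 (sq_nonneg g)
  have hg3 := mul_le_mul_of_nonneg_left h3 (by positivity : 0 ≤ |g| ^ 3 / 6)
  have hg4 := mul_le_mul_of_nonneg_left h4 (by positivity : 0 ≤ 4 * g ^ 4)
  have hsum : 2 * (|g| ^ 3 / 6 * (8 * (4 * (2 * ξ : ℕ) + 1) ^ 2 * m) +
      4 * g ^ 4 * (48 * (2 * (2 * ξ : ℕ) + 1) ^ 2 * m ^ 2)) + g ^ 2 * (32 * ξ ^ 2) =
      errorConstant ξ b / (m : ℝ) ^ 2 := by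
    rw [hgb, abs_div, Nat.abs_cast, errorConstant]
    push_cast
    field_simp
    ring
  rw [hD, hkap, ← hsum]
  refine (abs_sub_le _ (g ^ 2 * ∑ c, w c * T c ^ 2) _).trans ?_
  linarith

theorem logicalError_le (hΔ : 0 < Δ) (hΔ2 : Even Δ) (hL : IsLayout axis ξ Δ N m P a)
    (hΦ : IsResourceState ξ Φ) (hK : IsHomogeneous Φ (rotationSites a Δ m) σ K) (hσ : σ ≠ 0)
    (β : ℝ) : logicalError Φ axis a Δ m β σ ≤
      ((β / σ) ^ 2 * (1 + 16 * ξ) + errorConstant ξ (β / σ)) / m := by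
  have hm : (1 : ℝ) ≤ m := Nat.one_le_cast.mpr hL.steps_pos
  have h1 := abs_logicalError_sub_le hΔ hΔ2 hL hΦ hK hσ β
  have h2 := abs_kappa_mul_le hΔ hΔ2 hL hΦ hK hσ β
  have h3 : errorConstant ξ (β / σ) / (m : ℝ) ^ 2 ≤ errorConstant ξ (β / σ) / m :=
    div_le_div_of_nonneg_left (errorConstant_nonneg _ _) (by linarith)
      (le_self_pow₀ hm (by norm_num))
  rw [add_div]
  linarith [(abs_le.mp h1).2, (abs_le.mp h2).2]

end Error

end ClusterMBQC

theorem theorem1 (axis : ClusterMBQC.Axis) (ξ Δ : ℕ) (hΔ : 0 < Δ) (hΔ_even : Even Δ)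
    (β σ : ℝ) (hσ : σ ≠ 0) :
    (∃ C : ℝ, ∀ (N m P a : ℕ) (Φ : ClusterMBQC.Vec N) (K : ℕ → ℝ),
      ClusterMBQC.IsLayout axis ξ Δ N m P a →
      ClusterMBQC.IsResourceState ξ Φ →
      ClusterMBQC.IsHomogeneous Φ (ClusterMBQC.rotationSites a Δ m) σ K →
      (∀ θ : ℕ → ℝ,
        ClusterMBQC.logicalState Φ
            (ClusterMBQC.rotationAngles θ P a Δ m (ClusterMBQC.splitAngle β σ m)) =
          ClusterMBQC.logicalOp Φ axis a Δ m (ClusterMBQC.splitAngle β σ m)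
            (ClusterMBQC.logicalState Φ (ClusterMBQC.inputAngles θ P))) ∧
      |ClusterMBQC.logicalError Φ axis a Δ m β σ
          - β ^ 2 * ClusterMBQC.kappa σ K Δ m / m| ≤ C / (m : ℝ) ^ 2) ∧
    (∀ ε : ℝ, 0 < ε → ∃ m₀ : ℕ, ∀ (N m P a : ℕ) (Φ : ClusterMBQC.Vec N) (K : ℕ → ℝ),
      m₀ ≤ m →
      ClusterMBQC.IsLayout axis ξ Δ N m P a →
      ClusterMBQC.IsResourceState ξ Φ →
      ClusterMBQC.IsHomogeneous Φ (ClusterMBQC.rotationSites a Δ m) σ K →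
      ClusterMBQC.logicalError Φ axis a Δ m β σ < ε) := by
  refine ⟨⟨ClusterMBQC.errorConstant ξ (β / σ), fun N m P a Φ K hL hΦ hK => ⟨fun θ => ?_, ?_⟩⟩, ?_⟩
  · exact ClusterMBQC.logicalState_rotationAngles hΔ hΔ_even hL hΦ θ _
  · exact ClusterMBQC.abs_logicalError_sub_le hΔ hΔ_even hL hΦ hK hσ β
  · intro ε hε
    obtain ⟨m₀, hm₀⟩ := exists_nat_gt
      (((β / σ) ^ 2 * (1 + 16 * ξ) + ClusterMBQC.errorConstant ξ (β / σ)) / ε)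
    refine ⟨m₀, fun N m P a Φ K hm hL hΦ hK => ?_⟩
    refine (ClusterMBQC.logicalError_le hΔ hΔ_even hL hΦ hK hσ β).trans_lt ?_
    have hmpos : (0 : ℝ) < m := Nat.cast_pos.mpr hL.steps_pos
    have hle : (m₀ : ℝ) ≤ m := Nat.cast_le.mpr hm
    rw [div_lt_iff₀ hε] at hm₀
    rw [div_lt_iff₀ hmpos, mul_comm ε]
    exact hm₀.trans_le (mul_le_mul_of_nonneg_right hle hε.le)
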